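/- Let $d\ge 1$ and let $\alpha=(\alpha_1,\dots,\alpha_d)$, $\beta=(\beta_1,\dots,\beta_d)\in\mathbb{R}^d$ with $\alpha_j,\beta_j\ge -1/2$ for all $j$. Let $\tilde P_n^{(a,b)}$ denote the Jacobi polynomial of degree $n$ with parameters $a,b$, normalized in $L^2([-1,1],(1-t)^a(1+t)^b\,dt)$, and for $\nu\in\mathbb{N}_0^d$, $x\in[-1,1]^d$ put $\tilde P_\nu(x)=\prod_{j=1}^d\tilde P_{\nu_j}^{(\alpha_j,\beta_j)}(x_j)$. For a function $\hat A:[0,\infty)^d\to\mathbb{C}$ supported in $[0,2]^d$, an integer $n\ge 1$, and $x,y\in[-1,1]^d$ set $$\Lambda_n(x,y)=\sum_{\nu\in\mathbb{N}_0^d}\hat A\Big(\frac{\nu}{n}\Big)\tilde P_\nu(x)\tilde P_\nu(y),$$ $$W(n;x)=\prod_{j=1}^d(1-x_j+n^{-2})^{\alpha_j+1/2}(1+x_j+n^{-2})^{\beta_j+1/2},\qquad \rho(x,y)=\max_{1\le j\le d}|\arccos x_j-\arccos y_j|.$$ Write $D_\ell$ for the partial derivative with respect to $t_\ell$ (one-sided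 where $t_\ell=0$) and $\|\cdot\|_\infty$ for the supremum norm on $[0,\infty)^d$. (i) Let $k\ge 1$ be an integer. Suppose that $\hat A\in C^{3k-1}([0,\infty)^d)$, that $\operatorname{supp}\hat A\subset[0,2]^d$, and that for every $1\le\ell\le d$ and every $t\in[0,2]^d$ with $t_\ell=0$ we have $D_\ell^m\hat A(t)=0$ for $m=1,2,\dots,3k-1$. Then $$|\Lambda_n(x,y)|\le \frac{c\,n^d}{\sqrt{W(n;x)}\sqrt{W(n;y)}}\,\big(1+n\rho(x,y)\big)^{-k},\qquad x,y\in[-1,1]^d,\ n\ge 1,$$ where the constant $c>0$ depends only on $k$, $d$, $\alpha$, $\beta$ and upper bounds for $\|D_\ell^{3k-1}\hat A\|_\infty$, $\ell=1,\dots,d$, but not on $x$, $y$ and $n$. (ii) Consequently, if $\hat A$ is admissible, i.e. $\hat A\in C^\infty([0,\infty)^d)$, $\operatorname{supp}\hat A\subset[0,2]^d$, and for every $\ell$ and every $t\in[0,\infty)^d$ with $t_\ell=0$ we have $D_\ell^m\hat A(t)=0$ for all $m\ge 1$, then for every real $k>0$ the same estimate holds with a constant $c>0$ independent of $x$, $y$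 and $n$. -/

import Mathlib

open scoped ContDiff

noncomputable section

namespace TensorJacobi

/-- The Jacobi polynomial `P_n^{(α,β)}`, with the classical normalization
`P_n^{(α,β)}(1) = binom (n+α) n`, as
`∑_{s ≤ n} binom (n+α) (n-s) * binom (n+β) s * ((x-1)/2)^s * ((x+1)/2)^(n-s)`. -/
def jacobiP (α β : ℝ) (n : ℕ) (x : ℝ) : ℝ :=
  ∑ s ∈ Finset.range (n + 1),
    Ring.choose ((n : ℝ) + α) (n - s) * Ring.choose ((n : ℝ) + β) s *
      ((x - 1) / 2) ^ s * ((x + 1) / 2) ^ (n - s)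

/-- The univariate Jacobi weight `(1-t)^α (1+t)^β` on `[-1,1]`. -/
def jacobiWeight (α β t : ℝ) : ℝ := (1 - t) ^ α * (1 + t) ^ β

/-- The squared norm of `P_n^{(α,β)}` in `L²([-1,1], (1-t)^α (1+t)^β)`. -/
def jacobiNormSq (α β : ℝ) (n : ℕ) : ℝ :=
  ∫ t in (-1 : ℝ)..1, jacobiP α β n t ^ 2 * jacobiWeight α β t

/-- The `L²`-normalized Jacobi polynomial. -/
def jacobiPn (α β : ℝ) (n : ℕ) (x : ℝ) : ℝ :=
  (Real.sqrt (jacobiNormSq α β n))⁻¹ * jacobiP α β n x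

/-- The tensor product `L²`-normalized Jacobi polynomial. -/
def tensorJacobi {d : ℕ} (α β : Fin d → ℝ) (ν : Fin d → ℕ) (x : Fin d → ℝ) : ℝ :=
  ∏ j, jacobiPn (α j) (β j) (ν j) (x j)

/-- The kernel `Λ_n(x,y) = ∑_ν A(ν/n) P̃_ν(x) P̃_ν(y)`. For `n ≥ 1` and `A` compactly supported
the sum has finitely many nonzero terms. -/
def kernel {d : ℕ} (α β : Fin d → ℝ) (A : (Fin d → ℝ) → ℂ) (n : ℕ) (x y : Fin d → ℝ) : ℂ :=
  ∑' ν : Fin d → ℕ,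
    A (fun j => (ν j : ℝ) / n) * (tensorJacobi α β ν x : ℂ) * (tensorJacobi α β ν y : ℂ)

/-- The weight `W_{α,β}(n;x)`, for `n ≥ 1`. -/
def bigW {d : ℕ} (α β : Fin d → ℝ) (n : ℕ) (x : Fin d → ℝ) : ℝ :=
  ∏ j, (1 - x j + ((n : ℝ) ^ 2)⁻¹) ^ (α j + 1 / 2) * (1 + x j + ((n : ℝ) ^ 2)⁻¹) ^ (β j + 1 / 2)

/-- The distance `max_j |arccos x_j - arccos y_j|` on `[-1,1]^d`, `d ≥ 1`. -/
def rho {d : ℕ} (x y : Fin d → ℝ) : ℝ :=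
  ⨆ j, |Real.arccos (x j) - Real.arccos (y j)|

/-- The closed orthant `[0,∞)^d`. -/
def orthant (d : ℕ) : Set (Fin d → ℝ) := {t | ∀ j, 0 ≤ t j}

/-- The partial derivative `D_ℓ^m A(t)` of a function on `[0,∞)^d`, one-sided where `t_ℓ = 0`. -/
def partialD {d : ℕ} (ℓ : Fin d) (m : ℕ) (A : (Fin d → ℝ) → ℂ) (t : Fin d → ℝ) : ℂ :=
  iteratedDerivWithin m (fun s => A (Function.update t ℓ s)) (Set.Ici 0) (t ℓ)

/-- `A`, as a function on `[0,∞)^d`, is supported in `[0,2]^d`. -/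
def SuppInCube {d : ℕ} (A : (Fin d → ℝ) → ℂ) : Prop :=
  ∀ t ∈ orthant d, A t ≠ 0 → ∀ j, t j ≤ 2

/-- `A` is of class `C^{3k-1}` on `[0,∞)^d`, supported in `[0,2]^d`, and for every `ℓ` the
derivatives `D_ℓ^m A`, `1 ≤ m ≤ 3k-1`, vanish on the part of `{t_ℓ = 0}` in `[0,2]^d`. Only the
values of `A` on `[0,∞)^d` matter. -/
structure IsCutoff {d : ℕ} (k : ℕ) (A : (Fin d → ℝ) → ℂ) : Prop where
  contDiffOn : ContDiffOn ℝ ((3 * k - 1 : ℕ) : ℕ∞) A (orthant d)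
  supp : SuppInCube A
  boundary : ∀ ℓ : Fin d, ∀ t ∈ orthant d, (∀ j, t j ≤ 2) → t ℓ = 0 →
    ∀ m : ℕ, 1 ≤ m → m ≤ 3 * k - 1 → partialD ℓ m A t = 0

/-- Admissible cutoff functions (of the first kind): `C^∞` on `[0,∞)^d`, supported in `[0,2]^d`,
with all `D_ℓ^m A`, `m ≥ 1`, vanishing on `{t_ℓ = 0}`. -/
structure IsAdmissible {d : ℕ} (A : (Fin d → ℝ) → ℂ) : Prop where
  contDiffOn : ContDiffOn ℝ ∞ A (orthant d)
  supp : SuppInCube A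
  boundary : ∀ ℓ : Fin d, ∀ t ∈ orthant d, t ℓ = 0 → ∀ m : ℕ, 1 ≤ m → partialD ℓ m A t = 0

end TensorJacobi

end

/-!
Multiply the univariate kernel by `x - y`. By the three-term recurrence, summation by parts and the
contiguous relation expressing `P_{ν+1}^{(α,β)}` through `P_ν^{(α,β)}` and
`(1 - x) P_ν^{(α+1,β)}`, the product is a sum of kernels of the same kind in which the multiplier is
replaced by its image under a first-order difference operator and `α` may be raised by one. Up to
symbols of order `-2` the recurrence coefficients do not depend on `α` and `β`, so each factor
`x - y` gains `q / n`, where `q` bounds `arccos x`, `arccos y` and `1 / n`. Since `|x - y|` is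
comparable to `(arccos x + arccos y) |arccos x - arccos y|` when `arccos x + arccos y ≤ π`, this
gives the decay there; the other half follows by the reflection `x ↦ -x`.

The pointwise bound of the Jacobi polynomials which this requires comes from an energy estimate for
the Liouville normal form of the Jacobi equation, and near the endpoints from the mean value
theorem.

In several variables, the sum over `ν` is an average of its sums over the lines parallel to the
coordinate axis in which `x` and `y` are farthest apart, each of which is a univariate kernel.
-/

noncomputable section

namespace TensorJacobi

/-! ### Jacobi polynomials: contiguous relations, differential equation, recurrence -/

section Contiguous

open Finset

section RingChoose

variable {R : Type*} [CommRing R] [BinomialRing R]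

lemma succ_mul_choose_succ_succ (r : R) (k : ℕ) :
    ((k : R) + 1) * Ring.choose (r + 1) (k + 1) = (r + 1) * Ring.choose r k := by
  simpa [Ring.choose_one_right, nsmul_eq_mul] using Ring.choose_add_smul_choose r k 1

lemma sub_mul_choose_succ (r : R) (k : ℕ) :
    (r + 1 - k) * Ring.choose (r + 1) k = (r + 1) * Ring.choose r k := by
  cases k with
  | zero => simp
  | succ k =>
    push_cast
    linear_combination (r + 1) * Ring.choose_succ_succ r k - succ_mul_choose_succ_succ r k

lemma succ_mul_choose_succ (r : R) (k : ℕ) :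
    ((k : R) + 1) * Ring.choose r (k + 1) = (r - k) * Ring.choose r k := by
  linear_combination succ_mul_choose_succ_succ r k - ((k : R) + 1) * Ring.choose_succ_succ r k

lemma choose_mul_choose_succ (a b : R) (s i : ℕ) :
    Ring.choose a i * Ring.choose b (s + 1) * ((s + 1) * (a - i)) =
      Ring.choose a (i + 1) * Ring.choose b s * ((i + 1) * (b - s)) := by
  linear_combination (a - i) * Ring.choose a i * succ_mul_choose_succ b s -
    (b - s) * Ring.choose b s * succ_mul_choose_succ a i

/-- The homogeneous form `∑_{s+i=n} binom a i * binom b s * X^s * Y^i` of degree `n`, from which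
`P_n^{(α,β)}(x)` arises at `X = (x-1)/2`, `Y = (x+1)/2`, `a = n+α`, `b = n+β`. -/
def jacobiForm (X Y : R) (n : ℕ) (a b : R) : R :=
  ∑ p ∈ antidiagonal n, Ring.choose a p.2 * Ring.choose b p.1 * X ^ p.1 * Y ^ p.2

lemma left_mul_jacobiForm (X Y : R) (n : ℕ) (a b : R) :
    X * jacobiForm X Y n a b = ∑ p ∈ antidiagonal (n + 1),
      Ring.choose a p.2 * (Ring.choose (b + 1) p.1 - Ring.choose b p.1) * X ^ p.1 * Y ^ p.2 := by
  rw [Finset.Nat.sum_antidiagonal_succ, jacobiForm, mul_sum]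
  simp only [Ring.choose_zero_right, Ring.choose_succ_succ, sub_self, mul_zero, zero_mul, zero_add]
  exact sum_congr rfl fun p _ => by ring

lemma right_mul_jacobiForm (X Y : R) (n : ℕ) (a b : R) :
    Y * jacobiForm X Y n a b = ∑ p ∈ antidiagonal (n + 1),
      (Ring.choose (a + 1) p.2 - Ring.choose a p.2) * Ring.choose b p.1 * X ^ p.1 * Y ^ p.2 := by
  rw [Finset.Nat.sum_antidiagonal_succ', jacobiForm, mul_sum]
  simp only [Ring.choose_zero_right, Ring.choose_succ_succ, sub_self, zero_mul, zero_add]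
  exact sum_congr rfl fun p _ => by ring

lemma left_mul_jacobiForm_succ (X Y : R) (n : ℕ) (a b : R) :
    -(a + b + 2) * (X * jacobiForm X Y n (a + 1) b) =
      (a + 1) * (Y * jacobiForm X Y n a b - X * jacobiForm X Y n a b) -
        (n + 1) * jacobiForm X Y (n + 1) (a + 1) (b + 1) := by
  rw [left_mul_jacobiForm, left_mul_jacobiForm, right_mul_jacobiForm, jacobiForm, mul_sum, mul_sum,
    ← sum_sub_distrib, mul_sum, ← sum_sub_distrib]
  refine sum_congr rfl fun p hp => ?_
  have degree_eq : (p.1 : R) + p.2 = n + 1 := by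
    exact_mod_cast congrArg (Nat.cast (R := R)) (mem_antidiagonal.mp hp)
  linear_combination (X ^ p.1 * Y ^ p.2) *
    (-(Ring.choose (b + 1) p.1) * sub_mul_choose_succ a p.2 -
      Ring.choose (a + 1) p.2 * sub_mul_choose_succ b p.1 -
      Ring.choose (a + 1) p.2 * Ring.choose (b + 1) p.1 * degree_eq)

lemma jacobiForm_succ_right (X Y : R) (n : ℕ) (a b : R) :
    (a + b + 2) * jacobiForm X Y (n + 1) a (b + 1) =
      (a + b + 1 - n) * jacobiForm X Y (n + 1) (a + 1) (b + 1) -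
        (b + 1) * (Y * jacobiForm X Y n a b - X * jacobiForm X Y n a b) := by
  rw [left_mul_jacobiForm, right_mul_jacobiForm, jacobiForm, jacobiForm, mul_sum, mul_sum,
    ← sum_sub_distrib, mul_sum, ← sum_sub_distrib]
  refine sum_congr rfl fun p hp => ?_
  have degree_eq : (p.1 : R) + p.2 = n + 1 := by
    exact_mod_cast congrArg (Nat.cast (R := R)) (mem_antidiagonal.mp hp)
  linear_combination (X ^ p.1 * Y ^ p.2) *
    (-(Ring.choose (b + 1) p.1) * sub_mul_choose_succ a p.2 -
      Ring.choose (a + 1) p.2 * sub_mul_choose_succ b p.1 -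
      Ring.choose (a + 1) p.2 * Ring.choose (b + 1) p.1 * degree_eq)

end RingChoose

lemma choose_pos_of_lt (k : ℕ) {r : ℝ} (hr : (k : ℝ) - 1 < r) : 0 < Ring.choose r k := by
  induction k with
  | zero => simp
  | succ k ih =>
    push_cast at hr
    have succ_mul_pos : 0 < ((k : ℝ) + 1) * Ring.choose r (k + 1) := by
      rw [succ_mul_choose_succ]
      exact mul_pos (by linarith) (ih (by linarith))
    exact (mul_pos_iff_of_pos_left (by positivity)).mp succ_mul_pos

lemma jacobiP_eq_jacobiForm (α β : ℝ) (n : ℕ) (x : ℝ) :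
    jacobiP α β n x = jacobiForm ((x - 1) / 2) ((x + 1) / 2) n (n + α) (n + β) := by
  rw [jacobiP, jacobiForm, Finset.Nat.sum_antidiagonal_eq_sum_range_succ
    (fun s i => Ring.choose (n + α) i * Ring.choose (n + β) s *
      ((x - 1) / 2) ^ s * ((x + 1) / 2) ^ i)]

lemma one_sub_mul_jacobiP_left_succ (α β : ℝ) (n : ℕ) (x : ℝ) :
    (n + (α + β) / 2 + 1) * ((1 - x) * jacobiP (α + 1) β n x) =
      (n + α + 1) * jacobiP α β n x - (n + 1) * jacobiP α β (n + 1) x := by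
  have h := left_mul_jacobiForm_succ ((x - 1) / 2) ((x + 1) / 2) n (n + α) (n + β)
  simp only [jacobiP_eq_jacobiForm]
  push_cast
  rw [show (n : ℝ) + (α + 1) = n + α + 1 by ring, show (n : ℝ) + 1 + α = n + α + 1 by ring,
    show (n : ℝ) + 1 + β = n + β + 1 by ring]
  linear_combination h

lemma jacobiP_succ_eq_sub_left_succ (α β : ℝ) (n : ℕ) (x : ℝ) :
    (2 * n + α + β + 3) * jacobiP α β (n + 1) x =
      (n + α + β + 2) * jacobiP (α + 1) β (n + 1) x -
        (n + β + 1) * jacobiP (α + 1) β n x := by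
  have h := jacobiForm_succ_right ((x - 1) / 2) ((x + 1) / 2) n (n + α + 1) (n + β)
  simp only [jacobiP_eq_jacobiForm]
  push_cast
  rw [show (n : ℝ) + (α + 1) = n + α + 1 by ring, show (n : ℝ) + 1 + α = n + α + 1 by ring,
    show (n : ℝ) + 1 + β = n + β + 1 by ring, show (n : ℝ) + 1 + (α + 1) = n + α + 1 + 1 by ring]
  linear_combination h

lemma jacobiP_zero (α β x : ℝ) : jacobiP α β 0 x = 1 := by
  simp [jacobiP]

lemma jacobiP_neg (α β : ℝ) (n : ℕ) (x : ℝ) :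
    jacobiP α β n (-x) = (-1) ^ n * jacobiP β α n x := by
  rw [jacobiP_eq_jacobiForm, jacobiP_eq_jacobiForm, jacobiForm, jacobiForm,
    ← Finset.Nat.sum_antidiagonal_swap, mul_sum]
  refine sum_congr rfl fun p hp => ?_
  rw [← mem_antidiagonal.mp hp, Prod.fst_swap, Prod.snd_swap,
    show (-x - 1) / 2 = -1 * ((x + 1) / 2) by ring, show (-x + 1) / 2 = -1 * ((x - 1) / 2) by ring,
    mul_pow, mul_pow, pow_add]
  ring

lemma jacobiP_one (α β : ℝ) (n : ℕ) : jacobiP α β n 1 = Ring.choose (n + α) n := by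
  rw [jacobiP, Finset.sum_eq_single 0 (fun s _ hs => by simp [hs]) (by simp)]
  norm_num

lemma jacobiP_one_pos {α : ℝ} (β : ℝ) (hα : -1 < α) (n : ℕ) : 0 < jacobiP α β n 1 := by
  rw [jacobiP_one]
  exact choose_pos_of_lt n (by linarith)

end Contiguous

section DifferentialEquation

open Finset Polynomial

/-- The polynomial `((X-1)/2)^s ((X+1)/2)^i`; those with `s + i = n` are the building blocks of the
Jacobi polynomials of degree `n`. -/
def halfMonomial (s i : ℕ) : ℝ[X] := (C (1 / 2) * (X - 1)) ^ s * (C (1 / 2) * (X + 1)) ^ i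

/-- The Jacobi polynomial `jacobiP` as an element of `ℝ[X]`; its derivatives are taken there. -/
def jacobiPoly (α β : ℝ) (n : ℕ) : ℝ[X] :=
  ∑ p ∈ antidiagonal n, C (Ring.choose (n + α) p.2 * Ring.choose (n + β) p.1) *
    halfMonomial p.1 p.2

lemma eval_jacobiPoly (α β : ℝ) (n : ℕ) (x : ℝ) :
    (jacobiPoly α β n).eval x = jacobiP α β n x := by
  rw [jacobiP_eq_jacobiForm, jacobiForm, jacobiPoly, eval_finsetSum]
  refine sum_congr rfl fun p _ => ?_
  simp only [halfMonomial, eval_mul, eval_C, eval_pow, eval_sub, eval_add, eval_X, eval_one,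
    one_div_mul_eq_div]
  ring

/-- The Jacobi differential operator `(1-x²) p'' + (β - α - (α+β+2) x) p' + μ p`. -/
def jacobiOp (α β μ : ℝ) (p : ℝ[X]) : ℝ[X] :=
  (1 - X ^ 2) * derivative (derivative p) +
    (C (β - α) - C (α + β + 2) * X) * derivative p + C μ * p

lemma jacobiOp_halfMonomial (α β : ℝ) (s i : ℕ) :
    jacobiOp α β ((s + i : ℝ) * (s + i + α + β + 1)) (halfMonomial s i) =
      C ((s : ℝ) * (s + α)) * (halfMonomial s i - halfMonomial (s - 1) (i + 1)) +
      C ((i : ℝ) * (i + β)) * (halfMonomial s i - halfMonomial (s + 1) (i - 1)) := by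
  refine Polynomial.funext fun x => ?_
  rcases s with _ | _ | s <;> rcases i with _ | _ | i <;>
  simp [jacobiOp, halfMonomial, derivative_mul, derivative_pow] <;> ring

lemma jacobiOp_sum_C_mul {ι : Type*} (t : Finset ι) (α β μ : ℝ) (c : ι → ℝ) (q : ι → ℝ[X]) :
    jacobiOp α β μ (∑ p ∈ t, C (c p) * q p) = ∑ p ∈ t, C (c p) * jacobiOp α β μ (q p) := by
  simp only [jacobiOp, derivative_sum, derivative_C_mul, mul_sum, ← sum_add_distrib]
  exact sum_congr rfl fun p _ => by ring

-- Each monomial maps to differences with its two neighbours; after shifting one of the two sums,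
-- `choose_mul_choose_succ` makes the coefficients cancel.
lemma jacobiOp_jacobiPoly (α β : ℝ) (n : ℕ) :
    jacobiOp α β (n * (n + α + β + 1)) (jacobiPoly α β n) = 0 := by
  have op_halfMonomial : ∀ p ∈ antidiagonal n,
      jacobiOp α β (n * (n + α + β + 1)) (halfMonomial p.1 p.2) = _ := fun p hp => by
    have hn : (n : ℝ) = p.1 + p.2 := by exact_mod_cast (mem_antidiagonal.mp hp).symm
    rw [hn, jacobiOp_halfMonomial]
  rw [jacobiPoly, jacobiOp_sum_C_mul,
    sum_congr rfl fun p hp => by rw [op_halfMonomial p hp, mul_add], sum_add_distrib]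
  cases n with
  | zero => simp
  | succ m =>
    rw [Finset.Nat.sum_antidiagonal_succ, Finset.Nat.sum_antidiagonal_succ']
    simp only [Nat.cast_zero, zero_mul, map_zero, mul_zero, zero_add]
    rw [← sum_add_distrib]
    refine sum_eq_zero fun p hp => ?_
    have hm : (m : ℝ) = p.1 + p.2 := by exact_mod_cast (mem_antidiagonal.mp hp).symm
    have coeff_eq := choose_mul_choose_succ ((m + 1 : ℕ) + α) ((m + 1 : ℕ) + β) p.1 p.2
    rw [show ((m + 1 : ℕ) + α - p.2 : ℝ) = (p.1 + 1 : ℕ) + α by push_cast; rw [hm]; ring,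
      show ((m + 1 : ℕ) + β - p.1 : ℝ) = (p.2 + 1 : ℕ) + β by push_cast; rw [hm]; ring,
      ← Nat.cast_succ, ← Nat.cast_succ] at coeff_eq
    simp only [Nat.add_sub_cancel]
    rw [← mul_assoc, ← mul_assoc, ← C_mul, ← C_mul, coeff_eq]
    ring

lemma hasDerivAt_jacobiP (α β : ℝ) (n : ℕ) (x : ℝ) :
    HasDerivAt (jacobiP α β n) ((derivative (jacobiPoly α β n)).eval x) x :=
  ((jacobiPoly α β n).hasDerivAt x).congr_of_eventuallyEq <|
    .of_forall fun t => (eval_jacobiPoly α β n t).symm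

lemma continuous_jacobiP (α β : ℝ) (n : ℕ) : Continuous (jacobiP α β n) :=
  continuous_iff_continuousAt.mpr fun x => (hasDerivAt_jacobiP α β n x).continuousAt

lemma jacobiP_differential_equation (α β : ℝ) (n : ℕ) (x : ℝ) :
    (1 - x ^ 2) * (derivative (derivative (jacobiPoly α β n))).eval x +
      (β - α - (α + β + 2) * x) * (derivative (jacobiPoly α β n)).eval x +
      n * (n + α + β + 1) * jacobiP α β n x = 0 := by
  have h := congrArg (eval x) (jacobiOp_jacobiPoly α β n)
  simpa only [jacobiOp, eval_add, eval_mul, eval_sub, eval_one, eval_pow, eval_X, eval_C,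
    eval_zero, eval_jacobiPoly] using h

end DifferentialEquation

section Recurrence

/-- The coefficient `A_n` of the recurrence `x P_n = A_n P_{n+1} + B_n P_n + C_n P_{n-1}`. At
`n = 0` the factor `n+α+β+1` is cancelled, so that `α + β = -1` is covered. -/
def recA (α β : ℝ) (n : ℕ) : ℝ :=
  if n = 0 then 2 / (α + β + 2) else
    2 * (n + 1) * (n + α + β + 1) / ((2 * n + α + β + 1) * (2 * n + α + β + 2))

/-- The coefficient `B_n` of the recurrence `x P_n = A_n P_{n+1} + B_n P_n + C_n P_{n-1}`. At
`n = 0` the factor `α+β` is cancelled, so that `α + β = 0` is covered. -/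
def recB (α β : ℝ) (n : ℕ) : ℝ :=
  if n = 0 then (β - α) / (α + β + 2) else
    (β ^ 2 - α ^ 2) / ((2 * n + α + β) * (2 * n + α + β + 2))

/-- The coefficient `C_{n+1}` (note the shift of the index) of the recurrence
`x P_n = A_n P_{n+1} + B_n P_n + C_n P_{n-1}`. -/
def recC (α β : ℝ) (n : ℕ) : ℝ :=
  2 * (n + 1 + α) * (n + 1 + β) / ((2 * n + α + β + 2) * (2 * n + α + β + 3))

lemma mul_jacobiP_zero {α β : ℝ} (h : -2 < α + β) (x : ℝ) :
    x * jacobiP α β 0 x = recA α β 0 * jacobiP α β 1 x + recB α β 0 * jacobiP α β 0 x := by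
  have raise := one_sub_mul_jacobiP_left_succ α β 0 x
  simp only [jacobiP_zero, recA, recB, if_true, Nat.cast_zero, zero_add, mul_one, one_mul]
    at raise ⊢
  have : α + β + 2 ≠ 0 := by linarith
  field_simp
  linear_combination (-2) * raise

lemma mul_jacobiP_succ {α β : ℝ} (h : -2 < α + β) (n : ℕ) (x : ℝ) :
    x * jacobiP α β (n + 1) x = recA α β (n + 1) * jacobiP α β (n + 2) x +
      recB α β (n + 1) * jacobiP α β (n + 1) x + recC α β n * jacobiP α β n x := by
  have raise_succ := one_sub_mul_jacobiP_left_succ α β (n + 1) x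
  have raise := one_sub_mul_jacobiP_left_succ α β n x
  have lower := jacobiP_succ_eq_sub_left_succ α β n x
  simp only [recA, recB, recC, Nat.succ_ne_zero, if_false]
  push_cast at raise_succ raise lower ⊢
  have : (0 : ℝ) ≤ n := n.cast_nonneg
  have : 2 * (n : ℝ) + α + β + 2 ≠ 0 := by linarith
  have : 2 * (n : ℝ) + α + β + 3 ≠ 0 := by linarith
  have : 2 * (n : ℝ) + α + β + 4 ≠ 0 := by linarith
  rw [show 2 * ((n : ℝ) + 1) + α + β + 1 = 2 * n + α + β + 3 by ring,
    show 2 * ((n : ℝ) + 1) + α + β + 2 = 2 * n + α + β + 4 by ring,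
    show 2 * ((n : ℝ) + 1) + α + β = 2 * n + α + β + 2 by ring]
  field_simp
  rw [show n + 1 + 1 = n + 2 from rfl] at raise_succ
  linear_combination -2 * (2 * n + α + β + 2) * (n + α + β + 2) * raise_succ +
    2 * (2 * n + α + β + 4) * (n + β + 1) * raise +
    (2 * n + α + β + 2) * (2 * n + α + β + 4) * (x - 1) * lower

end Recurrence

/-! ### Orthogonality and norms -/

section Orthogonality

open MeasureTheory
open Polynomial (derivative)

variable {α β : ℝ}

lemma jacobiWeight_nonneg (α β : ℝ) {t : ℝ} (ht : t ∈ Set.Icc (-1 : ℝ) 1) :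
    0 ≤ jacobiWeight α β t :=
  mul_nonneg (Real.rpow_nonneg (by linarith [ht.2]) _) (Real.rpow_nonneg (by linarith [ht.1]) _)

lemma jacobiWeight_pos (α β : ℝ) {t : ℝ} (ht : t ∈ Set.Ioo (-1 : ℝ) 1) :
    0 < jacobiWeight α β t :=
  mul_pos (Real.rpow_pos_of_pos (by linarith [ht.2]) _)
    (Real.rpow_pos_of_pos (by linarith [ht.1]) _)

lemma jacobiWeight_neg (α β t : ℝ) : jacobiWeight α β (-t) = jacobiWeight β α t := by
  rw [jacobiWeight, jacobiWeight, mul_comm, sub_neg_eq_add, ← sub_eq_add_neg]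

lemma jacobiWeight_left_succ (β : ℝ) (hα : -1 < α) (t : ℝ) :
    jacobiWeight (α + 1) β t = (1 - t) * jacobiWeight α β t := by
  rw [jacobiWeight, jacobiWeight]
  rcases eq_or_ne (1 - t) 0 with h | h
  · rw [h, Real.zero_rpow (by linarith)]; ring
  · rw [Real.rpow_add_one h]; ring

lemma intervalIntegrable_jacobiWeight_zero_one (β : ℝ) (hα : -1 < α) :
    IntervalIntegrable (jacobiWeight α β) volume 0 1 := by
  have singular_factor : IntervalIntegrable (fun t : ℝ => (1 - t) ^ α) volume 0 1 := by
    simpa using (intervalIntegral.intervalIntegrable_rpow' (a := 1) (b := 0) hα).comp_sub_left 1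
  refine singular_factor.mul_continuousOn <|
    ContinuousOn.rpow_const (by fun_prop) fun t ht => Or.inl ?_
  rw [Set.uIcc_of_le zero_le_one] at ht
  linarith [ht.1]

lemma intervalIntegrable_jacobiWeight (hα : -1 < α) (hβ : -1 < β) :
    IntervalIntegrable (jacobiWeight α β) volume (-1) 1 := by
  refine IntervalIntegrable.trans (b := 0) ?_ (intervalIntegrable_jacobiWeight_zero_one β hα)
  have h := (intervalIntegrable_jacobiWeight_zero_one α hβ).comp_sub_left 0
  simp only [zero_sub, sub_zero, jacobiWeight_neg] at h
  exact h.symm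

lemma intervalIntegrable_mul_jacobiWeight (hα : -1 < α) (hβ : -1 < β) {f : ℝ → ℝ}
    (hf : Continuous f) :
    IntervalIntegrable (fun t => f t * jacobiWeight α β t) volume (-1) 1 :=
  (intervalIntegrable_jacobiWeight hα hβ).continuousOn_mul hf.continuousOn

/-- The inner product of `L²([-1,1], (1-t)^α (1+t)^β dt)`. -/
def jacobiInner (α β : ℝ) (f g : ℝ → ℝ) : ℝ :=
  ∫ t in (-1 : ℝ)..1, f t * g t * jacobiWeight α β t

lemma jacobiInner_comm (α β : ℝ) (f g : ℝ → ℝ) : jacobiInner α β f g = jacobiInner α β g f := by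
  simp only [jacobiInner, mul_comm (f _)]

lemma jacobiInner_self (α β : ℝ) (n : ℕ) :
    jacobiInner α β (jacobiP α β n) (jacobiP α β n) = jacobiNormSq α β n := by
  simp only [jacobiInner, jacobiNormSq, sq]

lemma jacobiInner_id_mul_left (α β : ℝ) (f g : ℝ → ℝ) :
    jacobiInner α β (fun t => t * f t) g = jacobiInner α β (fun t => t * g t) f :=
  intervalIntegral.integral_congr fun t _ => by ring

lemma jacobiInner_add_mul_left (hα : -1 < α) (hβ : -1 < β) {f g h : ℝ → ℝ}
    (hf : Continuous f) (hg : Continuous g) (hh : Continuous h) (a b : ℝ) :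
    jacobiInner α β (fun t => a * f t + b * g t) h =
      a * jacobiInner α β f h + b * jacobiInner α β g h := by
  simp only [jacobiInner]
  rw [← intervalIntegral.integral_const_mul, ← intervalIntegral.integral_const_mul,
    ← intervalIntegral.integral_add]
  · exact intervalIntegral.integral_congr fun t _ => by ring
  · exact (intervalIntegrable_mul_jacobiWeight hα hβ (hf.mul hh)).const_mul a
  · exact (intervalIntegrable_mul_jacobiWeight hα hβ (hg.mul hh)).const_mul b

/-- The flux `(1-x)^{α+1} (1+x)^{β+1} P_n'(x)`, for which the Jacobi equation reads
`jacobiFlux' = -n (n+α+β+1) P_n * jacobiWeight`. -/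
def jacobiFlux (α β : ℝ) (n : ℕ) (x : ℝ) : ℝ :=
  (1 - x) ^ (α + 1) * (1 + x) ^ (β + 1) * (derivative (jacobiPoly α β n)).eval x

lemma continuous_jacobiFlux (hα : -1 < α) (hβ : -1 < β) (n : ℕ) :
    Continuous (jacobiFlux α β n) :=
  ((Continuous.rpow_const (by fun_prop) fun _ => Or.inr (by linarith)).mul
    (Continuous.rpow_const (by fun_prop) fun _ => Or.inr (by linarith))).mul
    (derivative (jacobiPoly α β n)).continuous

lemma jacobiFlux_one (hα : -1 < α) (β : ℝ) (n : ℕ) : jacobiFlux α β n 1 = 0 := by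
  rw [jacobiFlux, sub_self, Real.zero_rpow (by linarith), zero_mul, zero_mul]

lemma jacobiFlux_neg_one (α : ℝ) (hβ : -1 < β) (n : ℕ) : jacobiFlux α β n (-1) = 0 := by
  rw [jacobiFlux, add_neg_cancel, Real.zero_rpow (show β + 1 ≠ 0 by linarith), mul_zero, zero_mul]

lemma hasDerivAt_jacobiFlux (α β : ℝ) (n : ℕ) {x : ℝ} (hx : x ∈ Set.Ioo (-1 : ℝ) 1) :
    HasDerivAt (jacobiFlux α β n)
      (-(n * (n + α + β + 1)) * (jacobiP α β n x * jacobiWeight α β x)) x := by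
  have one_sub_ne : (1 - x) ≠ 0 := by linarith [hx.2]
  have one_add_ne : (1 + x) ≠ 0 := by linarith [hx.1]
  have deriv_left : HasDerivAt (fun x : ℝ => (1 - x) ^ (α + 1)) _ x :=
    ((hasDerivAt_const x (1 : ℝ)).sub (hasDerivAt_id x)).rpow_const (Or.inl one_sub_ne)
  have deriv_right : HasDerivAt (fun x : ℝ => (1 + x) ^ (β + 1)) _ x :=
    ((hasDerivAt_const x (1 : ℝ)).add (hasDerivAt_id x)).rpow_const (Or.inl one_add_ne)
  refine ((deriv_left.mul deriv_right).mul
    ((derivative (jacobiPoly α β n)).hasDerivAt x)).congr_deriv ?_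
  simp only [id, add_sub_cancel_right, Pi.sub_apply, Pi.add_apply, Pi.mul_apply]
  rw [Real.rpow_add_one one_sub_ne, Real.rpow_add_one one_add_ne, jacobiWeight]
  linear_combination ((1 - x) ^ α * (1 + x) ^ β) * jacobiP_differential_equation α β n x

lemma eigenvalue_sub_mul_jacobiInner (hα : -1 < α) (hβ : -1 < β) (n m : ℕ) :
    (m * (m + α + β + 1) - n * (n + α + β + 1)) *
      jacobiInner α β (jacobiP α β n) (jacobiP α β m) = 0 := by
  let wronskian : ℝ → ℝ := fun x =>
    jacobiFlux α β n x * jacobiP α β m x - jacobiFlux α β m x * jacobiP α β n x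
  have wronskian_continuous : Continuous wronskian :=
    ((continuous_jacobiFlux hα hβ n).mul (continuous_jacobiP α β m)).sub
      ((continuous_jacobiFlux hα hβ m).mul (continuous_jacobiP α β n))
  have wronskian_deriv : ∀ x ∈ Set.Ioo (-1 : ℝ) 1, HasDerivAt wronskian
      ((m * (m + α + β + 1) - n * (n + α + β + 1)) *
        (jacobiP α β n x * jacobiP α β m x * jacobiWeight α β x)) x := by
    intro x hx
    refine (((hasDerivAt_jacobiFlux α β n hx).mul (hasDerivAt_jacobiP α β m x)).sub
      ((hasDerivAt_jacobiFlux α β m hx).mul (hasDerivAt_jacobiP α β n x))).congr_deriv ?_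
    simp only [jacobiFlux]
    ring
  rw [jacobiInner, ← intervalIntegral.integral_const_mul,
    intervalIntegral.integral_eq_sub_of_hasDerivAt_of_le (by norm_num)
      wronskian_continuous.continuousOn wronskian_deriv
      ((intervalIntegrable_mul_jacobiWeight hα hβ
        ((continuous_jacobiP α β n).mul (continuous_jacobiP α β m))).const_mul _)]
  simp only [wronskian, jacobiFlux_one hα, jacobiFlux_neg_one α hβ, zero_mul, sub_self]

theorem jacobiInner_jacobiP_of_ne (hα : -1 < α) (hβ : -1 < β) {n m : ℕ} (h : n ≠ m) :
    jacobiInner α β (jacobiP α β n) (jacobiP α β m) = 0 := by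
  refine (mul_eq_zero.mp (eigenvalue_sub_mul_jacobiInner hα hβ n m)).resolve_left ?_
  have eigenvalue_sub : (m * (m + α + β + 1) - n * (n + α + β + 1) : ℝ) =
      ((m : ℝ) - n) * (m + n + α + β + 1) := by ring
  rw [eigenvalue_sub]
  refine mul_ne_zero (sub_ne_zero.mpr (by exact_mod_cast h.symm)) ?_
  have : (1 : ℝ) ≤ m + n := by exact_mod_cast (by omega : 1 ≤ m + n)
  linarith

lemma exists_jacobiP_pos_on_Ioo (β : ℝ) (hα : -1 < α) (n : ℕ) :
    ∃ a ∈ Set.Ioo (0 : ℝ) 1, ∀ t ∈ Set.Ioo a 1, 0 < jacobiP α β n t := by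
  have pos_near_one : ∀ᶠ t in nhdsWithin 1 (Set.Iio 1), 0 < jacobiP α β n t :=
    nhdsWithin_le_nhds ((continuous_jacobiP α β n).continuousAt.eventually_mem
      (Ioi_mem_nhds (jacobiP_one_pos β hα n)))
  obtain ⟨l, hl, h⟩ := (mem_nhdsLT_iff_exists_Ioo_subset' zero_lt_one).mp pos_near_one
  have hl1 : l < 1 := hl
  exact ⟨max l (1 / 2), ⟨by positivity, max_lt hl1 (by norm_num)⟩,
    fun t ht => h ⟨(le_max_left _ _).trans_lt ht.1, ht.2⟩⟩

lemma jacobiNormSq_pos (hα : -1 < α) (hβ : -1 < β) (n : ℕ) : 0 < jacobiNormSq α β n := by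
  obtain ⟨a, ha, hpos⟩ := exists_jacobiP_pos_on_Ioo β hα n
  have integrable := intervalIntegrable_mul_jacobiWeight hα hβ ((continuous_jacobiP α β n).pow 2)
  have tail_integrable : IntervalIntegrable (fun t => jacobiP α β n t ^ 2 * jacobiWeight α β t)
      volume a 1 := integrable.mono_set (by
        rw [Set.uIcc_of_le (by linarith [ha.2]), Set.uIcc_of_le (by norm_num)]
        exact Set.Icc_subset_Icc (by linarith [ha.1]) le_rfl)
  calc 0 < ∫ t in a..1, jacobiP α β n t ^ 2 * jacobiWeight α β t :=
        intervalIntegral.intervalIntegral_pos_of_pos_on tail_integrable (fun t ht =>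
          mul_pos (pow_pos (hpos t ht) 2)
            (jacobiWeight_pos α β ⟨by linarith [ht.1, ha.1], ht.2⟩)) ha.2
    _ ≤ jacobiNormSq α β n := by
        refine intervalIntegral.integral_mono_interval (by linarith [ha.1]) ha.2.le le_rfl
          ((ae_restrict_iff' measurableSet_Ioc).mpr (.of_forall fun t ht => ?_)) integrable
        exact mul_nonneg (sq_nonneg _) (jacobiWeight_nonneg α β ⟨ht.1.le, ht.2⟩)

lemma jacobiNormSq_swap (α β : ℝ) (n : ℕ) : jacobiNormSq α β n = jacobiNormSq β α n := by
  have reflect := intervalIntegral.integral_comp_neg (a := -1) (b := 1)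
    (fun t => jacobiP α β n t ^ 2 * jacobiWeight α β t)
  rw [neg_neg] at reflect
  rw [jacobiNormSq, ← reflect, jacobiNormSq]
  refine intervalIntegral.integral_congr fun t _ => ?_
  simp only [jacobiP_neg, jacobiWeight_neg, mul_pow]
  rw [pow_right_comm, neg_one_sq, one_pow, one_mul]

lemma jacobiInner_id_mul_jacobiP_zero (hα : -1 < α) (hβ : -1 < β) :
    jacobiInner α β (fun t => t * jacobiP α β 0 t) (jacobiP α β 1) =
      recA α β 0 * jacobiNormSq α β 1 := by
  have cont := continuous_jacobiP α β
  rw [funext (mul_jacobiP_zero (by linarith)),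
    jacobiInner_add_mul_left hα hβ (cont _) (cont _) (cont _),
    jacobiInner_jacobiP_of_ne hα hβ zero_ne_one, jacobiInner_self, mul_zero, add_zero]

lemma jacobiInner_id_mul_jacobiP_succ (hα : -1 < α) (hβ : -1 < β) (n : ℕ) {h : ℝ → ℝ}
    (hh : Continuous h) :
    jacobiInner α β (fun t => t * jacobiP α β (n + 1) t) h =
      recA α β (n + 1) * jacobiInner α β (jacobiP α β (n + 2)) h +
        recB α β (n + 1) * jacobiInner α β (jacobiP α β (n + 1)) h +
        recC α β n * jacobiInner α β (jacobiP α β n) h := by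
  have cont := continuous_jacobiP α β
  have split := jacobiInner_add_mul_left hα hβ (f := fun t => recA α β (n + 1) *
    jacobiP α β (n + 2) t + recB α β (n + 1) * jacobiP α β (n + 1) t)
    (((cont _).const_mul _).add ((cont _).const_mul _)) (cont n) hh 1 (recC α β n)
  simp only [one_mul] at split
  rw [funext (mul_jacobiP_succ (by linarith) n), split,
    jacobiInner_add_mul_left hα hβ (cont _) (cont _) hh]

-- Both sides are the inner product of `x P_n` with `P_{n+1}`.
theorem recA_mul_jacobiNormSq_succ (hα : -1 < α) (hβ : -1 < β) (n : ℕ) :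
    recA α β n * jacobiNormSq α β (n + 1) = recC α β n * jacobiNormSq α β n := by
  have cont := continuous_jacobiP α β
  have lower : jacobiInner α β (fun t => t * jacobiP α β (n + 1) t) (jacobiP α β n) =
      recC α β n * jacobiNormSq α β n := by
    rw [jacobiInner_id_mul_jacobiP_succ hα hβ n (cont n),
      jacobiInner_jacobiP_of_ne hα hβ (show n + 2 ≠ n by omega),
      jacobiInner_jacobiP_of_ne hα hβ (show n + 1 ≠ n by omega), jacobiInner_self]
    ring
  rw [← lower, ← jacobiInner_id_mul_left]
  cases n with
  | zero => rw [zero_add, jacobiInner_id_mul_jacobiP_zero hα hβ]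
  | succ n =>
    rw [jacobiInner_id_mul_jacobiP_succ hα hβ n (cont (n + 2)),
      jacobiInner_jacobiP_of_ne hα hβ (show n ≠ n + 2 by omega),
      jacobiInner_jacobiP_of_ne hα hβ (show n + 1 ≠ n + 2 by omega), jacobiInner_self]
    ring

lemma jacobiP_left_succ_succ (hα : -1 < α) (hβ : -1 < β) (n : ℕ) :
    jacobiP (α + 1) β (n + 1) = fun x =>
      ((2 * n + α + β + 3) / (n + α + β + 2)) * jacobiP α β (n + 1) x +
        ((n + β + 1) / (n + α + β + 2)) * jacobiP (α + 1) β n x := by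
  ext x
  have : (0 : ℝ) ≤ n := n.cast_nonneg
  have : (n : ℝ) + α + β + 2 ≠ 0 := by linarith
  field_simp
  linear_combination -jacobiP_succ_eq_sub_left_succ α β n x

lemma jacobiInner_left_succ_of_lt (hα : -1 < α) (hβ : -1 < β) {n m : ℕ} (h : n < m) :
    jacobiInner α β (jacobiP (α + 1) β n) (jacobiP α β m) = 0 := by
  have cont := continuous_jacobiP
  induction n with
  | zero =>
    rw [show jacobiP (α + 1) β 0 = jacobiP α β 0 from funext fun x => by simp only [jacobiP_zero]]
    exact jacobiInner_jacobiP_of_ne hα hβ h.ne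
  | succ n ih =>
    rw [jacobiP_left_succ_succ hα hβ, jacobiInner_add_mul_left hα hβ (cont _ _ _) (cont _ _ _)
      (cont _ _ _), ih (by omega), jacobiInner_jacobiP_of_ne hα hβ h.ne, mul_zero, mul_zero,
      add_zero]

lemma jacobiInner_left_succ_self_le (hα : -1 < α) (hβ : -1 < β) (hs : -1 ≤ α + β) (n : ℕ) :
    jacobiInner α β (jacobiP (α + 1) β n) (jacobiP α β n) ≤ 3 * jacobiNormSq α β n := by
  have normSq_pos := jacobiNormSq_pos hα hβ n
  have cont := continuous_jacobiP
  cases n with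
  | zero =>
    rw [show jacobiP (α + 1) β 0 = jacobiP α β 0 from funext fun x => by simp only [jacobiP_zero],
      jacobiInner_self]
    linarith
  | succ n =>
    have : (0 : ℝ) ≤ n := n.cast_nonneg
    rw [jacobiP_left_succ_succ hα hβ, jacobiInner_add_mul_left hα hβ (cont _ _ _) (cont _ _ _)
      (cont _ _ _), jacobiInner_left_succ_of_lt hα hβ (Nat.lt_succ_self n), jacobiInner_self,
      mul_zero, add_zero]
    gcongr
    rw [div_le_iff₀ (by linarith)]
    linarith

lemma jacobiNormSq_left_succ (hα : -1 < α) (hβ : -1 < β) (n : ℕ) :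
    (n + (α + β) / 2 + 1) * jacobiNormSq (α + 1) β n =
      (n + α + 1) * jacobiInner α β (jacobiP (α + 1) β n) (jacobiP α β n) := by
  have cont := continuous_jacobiP
  have move_factor : jacobiNormSq (α + 1) β n =
      jacobiInner α β (fun x => (1 - x) * jacobiP (α + 1) β n x) (jacobiP (α + 1) β n) := by
    refine intervalIntegral.integral_congr fun t _ => ?_
    simp only [jacobiWeight_left_succ β hα t]
    ring
  set D : ℝ := n + (α + β) / 2 + 1 with hD
  have hD0 : D ≠ 0 := by linarith [n.cast_nonneg (α := ℝ)]
  have expand : (fun x => (1 - x) * jacobiP (α + 1) β n x) = fun x =>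
      ((n + α + 1) / D) * jacobiP α β n x + (-(n + 1) / D) * jacobiP α β (n + 1) x := by
    ext x
    have := one_sub_mul_jacobiP_left_succ α β n x
    rw [← hD] at this
    field_simp
    linear_combination this
  rw [move_factor, expand, jacobiInner_add_mul_left hα hβ (cont _ _ _) (cont _ _ _) (cont _ _ _),
    jacobiInner_comm α β (jacobiP α β (n + 1)), jacobiInner_comm α β (jacobiP α β n),
    jacobiInner_left_succ_of_lt hα hβ (Nat.lt_succ_self n)]
  field_simp
  ring

lemma jacobiNormSq_left_succ_le (hα : -1 < α) (hβ : -1 < β) (hs : -1 ≤ α + β) (n : ℕ) :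
    jacobiNormSq (α + 1) β n ≤ 6 * (|α| + 2) * jacobiNormSq α β n := by
  have : (0 : ℝ) ≤ n := n.cast_nonneg
  have normSq_pos := jacobiNormSq_pos hα hβ n
  have ratio_le : (n + α + 1 : ℝ) ≤ 2 * (|α| + 2) * (n + (α + β) / 2 + 1) := by
    nlinarith [le_abs_self α, abs_nonneg α]
  refine le_of_mul_le_mul_left ?_ (show 0 < (n : ℝ) + (α + β) / 2 + 1 by linarith)
  calc (n + (α + β) / 2 + 1) * jacobiNormSq (α + 1) β n
      ≤ (n + α + 1) * (3 * jacobiNormSq α β n) := by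
        rw [jacobiNormSq_left_succ hα hβ]
        exact mul_le_mul_of_nonneg_left (jacobiInner_left_succ_self_le hα hβ hs n) (by linarith)
    _ ≤ 2 * (|α| + 2) * (n + (α + β) / 2 + 1) * (3 * jacobiNormSq α β n) := by gcongr
    _ = (n + (α + β) / 2 + 1) * (6 * (|α| + 2) * jacobiNormSq α β n) := by ring

lemma exists_jacobiNormSq_left_add_le (hα : -1 < α) (hβ : -1 < β) (hs : -1 ≤ α + β) (i : ℕ) :
    ∃ C : ℝ, 0 < C ∧ ∀ n, jacobiNormSq (α + i) β n ≤ C * jacobiNormSq α β n := by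
  induction i with
  | zero => exact ⟨1, one_pos, fun n => by simp⟩
  | succ i ih =>
    obtain ⟨C, hC, h⟩ := ih
    have : (0 : ℝ) ≤ i := i.cast_nonneg
    refine ⟨6 * (|α + i| + 2) * C, by positivity, fun n => ?_⟩
    push_cast
    rw [← add_assoc, mul_assoc]
    exact (jacobiNormSq_left_succ_le (by linarith) hβ (by linarith) n).trans
      (by gcongr; exact h n)

end Orthogonality

/-! ### The Liouville normal form in the trigonometric variable -/

section LiouvilleForm

open Real
open Polynomial (derivative)

/-- The Jacobi weight in the variable `x = cos θ`, including the Jacobian `sin θ`. -/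
def trigWeight (α β θ : ℝ) : ℝ := (1 - cos θ) ^ (α + 1 / 2) * (1 + cos θ) ^ (β + 1 / 2)

/-- Half the logarithmic derivative of `trigWeight`, the first-order coefficient removed by the
Liouville transformation. -/
def trigDrift (α β θ : ℝ) : ℝ := ((α - β) + (α + β + 1) * cos θ) / (2 * sin θ)

/-- The derivative of `trigDrift`. -/
def trigDriftDeriv (α β θ : ℝ) : ℝ := -((α + β + 1) + (α - β) * cos θ) / (2 * sin θ ^ 2)

/-- The potential `V` of the Liouville normal form `u'' = V u` satisfied by
`u = √(trigWeight) * P_n(cos θ)`. -/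
def trigPotential (α β : ℝ) (n : ℕ) (θ : ℝ) : ℝ :=
  trigDrift α β θ ^ 2 + trigDriftDeriv α β θ - n * (n + α + β + 1)

/-- The derivative `u' / √(trigWeight)` of the Liouville normal form
`u = √(trigWeight) * P_n(cos θ)`. -/
def trigSlope (α β : ℝ) (n : ℕ) (θ : ℝ) : ℝ :=
  -sin θ * (derivative (jacobiPoly α β n)).eval (cos θ) + trigDrift α β θ * jacobiP α β n (cos θ)

/-- The energy `u'² + (n+1)² u²` of the Liouville normal form. -/
def trigEnergy (α β : ℝ) (n : ℕ) (θ : ℝ) : ℝ :=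
  trigWeight α β θ *
    (trigSlope α β n θ ^ 2 + ((n : ℝ) + 1) ^ 2 * jacobiP α β n (cos θ) ^ 2)

lemma cos_mem_Ioo {θ : ℝ} (hθ : θ ∈ Set.Ioo 0 π) : cos θ ∈ Set.Ioo (-1 : ℝ) 1 := by
  have := sin_pos_of_mem_Ioo hθ
  have := sin_sq_add_cos_sq θ
  constructor <;> nlinarith

lemma trigWeight_pos (α β : ℝ) {θ : ℝ} (hθ : θ ∈ Set.Ioo 0 π) : 0 < trigWeight α β θ :=
  have hcos := cos_mem_Ioo hθ
  mul_pos (rpow_pos_of_pos (by linarith [hcos.2]) _) (rpow_pos_of_pos (by linarith [hcos.1]) _)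

lemma trigEnergy_nonneg (α β : ℝ) (n : ℕ) {θ : ℝ} (hθ : θ ∈ Set.Ioo 0 π) :
    0 ≤ trigEnergy α β n θ := by
  have := trigWeight_pos α β hθ
  unfold trigEnergy
  positivity

lemma hasDerivAt_trigWeight (α β : ℝ) {θ : ℝ} (hθ : θ ∈ Set.Ioo 0 π) :
    HasDerivAt (trigWeight α β) (2 * trigDrift α β θ * trigWeight α β θ) θ := by
  have hcos := cos_mem_Ioo hθ
  have hsub : 1 - cos θ ≠ 0 := by linarith [hcos.2]
  have hadd : 1 + cos θ ≠ 0 := by linarith [hcos.1]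
  have hsin : sin θ ≠ 0 := (sin_pos_of_mem_Ioo hθ).ne'
  have hderiv_left : HasDerivAt (fun x : ℝ => (1 - cos x) ^ (α + 1 / 2)) _ θ :=
    ((hasDerivAt_cos θ).const_sub 1).rpow_const (Or.inl hsub)
  have hderiv_right : HasDerivAt (fun x : ℝ => (1 + cos x) ^ (β + 1 / 2)) _ θ :=
    ((hasDerivAt_cos θ).const_add 1).rpow_const (Or.inl hadd)
  refine (hderiv_left.mul hderiv_right).congr_deriv ?_
  rw [rpow_sub_one hsub, rpow_sub_one hadd, trigDrift, trigWeight]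
  have hsin_sq : sin θ ^ 2 = (1 - cos θ) * (1 + cos θ) := by
    linear_combination sin_sq_add_cos_sq θ
  generalize (1 - cos θ) ^ (α + 1 / 2) = U
  generalize (1 + cos θ) ^ (β + 1 / 2) = V
  field_simp
  linear_combination ((α * 2 + 1) * (1 + cos θ) - (β * 2 + 1) * (1 - cos θ)) * U * V * hsin_sq

lemma hasDerivAt_trigDrift (α β : ℝ) {θ : ℝ} (hθ : θ ∈ Set.Ioo 0 π) :
    HasDerivAt (trigDrift α β) (trigDriftDeriv α β θ) θ := by
  have hsin : sin θ ≠ 0 := (sin_pos_of_mem_Ioo hθ).ne'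
  refine ((((hasDerivAt_cos θ).const_mul (α + β + 1)).const_add (α - β)).div
    ((hasDerivAt_sin θ).const_mul 2) (mul_ne_zero two_ne_zero hsin)).congr_deriv ?_
  rw [trigDriftDeriv]
  field_simp
  linear_combination (-(α + β + 1)) * sin_sq_add_cos_sq θ

lemma hasDerivAt_jacobiP_cos (α β : ℝ) (n : ℕ) (θ : ℝ) :
    HasDerivAt (fun θ => jacobiP α β n (cos θ))
      (trigSlope α β n θ - trigDrift α β θ * jacobiP α β n (cos θ)) θ := by
  refine ((hasDerivAt_jacobiP α β n (cos θ)).comp θ (hasDerivAt_cos θ)).congr_deriv ?_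
  rw [trigSlope]
  ring

lemma hasDerivAt_trigSlope (α β : ℝ) (n : ℕ) {θ : ℝ} (hθ : θ ∈ Set.Ioo 0 π) :
    HasDerivAt (trigSlope α β n) (-trigDrift α β θ * trigSlope α β n θ +
      trigPotential α β n θ * jacobiP α β n (cos θ)) θ := by
  have hsin : sin θ ≠ 0 := (sin_pos_of_mem_Ioo hθ).ne'
  have hderiv := ((derivative (jacobiPoly α β n)).hasDerivAt (cos θ)).comp θ (hasDerivAt_cos θ)
  refine ((((hasDerivAt_sin θ).neg).mul hderiv).add
    ((hasDerivAt_trigDrift α β hθ).mul (hasDerivAt_jacobiP_cos α β n θ))).congr_deriv ?_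
  have hdrift : 2 * trigDrift α β θ * sin θ = (α - β) + (α + β + 1) * cos θ := by
    rw [trigDrift]; field_simp
  simp only [Function.comp, trigPotential, trigSlope, Pi.neg_apply]
  linear_combination jacobiP_differential_equation α β n (cos θ) -
    (derivative (jacobiPoly α β n)).eval (cos θ) * hdrift +
    (derivative (derivative (jacobiPoly α β n))).eval (cos θ) * sin_sq_add_cos_sq θ

lemma hasDerivAt_trigEnergy (α β : ℝ) (n : ℕ) {θ : ℝ} (hθ : θ ∈ Set.Ioo 0 π) :
    HasDerivAt (trigEnergy α β n) (2 * trigWeight α β θ * jacobiP α β n (cos θ) *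
      trigSlope α β n θ * (trigPotential α β n θ + ((n : ℝ) + 1) ^ 2)) θ := by
  refine ((hasDerivAt_trigWeight α β hθ).mul (((hasDerivAt_trigSlope α β n hθ).pow 2).add
    (((hasDerivAt_jacobiP_cos α β n θ).pow 2).const_mul
      (((n : ℝ) + 1) ^ 2)))).congr_deriv ?_
  simp only [Pi.add_apply, Pi.pow_apply, Nat.cast_ofNat, Nat.add_one_sub_one, pow_one]
  ring

/-- The constant bounding the part of `trigPotential` that is independent of the degree. -/
def driftConst (α β : ℝ) : ℝ := (|α - β| + |α + β + 1|) ^ 2 + (|α - β| + |α + β + 1|)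

/-- The constant bounding the difference between `(n + 1)²` and the eigenvalue
`n * (n + α + β + 1)`, relative to `n + 1`. -/
def shiftConst (α β : ℝ) : ℝ := 2 + |α + β|

lemma driftConst_nonneg (α β : ℝ) : 0 ≤ driftConst α β := by
  unfold driftConst; positivity

lemma shiftConst_nonneg (α β : ℝ) : 0 ≤ shiftConst α β := by
  unfold shiftConst; positivity

lemma abs_add_mul_cos_le (a b θ : ℝ) : |a + b * cos θ| ≤ |a| + |b| :=
  (abs_add_le _ _).trans <| by
    rw [abs_mul]
    gcongr
    exact mul_le_of_le_one_right (abs_nonneg b) (abs_cos_le_one θ)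

lemma abs_sq_trigDrift_add_trigDriftDeriv_le (α β : ℝ) {θ : ℝ} (hθ : θ ∈ Set.Ioo 0 π) :
    |trigDrift α β θ ^ 2 + trigDriftDeriv α β θ| ≤ driftConst α β / sin θ ^ 2 := by
  have hsin := sin_pos_of_mem_Ioo hθ
  have hdrift := abs_add_mul_cos_le (α - β) (α + β + 1) θ
  have hdriftDeriv := abs_le.mp (abs_add_mul_cos_le (α + β + 1) (α - β) θ)
  have hdrift_sq := (sq_abs ((α - β) + (α + β + 1) * cos θ)).symm.trans_le
    (pow_le_pow_left₀ (abs_nonneg _) hdrift 2)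
  have hcommon : trigDrift α β θ ^ 2 + trigDriftDeriv α β θ =
      (((α - β) + (α + β + 1) * cos θ) ^ 2 / 4 - ((α + β + 1) + (α - β) * cos θ) / 2) /
        sin θ ^ 2 := by
    rw [trigDrift, trigDriftDeriv]
    field_simp
    ring
  rw [hcommon, abs_div, abs_of_pos (show 0 < sin θ ^ 2 by positivity)]
  gcongr
  rw [driftConst, abs_le]
  constructor <;> nlinarith [sq_nonneg ((α - β) + (α + β + 1) * cos θ)]

lemma abs_succ_sq_sub_eigenvalue_le (α β : ℝ) (n : ℕ) :
    |((n : ℝ) + 1) ^ 2 - n * (n + α + β + 1)| ≤ shiftConst α β * (n + 1) := by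
  have : (0 : ℝ) ≤ n := n.cast_nonneg
  have habs := abs_le.mp (le_refl |α + β|)
  rw [shiftConst, abs_le]
  constructor <;> nlinarith [habs.1, habs.2, abs_nonneg (α + β)]

lemma abs_trigPotential_add_le (α β : ℝ) (n : ℕ) {θ : ℝ} (hθ : θ ∈ Set.Ioo 0 π) :
    |trigPotential α β n θ + ((n : ℝ) + 1) ^ 2| ≤
      driftConst α β / sin θ ^ 2 + shiftConst α β * (n + 1) := by
  rw [trigPotential, sub_add_eq_add_sub, add_sub_assoc]
  exact (abs_add_le _ _).trans (add_le_add (abs_sq_trigDrift_add_trigDriftDeriv_le α β hθ)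
    (abs_succ_sq_sub_eigenvalue_le α β n))

lemma abs_two_mul_trigWeight_mul_le (α β : ℝ) (n : ℕ) {θ : ℝ} (hθ : θ ∈ Set.Ioo 0 π) :
    |2 * trigWeight α β θ * jacobiP α β n (cos θ) * trigSlope α β n θ| ≤
      trigEnergy α β n θ / (n + 1) := by
  have hn : (0 : ℝ) < n + 1 := by positivity
  have hweight := (trigWeight_pos α β hθ).le
  rw [le_div_iff₀ hn, trigEnergy, ← abs_of_pos hn, ← abs_mul, abs_of_pos hn, abs_le]
  constructor
  · nlinarith [mul_nonneg hweight (sq_nonneg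
      (trigSlope α β n θ + ((n : ℝ) + 1) * jacobiP α β n (cos θ)))]
  · nlinarith [mul_nonneg hweight (sq_nonneg
      (trigSlope α β n θ - ((n : ℝ) + 1) * jacobiP α β n (cos θ)))]

lemma abs_deriv_trigEnergy_le (α β : ℝ) (n : ℕ) {θ : ℝ} (hθ : θ ∈ Set.Ioo 0 π) :
    |2 * trigWeight α β θ * jacobiP α β n (cos θ) *
      trigSlope α β n θ * (trigPotential α β n θ + ((n : ℝ) + 1) ^ 2)| ≤
    (driftConst α β / (n + 1) / sin θ ^ 2 + shiftConst α β) * trigEnergy α β n θ := by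
  have := trigEnergy_nonneg α β n hθ
  calc _ ≤ trigEnergy α β n θ / (n + 1) *
        (driftConst α β / sin θ ^ 2 + shiftConst α β * (n + 1)) := by
        rw [abs_mul]
        exact mul_le_mul (abs_two_mul_trigWeight_mul_le α β n hθ)
          (abs_trigPotential_add_le α β n hθ) (abs_nonneg _) (by positivity)
    _ = _ := by
      field_simp

lemma le_mul_exp_sub_of_neg_deriv_le {f f' ψ ψ' : ℝ → ℝ} {a b : ℝ}
    (hf : ∀ x ∈ Set.Ioo a b, HasDerivAt f (f' x) x)
    (hψ : ∀ x ∈ Set.Ioo a b, HasDerivAt ψ (ψ' x) x)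
    (hle : ∀ x ∈ Set.Ioo a b, -(ψ' x * f x) ≤ f' x) {x y : ℝ}
    (hx : x ∈ Set.Ioo a b) (hy : y ∈ Set.Ioo a b) (hxy : x ≤ y) :
    f x ≤ f y * exp (ψ y - ψ x) := by
  have hderiv : ∀ x ∈ Set.Ioo a b, HasDerivAt (fun x => f x * exp (ψ x)) _ x :=
    fun x hx => (hf x hx).mul (hψ x hx).exp
  have hmono : MonotoneOn (fun x => f x * exp (ψ x)) (Set.Ioo a b) := by
    refine monotoneOn_of_deriv_nonneg (convex_Ioo _ _)
      (fun x hx => (hderiv x hx).continuousAt.continuousWithinAt) ?_ ?_ <;> rw [interior_Ioo]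
    · exact fun x hx => (hderiv x hx).differentiableAt.differentiableWithinAt
    · intro x hx
      rw [(hderiv x hx).deriv]
      nlinarith [hle x hx, exp_pos (ψ x)]
  rw [exp_sub, ← mul_div_assoc, le_div_iff₀ (exp_pos _)]
  exact hmono hx hy hxy

lemma hasDerivAt_cos_div_sin {θ : ℝ} (hsin : sin θ ≠ 0) :
    HasDerivAt (fun θ => cos θ / sin θ) (-1 / sin θ ^ 2) θ := by
  refine ((hasDerivAt_cos θ).div (hasDerivAt_sin θ) hsin).congr_deriv ?_
  rw [show -sin θ * sin θ - cos θ * cos θ = -1 by linear_combination -sin_sq_add_cos_sq θ]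

theorem trigEnergy_le_mul_exp (α β : ℝ) (n : ℕ) {θ φ : ℝ} (hθ : 0 < θ) (hθφ : θ ≤ φ)
    (hφ : φ < π) :
    trigEnergy α β n θ ≤ trigEnergy α β n φ *
      exp (driftConst α β / (n + 1) * (cos θ / sin θ - cos φ / sin φ) +
        shiftConst α β * (φ - θ)) := by
  have hexponent : ∀ x ∈ Set.Ioo 0 π, HasDerivAt
      (fun x => -(driftConst α β / (n + 1)) * (cos x / sin x) + shiftConst α β * x)
      (driftConst α β / (n + 1) / sin x ^ 2 + shiftConst α β) x := fun x hx =>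
    (((hasDerivAt_cos_div_sin (sin_pos_of_mem_Ioo hx).ne').const_mul _).add
      ((hasDerivAt_id x).const_mul (shiftConst α β))).congr_deriv (by ring)
  convert le_mul_exp_sub_of_neg_deriv_le (fun x hx => hasDerivAt_trigEnergy α β n hx) hexponent
    (fun x hx => (abs_le.mp (abs_deriv_trigEnergy_le α β n hx)).1)
    ⟨hθ, hθφ.trans_lt hφ⟩ ⟨hθ.trans_le hθφ, hφ⟩ hθφ using 3
  ring

end LiouvilleForm

/-! ### The pointwise bound away from the endpoints -/

section InteriorBound

open Real MeasureTheory

lemma trigWeight_eq_jacobiWeight_mul_sin (α β : ℝ) {θ : ℝ} (hθ : θ ∈ Set.Ioo 0 π) :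
    trigWeight α β θ = jacobiWeight α β (cos θ) * sin θ := by
  have hcos := cos_mem_Ioo hθ
  have hsub : 0 < 1 - cos θ := by linarith [hcos.2]
  have hadd : 0 < 1 + cos θ := by linarith [hcos.1]
  have hsin : sin θ = (1 - cos θ) ^ (1 / 2 : ℝ) * (1 + cos θ) ^ (1 / 2 : ℝ) := by
    rw [← mul_rpow hsub.le hadd.le, ← sqrt_eq_rpow, eq_comm,
      sqrt_eq_iff_eq_sq (by positivity) (sin_pos_of_mem_Ioo hθ).le]
    linear_combination -sin_sq_add_cos_sq θ
  rw [trigWeight, jacobiWeight, rpow_add hsub, rpow_add hadd, hsin]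
  ring

lemma continuousOn_jacobiWeight (α β : ℝ) :
    ContinuousOn (jacobiWeight α β) (Set.Ioo (-1) 1) := by
  unfold jacobiWeight
  refine ContinuousOn.mul (ContinuousOn.rpow_const (by fun_prop) fun t ht => Or.inl ?_)
    (ContinuousOn.rpow_const (by fun_prop) fun t ht => Or.inl ?_)
  · linarith [ht.2]
  · linarith [ht.1]

lemma integral_trigWeight_mul_jacobiP_cos_sq (α β : ℝ) (n : ℕ) {a b : ℝ} (ha : 0 < a)
    (hab : a ≤ b) (hb : b < π) :
    ∫ θ in a..b, trigWeight α β θ * jacobiP α β n (cos θ) ^ 2 =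
      ∫ t in cos b..cos a, jacobiP α β n t ^ 2 * jacobiWeight α β t := by
  have hmem : ∀ θ ∈ Set.uIcc a b, θ ∈ Set.Ioo 0 π := by
    rw [Set.uIcc_of_le hab]
    exact Set.Icc_subset_Ioo ha hb
  have hcont : ContinuousOn (fun t => jacobiP α β n t ^ 2 * jacobiWeight α β t)
      (cos '' Set.uIcc a b) :=
    ((continuous_jacobiP α β n).pow 2).continuousOn.mul <|
      (continuousOn_jacobiWeight α β).mono (Set.image_subset_iff.mpr fun θ hθ =>
        cos_mem_Ioo (hmem θ hθ))
  rw [intervalIntegral.integral_symm (cos a), ← intervalIntegral.integral_comp_mul_deriv'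
    (fun θ _ => hasDerivAt_cos θ) continuous_sin.neg.continuousOn hcont,
    ← intervalIntegral.integral_neg]
  refine intervalIntegral.integral_congr fun θ hθ => ?_
  simp only [Function.comp, trigWeight_eq_jacobiWeight_mul_sin α β (hmem θ hθ)]
  ring

lemma integral_trigWeight_mul_jacobiP_cos_sq_le {α β : ℝ} (hα : -1 < α) (hβ : -1 < β) (n : ℕ)
    {a b : ℝ} (ha : 0 < a) (hab : a ≤ b) (hb : b < π) :
    ∫ θ in a..b, trigWeight α β θ * jacobiP α β n (cos θ) ^ 2 ≤ jacobiNormSq α β n := by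
  rw [integral_trigWeight_mul_jacobiP_cos_sq α β n ha hab hb, jacobiNormSq]
  refine intervalIntegral.integral_mono_interval (neg_one_le_cos b)
    (cos_le_cos_of_nonneg_of_le_pi ha.le hb.le hab) (cos_le_one a) ?_
    (intervalIntegrable_mul_jacobiWeight hα hβ ((continuous_jacobiP α β n).pow 2))
  refine (ae_restrict_iff' measurableSet_Ioc).mpr (.of_forall fun t ht => ?_)
  exact mul_nonneg (sq_nonneg _) (jacobiWeight_nonneg α β ⟨ht.1.le, ht.2⟩)

lemma pi_div_two_le : π / 2 ≤ 2 * π / 3 := by linarith [pi_pos]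

lemma mem_Ioo_of_mem_middle {θ : ℝ} (hθ : θ ∈ Set.Icc (π / 2) (2 * π / 3)) :
    θ ∈ Set.Ioo 0 π :=
  ⟨by linarith [hθ.1, pi_pos], by linarith [hθ.2, pi_pos]⟩

lemma cos_mem_Icc_of_mem_middle {θ : ℝ} (hθ : θ ∈ Set.Icc (π / 2) (2 * π / 3)) :
    cos θ ∈ Set.Icc (-1 / 2 : ℝ) 0 := by
  have := pi_pos
  constructor
  · rw [show (-1 / 2 : ℝ) = cos (2 * π / 3) by
      rw [show 2 * π / 3 = π - π / 3 by ring, cos_pi_sub, cos_pi_div_three]; norm_num]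
    exact cos_le_cos_of_nonneg_of_le_pi (by linarith [hθ.1]) (by linarith) hθ.2
  · exact cos_nonpos_of_pi_div_two_le_of_le hθ.1 (by linarith [hθ.2])

lemma three_quarters_le_sin_sq {θ : ℝ} (hθ : θ ∈ Set.Icc (π / 2) (2 * π / 3)) :
    3 / 4 ≤ sin θ ^ 2 := by
  have hcos := cos_mem_Icc_of_mem_middle hθ
  nlinarith [hcos.1, hcos.2, sin_sq_add_cos_sq θ]

lemma continuousOn_middle {f f' : ℝ → ℝ} (h : ∀ θ ∈ Set.Ioo 0 π, HasDerivAt f (f' θ) θ) :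
    ContinuousOn f (Set.Icc (π / 2) (2 * π / 3)) :=
  fun θ hθ => (h θ (mem_Ioo_of_mem_middle hθ)).continuousAt.continuousWithinAt

/-- A bump vanishing at the ends of the middle interval `[π/2, 2π/3]`, used to localize the
energy identity there. -/
def middleBump (θ : ℝ) : ℝ := (θ - π / 2) * (2 * π / 3 - θ)

lemma hasDerivAt_middleBump (θ : ℝ) :
    HasDerivAt middleBump (π / 2 + 2 * π / 3 - 2 * θ) θ :=
  (((hasDerivAt_id θ).sub_const (π / 2)).mul
    ((hasDerivAt_id θ).const_sub (2 * π / 3))).congr_deriv (by simp only [id]; ring)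

lemma continuous_middleBump : Continuous middleBump := by
  unfold middleBump; fun_prop

lemma middleBump_sq_le_one {θ : ℝ} (hθ : θ ∈ Set.Icc (π / 2) (2 * π / 3)) :
    middleBump θ ^ 2 ≤ 1 := by
  have := pi_lt_four
  refine pow_le_one₀ (mul_nonneg (by linarith [hθ.1]) (by linarith [hθ.2])) ?_
  exact mul_le_one₀ (by linarith [hθ.2]) (by linarith [hθ.2]) (by linarith [hθ.1])

lemma deriv_middleBump_sq_le_one {θ : ℝ} (hθ : θ ∈ Set.Icc (π / 2) (2 * π / 3)) :
    (π / 2 + 2 * π / 3 - 2 * θ) ^ 2 ≤ 1 := by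
  have := pi_lt_four
  rw [sq_le_one_iff_abs_le_one, abs_le]
  constructor <;> linarith [hθ.1, hθ.2]

lemma integral_middleBump_sq_pos : 0 < ∫ θ in (π / 2)..(2 * π / 3), middleBump θ ^ 2 := by
  refine intervalIntegral.intervalIntegral_pos_of_pos_on
    ((continuous_middleBump.pow 2).intervalIntegrable _ _) (fun θ hθ => ?_)
    (by linarith [pi_pos])
  exact pow_pos (mul_pos (by linarith [hθ.1]) (by linarith [hθ.2])) 2

/-- The derivative of the localized product `η² u u'`, where `η = middleBump` and
`u = √(trigWeight) * P_n(cos θ)` is the Liouville normal form. -/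
def trigCrossDeriv (α β : ℝ) (n : ℕ) (θ : ℝ) : ℝ :=
  2 * middleBump θ * (π / 2 + 2 * π / 3 - 2 * θ) *
      (trigWeight α β θ * jacobiP α β n (cos θ) * trigSlope α β n θ) +
    middleBump θ ^ 2 * (trigWeight α β θ * (trigSlope α β n θ ^ 2 +
      trigPotential α β n θ * jacobiP α β n (cos θ) ^ 2))

lemma hasDerivAt_trigCross (α β : ℝ) (n : ℕ) {θ : ℝ} (hθ : θ ∈ Set.Ioo 0 π) :
    HasDerivAt (fun θ => middleBump θ ^ 2 *
      (trigWeight α β θ * jacobiP α β n (cos θ) * trigSlope α β n θ))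
      (trigCrossDeriv α β n θ) θ := by
  refine (((hasDerivAt_middleBump θ).pow 2).mul (((hasDerivAt_trigWeight α β hθ).mul
    (hasDerivAt_jacobiP_cos α β n θ)).mul (hasDerivAt_trigSlope α β n hθ))).congr_deriv ?_
  simp only [trigCrossDeriv, Pi.mul_apply, Pi.pow_apply, Nat.cast_ofNat, Nat.add_one_sub_one,
    pow_one]
  ring

lemma continuousOn_trigPotential (α β : ℝ) (n : ℕ) :
    ContinuousOn (trigPotential α β n) (Set.Icc (π / 2) (2 * π / 3)) := by
  have hdrift := continuousOn_middle fun θ hθ => hasDerivAt_trigDrift α β hθ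
  have hdriftDeriv : ContinuousOn (trigDriftDeriv α β) (Set.Icc (π / 2) (2 * π / 3)) := by
    unfold trigDriftDeriv
    refine ContinuousOn.div (by fun_prop) (by fun_prop) fun θ hθ => ?_
    have := three_quarters_le_sin_sq hθ
    positivity
  unfold trigPotential
  exact ((hdrift.pow 2).add hdriftDeriv).sub continuousOn_const

lemma intervalIntegrable_trigCrossDeriv (α β : ℝ) (n : ℕ) :
    IntervalIntegrable (trigCrossDeriv α β n) volume (π / 2) (2 * π / 3) := by
  have hweight := continuousOn_middle fun θ hθ => hasDerivAt_trigWeight α β hθ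
  have hslope := continuousOn_middle fun θ hθ => hasDerivAt_trigSlope α β n hθ
  have hjacobi := continuousOn_middle fun θ _ => hasDerivAt_jacobiP_cos α β n θ
  have hbump := continuous_middleBump.continuousOn (s := Set.Icc (π / 2) (2 * π / 3))
  refine ContinuousOn.intervalIntegrable_of_Icc pi_div_two_le ?_
  unfold trigCrossDeriv
  exact (((continuousOn_const.mul hbump).mul (by fun_prop)).mul
      ((hweight.mul hjacobi).mul hslope)).add
    ((hbump.pow 2).mul (hweight.mul
      ((hslope.pow 2).add ((continuousOn_trigPotential α β n).mul (hjacobi.pow 2)))))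

lemma intervalIntegrable_trigWeight_mul_jacobiP_cos_sq (α β : ℝ) (n : ℕ) :
    IntervalIntegrable (fun θ => trigWeight α β θ * jacobiP α β n (cos θ) ^ 2) volume
      (π / 2) (2 * π / 3) :=
  ContinuousOn.intervalIntegrable_of_Icc pi_div_two_le <|
    (continuousOn_middle fun _ hθ => hasDerivAt_trigWeight α β hθ).mul
      ((continuousOn_middle fun θ _ => hasDerivAt_jacobiP_cos α β n θ).pow 2)

lemma intervalIntegrable_middleBump_sq_mul_trigEnergy (α β : ℝ) (n : ℕ) :
    IntervalIntegrable (fun θ => middleBump θ ^ 2 / 2 * trigEnergy α β n θ) volume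
      (π / 2) (2 * π / 3) :=
  ContinuousOn.intervalIntegrable_of_Icc pi_div_two_le <|
    ((continuous_middleBump.pow 2).div_const 2).continuousOn.mul
      (continuousOn_middle fun _ hθ => hasDerivAt_trigEnergy α β n hθ)

lemma integral_trigCrossDeriv (α β : ℝ) (n : ℕ) :
    ∫ θ in (π / 2)..(2 * π / 3), trigCrossDeriv α β n θ = 0 := by
  rw [intervalIntegral.integral_eq_sub_of_hasDerivAt (f := fun θ => middleBump θ ^ 2 *
      (trigWeight α β θ * jacobiP α β n (cos θ) * trigSlope α β n θ)) ?_
      (intervalIntegrable_trigCrossDeriv α β n)]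
  · simp [middleBump]
  · intro θ hθ
    rw [Set.uIcc_of_le pi_div_two_le] at hθ
    exact hasDerivAt_trigCross α β n (mem_Ioo_of_mem_middle hθ)

/-- The constant of the local energy estimate `middleBump_sq_mul_trigEnergy_le`. -/
def localConst (α β : ℝ) : ℝ := 4 + 2 * driftConst α β + shiftConst α β

lemma localConst_pos (α β : ℝ) : 0 < localConst α β := by
  have := driftConst_nonneg α β
  have := shiftConst_nonneg α β
  unfold localConst
  positivity

lemma abs_trigPotential_le (α β : ℝ) (n : ℕ) {θ : ℝ} (hθ : θ ∈ Set.Icc (π / 2) (2 * π / 3)) :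
    |trigPotential α β n θ| ≤
      2 * driftConst α β + ((n : ℝ) + 1) ^ 2 + shiftConst α β * (n + 1) := by
  have hshifted := abs_trigPotential_add_le α β n (mem_Ioo_of_mem_middle hθ)
  have hsin := three_quarters_le_sin_sq hθ
  have hdrift : driftConst α β / sin θ ^ 2 ≤ 2 * driftConst α β := by
    rw [div_le_iff₀ (by linarith)]
    nlinarith [driftConst_nonneg α β]
  rw [abs_le] at hshifted ⊢
  constructor <;> linarith [hshifted.1, hshifted.2, sq_nonneg ((n : ℝ) + 1)]

lemma middleBump_coeff_le_localConst (α β : ℝ) (n : ℕ) {θ : ℝ}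
    (hθ : θ ∈ Set.Icc (π / 2) (2 * π / 3)) :
    2 * (π / 2 + 2 * π / 3 - 2 * θ) ^ 2 + middleBump θ ^ 2 * |trigPotential α β n θ| +
        middleBump θ ^ 2 * ((n : ℝ) + 1) ^ 2 / 2 ≤ localConst α β * ((n : ℝ) + 1) ^ 2 := by
  have hn : (1 : ℝ) ≤ n + 1 := by linarith [n.cast_nonneg (α := ℝ)]
  have hn_sq : (n : ℝ) + 1 ≤ (n + 1) ^ 2 := by nlinarith
  have hbump := middleBump_sq_le_one hθ
  have := deriv_middleBump_sq_le_one hθ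
  have := abs_trigPotential_le α β n hθ
  have : middleBump θ ^ 2 * |trigPotential α β n θ| ≤ |trigPotential α β n θ| :=
    mul_le_of_le_one_left (abs_nonneg _) hbump
  have : middleBump θ ^ 2 * ((n : ℝ) + 1) ^ 2 ≤ ((n : ℝ) + 1) ^ 2 :=
    mul_le_of_le_one_left (sq_nonneg _) hbump
  have : shiftConst α β * ((n : ℝ) + 1) ≤ shiftConst α β * ((n : ℝ) + 1) ^ 2 :=
    mul_le_mul_of_nonneg_left hn_sq (shiftConst_nonneg α β)
  have : driftConst α β ≤ driftConst α β * ((n : ℝ) + 1) ^ 2 :=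
    le_mul_of_one_le_right (driftConst_nonneg α β) (hn.trans hn_sq)
  unfold localConst
  linarith

lemma middleBump_sq_mul_trigEnergy_le (α β : ℝ) (n : ℕ) {θ : ℝ}
    (hθ : θ ∈ Set.Icc (π / 2) (2 * π / 3)) :
    middleBump θ ^ 2 / 2 * trigEnergy α β n θ ≤ trigCrossDeriv α β n θ +
      localConst α β * ((n : ℝ) + 1) ^ 2 * (trigWeight α β θ * jacobiP α β n (cos θ) ^ 2) := by
  have hweight := (trigWeight_pos α β (mem_Ioo_of_mem_middle hθ)).le
  have hcoeff := sub_nonneg.mpr (middleBump_coeff_le_localConst α β n hθ)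
  rw [trigEnergy, trigCrossDeriv]
  set η := middleBump θ
  set η' := π / 2 + 2 * π / 3 - 2 * θ
  set V := trigPotential α β n θ
  set P := jacobiP α β n (cos θ)
  set S := trigSlope α β n θ
  have hV : 0 ≤ V + |V| := by linarith [neg_abs_le V]
  -- completing the square in the cross term `2 η η' P S`
  have hsquare : 0 ≤ (η * S + 2 * η' * P) ^ 2 / 2 + η ^ 2 * (V + |V|) * P ^ 2 +
      (localConst α β * ((n : ℝ) + 1) ^ 2 -
        (2 * η' ^ 2 + η ^ 2 * |V| + η ^ 2 * ((n : ℝ) + 1) ^ 2 / 2)) * P ^ 2 := by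
    positivity
  linarith [mul_nonneg hweight hsquare]

lemma integral_middleBump_sq_mul_trigEnergy_le {α β : ℝ} (hα : -1 < α) (hβ : -1 < β) (n : ℕ) :
    ∫ θ in (π / 2)..(2 * π / 3), middleBump θ ^ 2 / 2 * trigEnergy α β n θ ≤
      localConst α β * ((n : ℝ) + 1) ^ 2 * jacobiNormSq α β n := by
  have hcross := intervalIntegrable_trigCrossDeriv α β n
  have hjacobi := (intervalIntegrable_trigWeight_mul_jacobiP_cos_sq α β n).const_mul
    (localConst α β * ((n : ℝ) + 1) ^ 2)
  have := localConst_pos α β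
  calc _ ≤ ∫ θ in (π / 2)..(2 * π / 3), (trigCrossDeriv α β n θ + localConst α β *
          ((n : ℝ) + 1) ^ 2 * (trigWeight α β θ * jacobiP α β n (cos θ) ^ 2)) :=
        intervalIntegral.integral_mono_on pi_div_two_le
          (intervalIntegrable_middleBump_sq_mul_trigEnergy α β n) (hcross.add hjacobi)
          fun θ hθ => middleBump_sq_mul_trigEnergy_le α β n hθ
    _ = localConst α β * ((n : ℝ) + 1) ^ 2 *
          ∫ θ in (π / 2)..(2 * π / 3), trigWeight α β θ * jacobiP α β n (cos θ) ^ 2 := by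
        rw [intervalIntegral.integral_add hcross hjacobi, integral_trigCrossDeriv,
          intervalIntegral.integral_const_mul, zero_add]
    _ ≤ _ := by
        gcongr
        exact integral_trigWeight_mul_jacobiP_cos_sq_le hα hβ n (by positivity) pi_div_two_le
          (by linarith [pi_pos])

/-- The exponent in the comparison of the energy on `{θ | δ ≤ (n + 1) * sin θ}` with the energy
on the middle interval. -/
def energyExponent (α β δ : ℝ) : ℝ := driftConst α β * (1 / δ + 1) + shiftConst α β * 4

lemma cot_sub_cot_le {δ : ℝ} (hδ : 0 < δ) (n : ℕ) {θ φ : ℝ} (hsin : 0 < sin θ)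
    (hn : δ ≤ ((n : ℝ) + 1) * sin θ) (hφ : φ ∈ Set.Icc (π / 2) (2 * π / 3)) :
    cos θ / sin θ - cos φ / sin φ ≤ (1 / δ + 1) * (n + 1) := by
  have hcos := cos_mem_Icc_of_mem_middle hφ
  have hsinφ := sin_pos_of_mem_Ioo (mem_Ioo_of_mem_middle hφ)
  have : (0 : ℝ) ≤ n := n.cast_nonneg
  have : cos θ / sin θ ≤ (n + 1) / δ := by
    rw [div_le_div_iff₀ hsin hδ]
    nlinarith [cos_le_one θ]
  have : -(cos φ / sin φ) ≤ 1 := by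
    rw [← neg_div, div_le_one hsinφ]
    nlinarith [hcos.1, hcos.2, sin_sq_add_cos_sq φ]
  rw [add_mul, one_div_mul_eq_div]
  linarith

lemma trigEnergy_le_mul_exp_energyExponent (α β : ℝ) {δ : ℝ} (hδ : 0 < δ) (n : ℕ) {θ φ : ℝ}
    (hθ : θ ∈ Set.Ioc 0 (π / 2)) (hn : δ ≤ ((n : ℝ) + 1) * sin θ)
    (hφ : φ ∈ Set.Icc (π / 2) (2 * π / 3)) :
    trigEnergy α β n θ ≤ trigEnergy α β n φ * exp (energyExponent α β δ) := by
  have hφ' := mem_Ioo_of_mem_middle hφ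
  have := driftConst_nonneg α β
  have := trigEnergy_nonneg α β n hφ'
  have hsin := sin_pos_of_mem_Ioo (x := θ) ⟨hθ.1, by linarith [hθ.2, pi_pos]⟩
  refine (trigEnergy_le_mul_exp α β n hθ.1 (hθ.2.trans hφ.1) hφ'.2).trans ?_
  gcongr
  refine add_le_add ?_ (mul_le_mul_of_nonneg_left ?_ (shiftConst_nonneg α β))
  · calc driftConst α β / (n + 1) * (cos θ / sin θ - cos φ / sin φ)
        ≤ driftConst α β / (n + 1) * ((1 / δ + 1) * (n + 1)) := by
          gcongr
          exact cot_sub_cot_le hδ n hsin hn hφ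
      _ = driftConst α β * (1 / δ + 1) := by field_simp
  · linarith [hφ.2, hθ.1, pi_lt_four]

lemma sq_mul_trigWeight_mul_le_trigEnergy (α β : ℝ) (n : ℕ) {θ : ℝ} (hθ : θ ∈ Set.Ioo 0 π) :
    ((n : ℝ) + 1) ^ 2 * (trigWeight α β θ * jacobiP α β n (cos θ) ^ 2) ≤
      trigEnergy α β n θ := by
  have := mul_nonneg (trigWeight_pos α β hθ).le (sq_nonneg (trigSlope α β n θ))
  unfold trigEnergy
  linarith

theorem exists_trigWeight_mul_jacobiP_cos_sq_le {α β : ℝ} (hα : -1 < α) (hβ : -1 < β) {δ : ℝ}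
    (hδ : 0 < δ) :
    ∃ C : ℝ, 0 < C ∧ ∀ (n : ℕ) (θ : ℝ), θ ∈ Set.Ioc 0 (π / 2) → δ ≤ ((n : ℝ) + 1) * sin θ →
      trigWeight α β θ * jacobiP α β n (cos θ) ^ 2 ≤ C * jacobiNormSq α β n := by
  set B := exp (energyExponent α β δ)
  have : 0 < B := exp_pos _
  set c₀ : ℝ := ∫ θ in (π / 2)..(2 * π / 3), middleBump θ ^ 2
  have hc₀ : 0 < c₀ := integral_middleBump_sq_pos
  have := localConst_pos α β
  refine ⟨2 * localConst α β * B / c₀, by positivity, fun n θ hθ hn => ?_⟩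
  have hθ' : θ ∈ Set.Ioo 0 π := ⟨hθ.1, by linarith [hθ.2, pi_pos]⟩
  have haverage : c₀ * trigEnergy α β n θ / (2 * B) ≤
      localConst α β * ((n : ℝ) + 1) ^ 2 * jacobiNormSq α β n :=
    calc c₀ * trigEnergy α β n θ / (2 * B)
        = ∫ φ in (π / 2)..(2 * π / 3), middleBump φ ^ 2 * (trigEnergy α β n θ / (2 * B)) := by
          rw [intervalIntegral.integral_mul_const, mul_div_assoc]
      _ ≤ ∫ φ in (π / 2)..(2 * π / 3), middleBump φ ^ 2 / 2 * trigEnergy α β n φ := by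
          refine intervalIntegral.integral_mono_on pi_div_two_le
            (((continuous_middleBump.pow 2).mul continuous_const).intervalIntegrable _ _)
            (intervalIntegrable_middleBump_sq_mul_trigEnergy α β n) fun φ hφ => ?_
          rw [← mul_div_assoc, div_mul_eq_mul_div, div_le_div_iff₀ (by positivity) two_pos]
          nlinarith [mul_le_mul_of_nonneg_left
            (trigEnergy_le_mul_exp_energyExponent α β hδ n hθ hn hφ) (sq_nonneg (middleBump φ))]
      _ ≤ _ := integral_middleBump_sq_mul_trigEnergy_le hα hβ n
  rw [div_le_iff₀ (by positivity), mul_comm c₀, ← le_div_iff₀ hc₀] at haverage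
  refine le_of_mul_le_mul_left
    ((sq_mul_trigWeight_mul_le_trigEnergy α β n hθ').trans (haverage.trans_eq ?_))
    (show 0 < ((n : ℝ) + 1) ^ 2 by positivity)
  ring

end InteriorBound

/-! ### The pointwise bound up to the endpoints -/

section EndpointBound

open Real
open Polynomial (derivative)

/-- The univariate factor of `bigW`. -/
def uniW (α β : ℝ) (n : ℕ) (x : ℝ) : ℝ :=
  (1 - x + ((n : ℝ) ^ 2)⁻¹) ^ (α + 1 / 2) * (1 + x + ((n : ℝ) ^ 2)⁻¹) ^ (β + 1 / 2)

lemma uniW_neg (α β : ℝ) (n : ℕ) (x : ℝ) : uniW α β n (-x) = uniW β α n x := by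
  unfold uniW
  rw [mul_comm, sub_neg_eq_add, ← sub_eq_add_neg]

lemma uniW_pos (α β : ℝ) {n : ℕ} (hn : 1 ≤ n) {x : ℝ} (hx : x ∈ Set.Icc (-1 : ℝ) 1) :
    0 < uniW α β n x := by
  have : (0 : ℝ) < n := by exact_mod_cast hn
  have : 0 < ((n : ℝ) ^ 2)⁻¹ := by positivity
  exact mul_pos (rpow_pos_of_pos (by linarith [hx.2]) _) (rpow_pos_of_pos (by linarith [hx.1]) _)

lemma abs_eigenvalue_le (α β : ℝ) (n : ℕ) :
    |(n : ℝ) * (n + α + β + 1)| ≤ (1 + shiftConst α β) * ((n : ℝ) + 1) ^ 2 := by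
  have : (0 : ℝ) ≤ n := n.cast_nonneg
  have hshift := abs_le.mp (abs_succ_sq_sub_eigenvalue_le α β n)
  have : shiftConst α β * ((n : ℝ) + 1) ≤ shiftConst α β * ((n : ℝ) + 1) ^ 2 :=
    mul_le_mul_of_nonneg_left (by nlinarith) (shiftConst_nonneg α β)
  rw [abs_le]
  constructor <;> nlinarith [hshift.1, hshift.2]

-- Cauchy's mean value theorem for the flux `(1-x)^(α+1) (1+x)^(β+1) P_n'(x)` and `(1-x)^(α+1)`,
-- both of which vanish at `1`.
lemma exists_eval_derivative_jacobiPoly_eq {α β : ℝ} (hα : -1 < α) (hβ : -1 < β) (n : ℕ) {x : ℝ}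
    (hx : x ∈ Set.Ico (-1 : ℝ) 1) :
    ∃ c ∈ Set.Ioo x 1, (α + 1) * ((1 + x) ^ (β + 1) * (derivative (jacobiPoly α β n)).eval x) =
      n * (n + α + β + 1) * (jacobiP α β n c * (1 + c) ^ β) := by
  obtain ⟨c, hc, hratio⟩ := exists_ratio_hasDerivAt_eq_ratio_slope (jacobiFlux α β n)
    (fun x => -(n * (n + α + β + 1)) * (jacobiP α β n x * jacobiWeight α β x)) hx.2
    (continuous_jacobiFlux hα hβ n).continuousOn
    (fun y hy => hasDerivAt_jacobiFlux α β n ⟨by linarith [hx.1, hy.1], hy.2⟩)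
    (fun x => (1 - x) ^ (α + 1)) (fun x => -1 * (α + 1) * (1 - x) ^ (α + 1 - 1))
    (Continuous.continuousOn (Continuous.rpow_const (by fun_prop)
      fun x => Or.inr (by linarith)))
    (fun y hy => ((hasDerivAt_id y).const_sub 1).rpow_const
      (Or.inl (by simp only [id]; linarith [hy.2])))
  refine ⟨c, hc, ?_⟩
  have hc_pos := rpow_pos_of_pos (show 0 < 1 - c by linarith [hc.2]) α
  have hx_pos := rpow_pos_of_pos (show 0 < 1 - x by linarith [hx.2]) (α + 1)
  simp only [sub_self, add_sub_cancel_right, jacobiFlux, jacobiWeight] at hratio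
  rw [zero_rpow (by linarith)] at hratio
  refine mul_left_cancel₀ (mul_pos hc_pos hx_pos).ne' ?_
  linear_combination -hratio

/-- The constant in the bound of the derivative of `P_n` near the right endpoint. -/
def endConst (α β : ℝ) : ℝ := (1 + shiftConst α β) * 2 ^ |β| / (α + 1)

lemma endConst_pos {α : ℝ} (β : ℝ) (hα : -1 < α) : 0 < endConst α β := by
  have := shiftConst_nonneg α β
  have : 0 < α + 1 := by linarith
  unfold endConst
  positivity

lemma rpow_le_two_rpow_abs (β : ℝ) {s : ℝ} (hs : 1 ≤ s) (hs' : s ≤ 2) : s ^ β ≤ 2 ^ |β| :=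
  (rpow_le_rpow_of_exponent_le hs (le_abs_self β)).trans
    (rpow_le_rpow (by linarith) hs' (abs_nonneg β))

lemma exists_abs_eval_derivative_jacobiPoly_le {α β : ℝ} (hα : -1 < α) (hβ : -1 < β) (n : ℕ)
    {x : ℝ} (hx : x ∈ Set.Ico (0 : ℝ) 1) :
    ∃ c ∈ Set.Ioo x 1, |(derivative (jacobiPoly α β n)).eval x| ≤
      endConst α β * ((n : ℝ) + 1) ^ 2 * |jacobiP α β n c| := by
  obtain ⟨c, hc, heq⟩ := exists_eval_derivative_jacobiPoly_eq hα hβ n (x := x)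
    ⟨by linarith [hx.1], hx.2⟩
  refine ⟨c, hc, ?_⟩
  have hα' : 0 < α + 1 := by linarith
  have heig := abs_eigenvalue_le α β n
  have hx_one : 1 ≤ (1 + x) ^ (β + 1) := one_le_rpow (by linarith [hx.1]) (by linarith)
  have hc_nonneg : 0 ≤ (1 + c) ^ β := rpow_nonneg (by linarith [hx.1, hc.1]) _
  have hc_le : (1 + c) ^ β ≤ 2 ^ |β| :=
    rpow_le_two_rpow_abs β (by linarith [hx.1, hc.1]) (by linarith [hc.2])
  rw [endConst, div_mul_eq_mul_div, div_mul_eq_mul_div, le_div_iff₀ hα', mul_comm _ (α + 1)]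
  calc (α + 1) * |(derivative (jacobiPoly α β n)).eval x|
      ≤ (α + 1) * ((1 + x) ^ (β + 1) * |(derivative (jacobiPoly α β n)).eval x|) := by
        gcongr
        exact le_mul_of_one_le_left (abs_nonneg _) hx_one
    _ = |(α + 1) * ((1 + x) ^ (β + 1) * (derivative (jacobiPoly α β n)).eval x)| := by
        rw [abs_mul, abs_mul, abs_of_pos hα', abs_of_pos (zero_lt_one.trans_le hx_one)]
    _ = |(n : ℝ) * (n + α + β + 1)| * (|jacobiP α β n c| * (1 + c) ^ β) := by
        rw [heq, abs_mul, abs_mul (jacobiP α β n c), abs_of_nonneg hc_nonneg]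
    _ ≤ (1 + shiftConst α β) * ((n : ℝ) + 1) ^ 2 * (|jacobiP α β n c| * 2 ^ |β|) := by
        refine mul_le_mul heig ?_ (by positivity) ((abs_nonneg _).trans heig)
        gcongr
    _ = _ := by ring

lemma abs_jacobiP_le_two_mul {α β : ℝ} (hα : -1 < α) (hβ : -1 < β) (n : ℕ) {x₁ : ℝ}
    (hx₁ : 0 ≤ x₁) (hnear : endConst α β * ((n : ℝ) + 1) ^ 2 * (1 - x₁) ≤ 1 / 2) {x : ℝ}
    (hx : x ∈ Set.Icc x₁ 1) :
    |jacobiP α β n x| ≤ 2 * |jacobiP α β n x₁| := by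
  obtain ⟨ξ, hξ, hmaxOn⟩ := isCompact_Icc.exists_isMaxOn (⟨x, hx⟩ : (Set.Icc x₁ 1).Nonempty)
    ((continuous_jacobiP α β n).abs.continuousOn)
  have hmax : ∀ y ∈ Set.Icc x₁ 1, |jacobiP α β n y| ≤ |jacobiP α β n ξ| := fun y hy => hmaxOn hy
  refine (hmax x hx).trans ?_
  rcases hξ.1.eq_or_lt with rfl | hlt
  · linarith [abs_nonneg (jacobiP α β n x₁)]
  obtain ⟨z, hz, hslope⟩ := exists_hasDerivAt_eq_slope (jacobiP α β n) _ hlt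
    (continuous_jacobiP α β n).continuousOn (fun y _ => hasDerivAt_jacobiP α β n y)
  obtain ⟨c, hc, hderiv⟩ := exists_abs_eval_derivative_jacobiPoly_le hα hβ n
    (⟨hx₁.trans hz.1.le, hz.2.trans_le hξ.2⟩ : z ∈ Set.Ico (0 : ℝ) 1)
  rw [hslope, abs_div, abs_of_pos (sub_pos.mpr hlt), div_le_iff₀ (sub_pos.mpr hlt)] at hderiv
  have := endConst_pos β hα
  have hincrement : |jacobiP α β n ξ - jacobiP α β n x₁| ≤ 1 / 2 * |jacobiP α β n ξ| :=
    calc _ ≤ _ := hderiv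
      _ ≤ endConst α β * ((n : ℝ) + 1) ^ 2 * |jacobiP α β n ξ| * (1 - x₁) := by
        have := hmax c ⟨hz.1.le.trans hc.1.le, hc.2.le⟩
        gcongr
        exact hξ.2
      _ = endConst α β * ((n : ℝ) + 1) ^ 2 * (1 - x₁) * |jacobiP α β n ξ| := by ring
      _ ≤ _ := by gcongr
  linarith [abs_sub_abs_le_abs_sub (jacobiP α β n ξ) (jacobiP α β n x₁)]

lemma exists_le_jacobiP_sq_le_four_mul {α β : ℝ} (hα : -1 < α) (hβ : -1 < β) {δ : ℝ}
    (hδ : δ ≤ 1) (hend : endConst α β * δ ≤ 1 / 2) (n : ℕ) {x : ℝ}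
    (hx : x ∈ Set.Icc (0 : ℝ) 1) :
    ∃ y ∈ Set.Icc 0 x, δ * (((n : ℝ) + 1) ^ 2)⁻¹ ≤ 1 - y ∧
      jacobiP α β n x ^ 2 ≤ 4 * jacobiP α β n y ^ 2 := by
  have : (0 : ℝ) ≤ n := n.cast_nonneg
  have : (0 : ℝ) < (((n : ℝ) + 1) ^ 2)⁻¹ := by positivity
  have hinv : (((n : ℝ) + 1) ^ 2)⁻¹ ≤ 1 := inv_le_one_of_one_le₀ (by nlinarith)
  set x₁ : ℝ := 1 - δ * (((n : ℝ) + 1) ^ 2)⁻¹ with hx₁_def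
  have hx₁ : 0 ≤ x₁ := by nlinarith
  rcases le_total x x₁ with hle | hle
  · exact ⟨x, ⟨hx.1, le_rfl⟩, by linarith, by linarith [sq_nonneg (jacobiP α β n x)]⟩
  refine ⟨x₁, ⟨hx₁, hle⟩, by linarith, ?_⟩
  have hdouble : |jacobiP α β n x| ≤ 2 * |jacobiP α β n x₁| := by
    refine abs_jacobiP_le_two_mul hα hβ n hx₁ ?_ ⟨hle, hx.2⟩
    rw [hx₁_def, sub_sub_cancel]
    calc _ = endConst α β * δ := by field_simp
      _ ≤ _ := hend
  have hsq := pow_le_pow_left₀ (abs_nonneg _) hdouble 2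
  rw [mul_pow, sq_abs, sq_abs] at hsq
  linarith

lemma uniW_succ_le {α β : ℝ} (hα : -1 / 2 ≤ α) (hβ : -1 / 2 ≤ β) {δ : ℝ} (hδ : 0 < δ) (n : ℕ)
    {x y : ℝ} (hx : x ≤ 1) (hy : y ∈ Set.Icc 0 x) (hδy : δ * (((n : ℝ) + 1) ^ 2)⁻¹ ≤ 1 - y) :
    uniW α β (n + 1) x ≤ (1 + 1 / δ) ^ (α + 1 / 2) * 3 ^ (β + 1 / 2) *
      ((1 - y) ^ (α + 1 / 2) * (1 + y) ^ (β + 1 / 2)) := by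
  have : (0 : ℝ) ≤ n := n.cast_nonneg
  have : 0 < (((n : ℝ) + 1) ^ 2)⁻¹ := by positivity
  have : (((n : ℝ) + 1) ^ 2)⁻¹ ≤ 1 := inv_le_one_of_one_le₀ (by nlinarith)
  have hy_lt : 0 < 1 - y := lt_of_lt_of_le (by positivity) hδy
  have hinv : (((n : ℝ) + 1) ^ 2)⁻¹ ≤ 1 / δ * (1 - y) := by
    rw [one_div_mul_eq_div, le_div_iff₀ hδ]; linarith
  have hleft : (1 - x + (((n : ℝ) + 1) ^ 2)⁻¹) ^ (α + 1 / 2) ≤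
      (1 + 1 / δ) ^ (α + 1 / 2) * (1 - y) ^ (α + 1 / 2) := by
    rw [← mul_rpow (by positivity) hy_lt.le]
    exact rpow_le_rpow (by linarith) (by linarith [hy.2]) (by linarith)
  have hright : (1 + x + (((n : ℝ) + 1) ^ 2)⁻¹) ^ (β + 1 / 2) ≤
      3 ^ (β + 1 / 2) * (1 + y) ^ (β + 1 / 2) := by
    rw [← mul_rpow (by positivity) (by linarith [hy.1])]
    exact rpow_le_rpow (by linarith [hy.1, hy.2]) (by linarith [hy.1]) (by linarith)
  unfold uniW
  push_cast
  calc _ ≤ ((1 + 1 / δ) ^ (α + 1 / 2) * (1 - y) ^ (α + 1 / 2)) *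
      (3 ^ (β + 1 / 2) * (1 + y) ^ (β + 1 / 2)) :=
        mul_le_mul hleft hright (rpow_nonneg (by linarith [hy.1, hy.2]) _) (by positivity)
    _ = _ := by ring

lemma sqrt_le_succ_mul_sin_arccos {δ : ℝ} (n : ℕ) {y : ℝ} (hy : y ∈ Set.Icc (0 : ℝ) 1)
    (hδy : δ * (((n : ℝ) + 1) ^ 2)⁻¹ ≤ 1 - y) :
    √δ ≤ ((n : ℝ) + 1) * sin (arccos y) := by
  rw [sin_arccos, ← sqrt_sq (show (0 : ℝ) ≤ n + 1 by positivity), ← sqrt_mul (sq_nonneg _)]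
  refine sqrt_le_sqrt ?_
  calc δ = ((n : ℝ) + 1) ^ 2 * (δ * (((n : ℝ) + 1) ^ 2)⁻¹) := by field_simp
    _ ≤ ((n : ℝ) + 1) ^ 2 * (1 - y) := by gcongr
    _ ≤ ((n : ℝ) + 1) ^ 2 * (1 - y ^ 2) := by
        gcongr
        exact pow_le_of_le_one hy.1 hy.2 two_ne_zero

lemma exists_jacobiP_sq_mul_uniW_le_right {α β : ℝ} (hα : -1 / 2 ≤ α) (hβ : -1 / 2 ≤ β) :
    ∃ C : ℝ, 0 < C ∧ ∀ (n : ℕ) (x : ℝ), x ∈ Set.Icc (0 : ℝ) 1 →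
      jacobiP α β n x ^ 2 * uniW α β (n + 1) x ≤ C * jacobiNormSq α β n := by
  have hα' : -1 < α := by linarith
  have hβ' : -1 < β := by linarith
  have := endConst_pos β hα'
  obtain ⟨δ, hδ, hδ_le, hend⟩ : ∃ δ : ℝ, 0 < δ ∧ δ ≤ 1 ∧ endConst α β * δ ≤ 1 / 2 := by
    refine ⟨min 1 (1 / (2 * endConst α β)), by positivity, min_le_left _ _, ?_⟩
    calc _ ≤ endConst α β * (1 / (2 * endConst α β)) := by gcongr; exact min_le_right _ _
      _ = 1 / 2 := by field_simp
  obtain ⟨C, hC, hinterior⟩ := exists_trigWeight_mul_jacobiP_cos_sq_le hα' hβ' (sqrt_pos.mpr hδ)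
  set D := (1 + 1 / δ) ^ (α + 1 / 2) * 3 ^ (β + 1 / 2)
  refine ⟨4 * D * C, by positivity, fun n x hx => ?_⟩
  obtain ⟨y, hy, hδy, hsq⟩ := exists_le_jacobiP_sq_le_four_mul hα' hβ' hδ_le hend n hx
  have hy_lt : 0 < 1 - y := lt_of_lt_of_le (by positivity) hδy
  have hbound := hinterior n (arccos y)
    ⟨arccos_pos.mpr (by linarith), arccos_le_pi_div_two.mpr hy.1⟩
    (sqrt_le_succ_mul_sin_arccos n ⟨hy.1, hy.2.trans hx.2⟩ hδy)
  rw [trigWeight, cos_arccos (by linarith [hy.1]) (by linarith)] at hbound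
  calc jacobiP α β n x ^ 2 * uniW α β (n + 1) x
      ≤ (4 * jacobiP α β n y ^ 2) * (D * ((1 - y) ^ (α + 1 / 2) * (1 + y) ^ (β + 1 / 2))) :=
        mul_le_mul hsq (uniW_succ_le hα hβ hδ n hx.2 hy hδy)
          (uniW_pos α β (by omega) ⟨by linarith [hx.1], hx.2⟩).le (by positivity)
    _ = 4 * D * ((1 - y) ^ (α + 1 / 2) * (1 + y) ^ (β + 1 / 2) * jacobiP α β n y ^ 2) := by ring
    _ ≤ 4 * D * (C * jacobiNormSq α β n) := by gcongr
    _ = _ := by ring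

theorem exists_jacobiP_sq_mul_uniW_le {α β : ℝ} (hα : -1 / 2 ≤ α) (hβ : -1 / 2 ≤ β) :
    ∃ C : ℝ, 0 < C ∧ ∀ (n : ℕ) (x : ℝ), x ∈ Set.Icc (-1 : ℝ) 1 →
      jacobiP α β n x ^ 2 * uniW α β (n + 1) x ≤ C * jacobiNormSq α β n := by
  obtain ⟨C₁, hC₁, hright⟩ := exists_jacobiP_sq_mul_uniW_le_right hα hβ
  obtain ⟨C₂, -, hleft⟩ := exists_jacobiP_sq_mul_uniW_le_right hβ hα
  refine ⟨max C₁ C₂, lt_max_of_lt_left hC₁, fun n x hx => ?_⟩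
  have := jacobiNormSq_pos (α := α) (β := β) (by linarith) (by linarith) n
  rcases le_total 0 x with hx0 | hx0
  · refine (hright n x ⟨hx0, hx.2⟩).trans ?_
    gcongr
    exact le_max_left _ _
  · have hreflected := hleft n (-x) ⟨by linarith, by linarith [hx.1]⟩
    rw [jacobiP_neg, uniW_neg, mul_pow, ← pow_mul, mul_comm n 2, pow_mul, neg_one_sq, one_pow,
      one_mul, jacobiNormSq_swap] at hreflected
    refine hreflected.trans ?_
    gcongr
    exact le_max_right _ _

end EndpointBound

/-! ### Discrete symbols -/

/-- Discrete symbol estimates of order `r` with constant `C`, up to `M` forward differences: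
`‖Δ^m f ν‖ ≤ C (ν + 1) ^ (r - m)` for all `m ≤ M`. -/
def SymbolBound {E : Type*} [NormedAddCommGroup E] : ℕ → ℤ → ℝ → (ℕ → E) → Prop
  | 0, r, C, f => ∀ ν, ‖f ν‖ ≤ C * ((ν : ℝ) + 1) ^ r
  | M + 1, r, C, f => (∀ ν, ‖f ν‖ ≤ C * ((ν : ℝ) + 1) ^ r) ∧
      SymbolBound M (r - 1) C (fun ν => f (ν + 1) - f ν)

namespace SymbolBound

variable {E : Type*} [NormedAddCommGroup E] {M : ℕ} {p q r r' : ℤ} {A B C C' : ℝ}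
  {a : ℕ → ℝ} {f g : ℕ → E}

lemma bound (h : SymbolBound M r C f) (ν : ℕ) : ‖f ν‖ ≤ C * ((ν : ℝ) + 1) ^ r := by
  cases M with
  | zero => exact h ν
  | succ M => exact h.1 ν

lemma const_nonneg (h : SymbolBound M r C f) : 0 ≤ C := by
  simpa using (norm_nonneg _).trans (h.bound 0)

lemma norm_le_of_le (h : SymbolBound M r C f) (hr : r ≤ r') (hC : C ≤ C') (ν : ℕ) :
    ‖f ν‖ ≤ C' * ((ν : ℝ) + 1) ^ r' := by
  have : (1 : ℝ) ≤ (ν : ℝ) + 1 := by linarith [ν.cast_nonneg (α := ℝ)]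
  have : 0 ≤ C' := h.const_nonneg.trans hC
  refine (h.bound ν).trans ?_
  gcongr

lemma mono (h : SymbolBound M r C f) (hr : r ≤ r') (hC : C ≤ C') : SymbolBound M r' C' f := by
  induction M generalizing r r' f with
  | zero => exact h.norm_le_of_le hr hC
  | succ M ih => exact ⟨h.norm_le_of_le hr hC, ih h.2 (by omega)⟩

lemma succ (hf : ∀ ν, ‖f ν‖ ≤ C * ((ν : ℝ) + 1) ^ r)
    (hΔ : SymbolBound M (r - 1) C' fun ν => f (ν + 1) - f ν) :
    SymbolBound (M + 1) r (C + C') f := by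
  have : 0 ≤ C' := hΔ.const_nonneg
  have : 0 ≤ C := by simpa using (norm_nonneg _).trans (hf 0)
  refine ⟨fun ν => (hf ν).trans ?_, hΔ.mono le_rfl (by linarith)⟩
  gcongr
  linarith

lemma of_succ (h : SymbolBound (M + 1) r C f) : SymbolBound M r C f := by
  induction M generalizing r f with
  | zero => exact h.1
  | succ M ih => exact ⟨h.1, ih h.2⟩

lemma add (hf : SymbolBound M r C f) (hg : SymbolBound M r C' g) :
    SymbolBound M r (C + C') fun ν => f ν + g ν := by
  induction M generalizing r f g with
  | zero =>
    intro ν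
    rw [add_mul]
    exact norm_add_le_of_le (hf ν) (hg ν)
  | succ M ih =>
    refine ⟨fun ν => ?_, ?_⟩
    · rw [add_mul]
      exact norm_add_le_of_le (hf.1 ν) (hg.1 ν)
    · simpa only [add_sub_add_comm] using ih hf.2 hg.2

section Smul

variable [NormedSpace ℝ E]

lemma norm_smul_le (ha : SymbolBound M p A a) (hf : SymbolBound M q B f) (ν : ℕ) :
    ‖a ν • f ν‖ ≤ A * B * ((ν : ℝ) + 1) ^ (p + q) := by
  have hν : (ν : ℝ) + 1 ≠ 0 := by positivity
  rw [norm_smul, zpow_add₀ hν, mul_mul_mul_comm]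
  exact mul_le_mul (ha.bound ν) (hf.bound ν) (norm_nonneg _) ((norm_nonneg _).trans (ha.bound ν))

-- The factor `3` counts the terms of `Δ(a f) = a Δf + Δa f + Δa Δf`.
lemma smul (ha : SymbolBound M p A a) (hf : SymbolBound M q B f) :
    SymbolBound M (p + q) (3 ^ M * (A * B)) fun ν => a ν • f ν := by
  induction M generalizing p q a f with
  | zero => simpa only [SymbolBound, pow_zero, one_mul] using norm_smul_le ha hf
  | succ M ih =>
    have hAB : 0 ≤ A * B := mul_nonneg ha.const_nonneg hf.const_nonneg
    refine ⟨fun ν => (norm_smul_le ha hf ν).trans ?_, ?_⟩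
    · refine mul_le_mul_of_nonneg_right ?_ (by positivity)
      exact le_mul_of_one_le_left hAB (one_le_pow₀ (by norm_num))
    · have a_Δf := (ih ha.of_succ hf.2).mono (r' := p + q - 1) (by omega) le_rfl
      have Δa_f := (ih ha.2 hf.of_succ).mono (r' := p + q - 1) (by omega) le_rfl
      have Δa_Δf := (ih ha.2 hf.2).mono (r' := p + q - 1) (by omega) le_rfl
      convert (a_Δf.add Δa_f).add Δa_Δf using 2
      · ring
      · module

end Smul

end SymbolBound

lemma succ_zpow_le_two_zpow_abs_mul (ν : ℕ) (r : ℤ) :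
    ((ν : ℝ) + 1) ^ r ≤ 2 ^ |r| * (((ν + 1 : ℕ) : ℝ) + 1) ^ r := by
  have hν : (0 : ℝ) < (ν : ℝ) + 1 := by positivity
  push_cast
  rcases le_total 0 r with hr | hr
  · calc ((ν : ℝ) + 1) ^ r ≤ ((ν : ℝ) + 1 + 1) ^ r :=
          zpow_le_zpow_left₀ hr hν.le (by linarith)
      _ ≤ _ := le_mul_of_one_le_left (by positivity) (one_le_zpow₀ (by norm_num) (abs_nonneg r))
  · obtain ⟨k, rfl⟩ : ∃ k : ℕ, r = -k := ⟨r.natAbs, by omega⟩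
    rw [abs_neg, Nat.abs_cast, zpow_neg, zpow_neg, zpow_natCast, zpow_natCast, zpow_natCast,
      ← div_eq_mul_inv, ← div_pow, ← inv_pow]
    refine pow_le_pow_left₀ (by positivity) ?_ k
    rw [inv_eq_one_div, div_le_div_iff₀ hν (by positivity)]
    linarith

namespace SymbolBound

variable {E : Type*} [NormedAddCommGroup E] {M : ℕ} {r : ℤ} {C : ℝ} {f : ℕ → E}

lemma norm_le_of_shift (h : SymbolBound M r C fun ν => f (ν + 1)) (ν : ℕ) :
    ‖f ν‖ ≤ (‖f 0‖ + C * 2 ^ |r|) * ((ν : ℝ) + 1) ^ r := by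
  have := h.const_nonneg
  cases ν with
  | zero =>
    rw [Nat.cast_zero, zero_add, one_zpow, mul_one]
    exact le_add_of_nonneg_right (by positivity)
  | succ ν =>
    calc ‖f (ν + 1)‖ ≤ C * ((ν : ℝ) + 1) ^ r := h.bound ν
      _ ≤ C * (2 ^ |r| * (((ν + 1 : ℕ) : ℝ) + 1) ^ r) := by
        gcongr
        exact succ_zpow_le_two_zpow_abs_mul ν r
      _ = C * 2 ^ |r| * (((ν + 1 : ℕ) : ℝ) + 1) ^ r := by ring
      _ ≤ _ := by
        gcongr
        exact le_add_of_nonneg_left (norm_nonneg _)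

lemma of_shift (h : SymbolBound M r C fun ν => f (ν + 1)) : ∃ C', SymbolBound M r C' f := by
  induction M generalizing r f with
  | zero => exact ⟨_, norm_le_of_shift h⟩
  | succ M ih =>
    obtain ⟨C', hΔ⟩ := ih (f := fun ν => f (ν + 1) - f ν) h.2
    exact ⟨_, succ (norm_le_of_shift h) hΔ⟩

end SymbolBound

/-- A real sequence satisfying discrete symbol estimates of order `r` for differences of every
order. -/
def IsSymbol (r : ℤ) (a : ℕ → ℝ) : Prop := ∀ M, ∃ C, SymbolBound M r C a

namespace IsSymbol

variable {r p q : ℤ} {a b : ℕ → ℝ}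

lemma mono (h : IsSymbol r a) (hr : r ≤ p) : IsSymbol p a := fun M =>
  let ⟨C, hC⟩ := h M
  ⟨C, hC.mono hr le_rfl⟩

lemma add (ha : IsSymbol r a) (hb : IsSymbol r b) : IsSymbol r fun ν => a ν + b ν := fun M =>
  let ⟨_, hC⟩ := ha M
  let ⟨_, hD⟩ := hb M
  ⟨_, hC.add hD⟩

lemma mul (ha : IsSymbol r a) (hb : IsSymbol p b) (hq : r + p = q) :
    IsSymbol q fun ν => a ν * b ν := fun M =>
  let ⟨_, hC⟩ := ha M
  let ⟨_, hD⟩ := hb M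
  ⟨_, hq ▸ hC.smul hD⟩

lemma of_forall_exists_norm_le (ha : ∃ C, ∀ ν, ‖a ν‖ ≤ C * ((ν : ℝ) + 1) ^ r)
    (hΔ : IsSymbol (r - 1) fun ν => a (ν + 1) - a ν) : IsSymbol r a := by
  obtain ⟨C, hC⟩ := ha
  intro M
  cases M with
  | zero => exact ⟨C, hC⟩
  | succ M =>
    obtain ⟨C', hC'⟩ := hΔ M
    exact ⟨C + C', .succ hC hC'⟩

lemma zero (r : ℤ) : IsSymbol r fun _ => 0 := by
  intro M
  refine ⟨0, ?_⟩
  induction M generalizing r with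
  | zero => intro ν; simp
  | succ M ih => exact ⟨fun ν => by simp, by simpa using ih (r - 1)⟩

lemma const (c : ℝ) : IsSymbol 0 fun _ => c :=
  of_forall_exists_norm_le ⟨|c|, fun ν => by simp⟩ (by simpa only [sub_self] using zero (0 - 1))

lemma const_mul (c : ℝ) (ha : IsSymbol r a) : IsSymbol r fun ν => c * a ν :=
  (const c).mul ha (zero_add r)

lemma sub (ha : IsSymbol r a) (hb : IsSymbol r b) : IsSymbol r fun ν => a ν - b ν := by
  simpa only [sub_eq_add_neg, neg_one_mul] using ha.add (hb.const_mul (-1))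

lemma linear (c e : ℝ) : IsSymbol 1 fun ν => c * ν + e := by
  refine of_forall_exists_norm_le ⟨|c| + |e|, fun ν => ?_⟩ ?_
  · have hν : (1 : ℝ) ≤ (ν : ℝ) + 1 := by linarith [ν.cast_nonneg (α := ℝ)]
    calc ‖c * (ν : ℝ) + e‖ ≤ |c| * ν + |e| := by
          simpa only [Real.norm_eq_abs, abs_mul, Nat.abs_cast] using abs_add_le (c * (ν : ℝ)) e
      _ ≤ |c| * ((ν : ℝ) + 1) + |e| * ((ν : ℝ) + 1) := by
        gcongr
        · linarith
        · exact le_mul_of_one_le_right (abs_nonneg e) hν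
      _ = (|c| + |e|) * ((ν : ℝ) + 1) ^ (1 : ℤ) := by rw [zpow_one, add_mul]
  · have hΔ (ν : ℕ) : c * ((ν + 1 : ℕ) : ℝ) + e - (c * ν + e) = c := by push_cast; ring
    simpa only [hΔ, sub_self] using const c

lemma norm_inv_natCast_add_le {c : ℝ} (hc : 0 < c) (ν : ℕ) :
    ‖((ν : ℝ) + c)⁻¹‖ ≤ (1 + c⁻¹) * ((ν : ℝ) + 1) ^ (-1 : ℤ) := by
  rw [zpow_neg_one, norm_inv, Real.norm_of_nonneg (by positivity), ← div_eq_mul_inv,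
    inv_eq_one_div, div_le_div_iff₀ (by positivity) (by positivity)]
  calc 1 * ((ν : ℝ) + 1) ≤ ν + c + ν * c⁻¹ + 1 := by
        linarith [show 0 ≤ (ν : ℝ) * c⁻¹ by positivity]
    _ = (1 + c⁻¹) * ((ν : ℝ) + c) := by field_simp; ring

lemma inv_natCast_add {c : ℝ} (hc : 0 < c) : IsSymbol (-1) fun ν => ((ν : ℝ) + c)⁻¹ := by
  intro M
  induction M generalizing c with
  | zero => exact ⟨_, norm_inv_natCast_add_le hc⟩
  | succ M ih =>
    obtain ⟨C, hC⟩ := ih hc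
    obtain ⟨D, hD⟩ := ih (show 0 < c + 1 by linarith)
    obtain ⟨N, hN⟩ := const (-1) M
    have hΔ : (fun ν : ℕ => (((ν + 1 : ℕ) : ℝ) + c)⁻¹ - ((ν : ℝ) + c)⁻¹) =
        fun ν : ℕ => (-1 : ℝ) • (((ν : ℝ) + c)⁻¹ • ((ν : ℝ) + (c + 1))⁻¹) := by
      ext ν
      have : (ν : ℝ) + c ≠ 0 := by positivity
      have : (ν : ℝ) + 1 + c ≠ 0 := by positivity
      rw [Nat.cast_succ, smul_eq_mul, smul_eq_mul, ← add_assoc, add_right_comm (ν : ℝ) c]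
      field_simp
      ring
    have key := (hN.smul (hC.smul hD)).mono (r' := -1 - 1) (by norm_num) le_rfl
    exact ⟨_, .succ (norm_inv_natCast_add_le hc) (hΔ ▸ key)⟩

lemma of_shift (h : IsSymbol r fun ν => a (ν + 1)) : IsSymbol r a := fun M =>
  let ⟨_, hC⟩ := h M
  hC.of_shift

end IsSymbol

/-! ### Symbol estimates for the recurrence coefficients -/

section RecurrenceSymbols

variable {α β : ℝ}

lemma isSymbol_linear_div_cubic {c₁ c₂ c₃ : ℝ} (h₁ : 0 < c₁) (h₂ : 0 < c₂) (h₃ : 0 < c₃)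
    (e f : ℝ) :
    IsSymbol (-2) fun ν => (e * ν + f) / (((ν : ℝ) + c₁) * (ν + c₂) * (ν + c₃)) := by
  have h₁₂ := ((IsSymbol.linear e f).mul (.inv_natCast_add h₁) (q := 0) rfl).mul
    (.inv_natCast_add h₂) (q := -1) rfl
  convert h₁₂.mul (.inv_natCast_add h₃) (q := -2) rfl using 2 with ν
  have : (ν : ℝ) + c₁ ≠ 0 := by positivity
  have : (ν : ℝ) + c₂ ≠ 0 := by positivity
  have : (ν : ℝ) + c₃ ≠ 0 := by positivity
  field_simp

lemma isSymbol_linear_div_succ (e f : ℝ) :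
    IsSymbol 0 fun ν => (e * (ν : ℝ) + f) / ((ν : ℝ) + 1) :=
  (IsSymbol.linear e f).mul (.inv_natCast_add one_pos) rfl

lemma isSymbol_const_add_const_mul_inv_succ (c e : ℝ) :
    IsSymbol 0 fun ν => c + e * ((ν : ℝ) + 1)⁻¹ :=
  (IsSymbol.const c).add (((IsSymbol.inv_natCast_add one_pos).const_mul e).mono (by norm_num))

lemma isSymbol_recA_sub (hs : -1 ≤ α + β) :
    IsSymbol (-2) fun ν => recA α β ν - (1 / 2 + 1 / 4 * ((ν : ℝ) + 1)⁻¹) := by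
  apply IsSymbol.of_shift
  set s := α + β with hsdef
  convert isSymbol_linear_div_cubic (c₁ := 2) (c₂ := (s + 3) / 2) (c₃ := (s + 4) / 2)
    (by norm_num) (by linarith) (by linarith) ((2 - 2 * s - 2 * s ^ 2) / 16)
    (((2 - 2 * s - 2 * s ^ 2) + (s + 1) * (2 - 3 * s)) / 16) using 2 with ν
  simp only [recA, Nat.succ_ne_zero, if_false]
  push_cast
  rw [show 2 * ((ν : ℝ) + 1) + α + β + 1 = 2 * ν + s + 3 by rw [hsdef]; ring,
    show 2 * ((ν : ℝ) + 1) + α + β + 2 = 2 * ν + s + 4 by rw [hsdef]; ring,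
    show (ν : ℝ) + 1 + α + β + 1 = ν + s + 2 by rw [hsdef]; ring,
    show (ν : ℝ) + (s + 3) / 2 = (2 * ν + s + 3) / 2 by ring,
    show (ν : ℝ) + (s + 4) / 2 = (2 * ν + s + 4) / 2 by ring]
  have : (0 : ℝ) ≤ ν := ν.cast_nonneg
  have : 2 * (ν : ℝ) + s + 3 ≠ 0 := by linarith
  have : 2 * (ν : ℝ) + s + 4 ≠ 0 := by linarith
  have : (ν : ℝ) + 2 ≠ 0 := by linarith
  have : (ν : ℝ) + 1 + 1 ≠ 0 := by linarith
  field_simp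
  ring

lemma isSymbol_recC_sub (hs : -1 ≤ α + β) :
    IsSymbol (-2) fun ν => recC α β ν - (1 / 2 + -1 / 4 * ((ν : ℝ) + 1)⁻¹) := by
  set s := α + β with hsdef
  convert isSymbol_linear_div_cubic (c₁ := 1) (c₂ := (s + 2) / 2) (c₃ := (s + 3) / 2)
    (by norm_num) (by linarith) (by linarith) ((8 * α * β - 2 * s ^ 2 + 2 * s + 2) / 16)
    (((8 * α * β - 2 * s ^ 2 + 2 * s + 2) + s ^ 2 + s) / 16) using 2 with ν
  simp only [recC]
  rw [show 2 * (ν : ℝ) + α + β + 2 = 2 * ν + s + 2 by rw [hsdef]; ring,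
    show 2 * (ν : ℝ) + α + β + 3 = 2 * ν + s + 3 by rw [hsdef]; ring,
    show (ν : ℝ) + (s + 2) / 2 = (2 * ν + s + 2) / 2 by ring,
    show (ν : ℝ) + (s + 3) / 2 = (2 * ν + s + 3) / 2 by ring]
  have : (0 : ℝ) ≤ ν := ν.cast_nonneg
  have : 2 * (ν : ℝ) + s + 2 ≠ 0 := by linarith
  have : 2 * (ν : ℝ) + s + 3 ≠ 0 := by linarith
  have : (ν : ℝ) + 1 ≠ 0 := by linarith
  field_simp
  rw [hsdef]
  ring

lemma isSymbol_recA (hs : -1 ≤ α + β) : IsSymbol 0 (recA α β) := by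
  simpa only [sub_add_cancel] using ((isSymbol_recA_sub hs).mono (p := 0) (by norm_num)).add
    (isSymbol_const_add_const_mul_inv_succ (1 / 2) (1 / 4))

lemma isSymbol_recC (hs : -1 ≤ α + β) : IsSymbol 0 (recC α β) := by
  simpa only [sub_add_cancel] using ((isSymbol_recC_sub hs).mono (p := 0) (by norm_num)).add
    (isSymbol_const_add_const_mul_inv_succ (1 / 2) (-1 / 4))

lemma isSymbol_recB (hs : -1 ≤ α + β) : IsSymbol (-2) (recB α β) := by
  apply IsSymbol.of_shift
  set s := α + β with hsdef
  have inv_mul_inv := (IsSymbol.inv_natCast_add (c := (s + 2) / 2) (by linarith)).mul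
    (.inv_natCast_add (c := (s + 4) / 2) (by linarith)) (q := -2) rfl
  convert inv_mul_inv.const_mul ((β ^ 2 - α ^ 2) / 4) using 2 with ν
  simp only [recB, Nat.succ_ne_zero, if_false]
  push_cast
  rw [show 2 * ((ν : ℝ) + 1) + α + β = 2 * ν + s + 2 by rw [hsdef]; ring,
    show 2 * (ν : ℝ) + s + 2 + 2 = 2 * ν + s + 4 by ring,
    show (ν : ℝ) + (s + 2) / 2 = (2 * ν + s + 2) / 2 by ring,
    show (ν : ℝ) + (s + 4) / 2 = (2 * ν + s + 4) / 2 by ring]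
  have : (0 : ℝ) ≤ ν := ν.cast_nonneg
  have : 2 * (ν : ℝ) + s + 2 ≠ 0 := by linarith
  have : 2 * (ν : ℝ) + s + 4 ≠ 0 := by linarith
  field_simp
  norm_num

lemma isSymbol_recC_inv (hα : -1 < α) (hβ : -1 < β) : IsSymbol 0 fun ν => (recC α β ν)⁻¹ := by
  have quotient_α := ((IsSymbol.linear 2 (α + β + 2)).mul
    (IsSymbol.linear 1 ((α + β + 3) / 2)) (q := 2) rfl).mul
    (.inv_natCast_add (c := 1 + α) (by linarith)) (q := 1) rfl
  convert quotient_α.mul (.inv_natCast_add (c := 1 + β) (by linarith)) (q := 0) rfl using 2 with ν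
  simp only [recC]
  have : (0 : ℝ) ≤ ν := ν.cast_nonneg
  have : (ν : ℝ) + (1 + α) ≠ 0 := by linarith
  have : (ν : ℝ) + (1 + β) ≠ 0 := by linarith
  rw [inv_div, add_assoc (ν : ℝ) 1 α, add_assoc (ν : ℝ) 1 β]
  field_simp
  ring

lemma recC_ne_zero (hα : -1 < α) (hβ : -1 < β) (ν : ℕ) : recC α β ν ≠ 0 := by
  have : (0 : ℝ) ≤ ν := ν.cast_nonneg
  have : (ν : ℝ) + 1 + α ≠ 0 := by linarith
  have : (ν : ℝ) + 1 + β ≠ 0 := by linarith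
  have : 2 * (ν : ℝ) + α + β + 2 ≠ 0 := by linarith
  have : 2 * (ν : ℝ) + α + β + 3 ≠ 0 := by linarith
  unfold recC
  positivity

/-- The coefficient of `P_n` in `P_{n+1} = raiseDiag n P_n - raiseShift n (1 - x) P_n^{(α+1,β)}`. -/
def raiseDiag (α : ℝ) (n : ℕ) : ℝ := (n + α + 1) / (n + 1)

/-- The coefficient of `-(1 - x) P_n^{(α+1,β)}` in the expansion of `P_{n+1}`, see `raiseDiag`. -/
def raiseShift (α β : ℝ) (n : ℕ) : ℝ := (n + (α + β) / 2 + 1) / (n + 1)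

lemma jacobiP_succ_eq_raise (α β : ℝ) (n : ℕ) (x : ℝ) :
    jacobiP α β (n + 1) x = raiseDiag α n * jacobiP α β n x -
      raiseShift α β n * ((1 - x) * jacobiP (α + 1) β n x) := by
  have hraise := one_sub_mul_jacobiP_left_succ α β n x
  have : (n : ℝ) + 1 ≠ 0 := by positivity
  unfold raiseDiag raiseShift
  generalize (n : ℝ) + (α + β) / 2 + 1 = D at *
  field_simp
  linear_combination hraise

lemma isSymbol_raiseDiag (α : ℝ) : IsSymbol 0 (raiseDiag α) := by
  convert isSymbol_linear_div_succ 1 (α + 1) using 2 with ν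
  unfold raiseDiag
  ring

lemma isSymbol_raiseShift (α β : ℝ) : IsSymbol 0 (raiseShift α β) := by
  convert isSymbol_linear_div_succ 1 ((α + β) / 2 + 1) using 2 with ν
  unfold raiseShift
  ring

lemma isSymbol_raiseDiag_sub (α α' : ℝ) :
    IsSymbol (-1) fun ν => raiseDiag α ν - raiseDiag α' ν := by
  convert (IsSymbol.inv_natCast_add one_pos).const_mul (α - α') using 2 with ν
  unfold raiseDiag
  ring

/-- The coefficient `C_{n+1}^{(α+i,β)}` renormalized by the ratio of consecutive norms of the
polynomials `P_n^{(α,β)}`. -/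
def renormC (α β : ℝ) (i : ℕ) (ν : ℕ) : ℝ :=
  recC (α + i) β ν * (recA α β ν * (recC α β ν)⁻¹)

lemma isSymbol_renormC (hα : -1 < α) (hβ : -1 < β) (hs : -1 ≤ α + β) (i : ℕ) :
    IsSymbol 0 (renormC α β i) := by
  have : (0 : ℝ) ≤ i := i.cast_nonneg
  exact (isSymbol_recC (by linarith)).mul
    ((isSymbol_recA hs).mul (isSymbol_recC_inv hα hβ) rfl) rfl

-- `A ~ 1/2 + 1/(4n)` and `C ~ 1/2 - 1/(4n)` up to order `-2` whatever the parameters are, hence so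
-- is `C^{(α+i,β)} A / C ~ A`.
lemma isSymbol_renormC_sub_recA (hα : -1 < α) (hβ : -1 < β) (hs : -1 ≤ α + β) (i j : ℕ) :
    IsSymbol (-2) fun ν => renormC α β i ν - recA (α + j) β ν := by
  have : (0 : ℝ) ≤ i := i.cast_nonneg
  have : (0 : ℝ) ≤ j := j.cast_nonneg
  have hCi := (isSymbol_recC_sub (α := α + i) (β := β) (by linarith)).mul
    (isSymbol_recA hs) (q := -2) rfl
  have hA := (isSymbol_const_add_const_mul_inv_succ (1 / 2) (-1 / 4)).mul
    (isSymbol_recA_sub hs) (q := -2) rfl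
  have hAj := (isSymbol_recA_sub (α := α + j) (β := β) (by linarith)).mul
    (isSymbol_recC hs) (q := -2) rfl
  have hC := (isSymbol_const_add_const_mul_inv_succ (1 / 2) (1 / 4)).mul
    (isSymbol_recC_sub hs) (q := -2) rfl
  convert (((hCi.add hA).sub hAj).sub hC).mul (isSymbol_recC_inv hα hβ) (q := -2) rfl using 2
    with ν
  have := recC_ne_zero hα hβ ν
  unfold renormC
  field_simp
  ring

lemma exists_symbolBound_difference_add {E : Type*} [NormedAddCommGroup E] [NormedSpace ℝ E]
    {p : ℤ} {a b : ℕ → ℝ} (ha : IsSymbol (p + 1) a) (hb : IsSymbol p b) (M : ℕ) :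
    ∃ K : ℝ, 0 ≤ K ∧ ∀ (r : ℤ) (D : ℝ) (g : ℕ → E), SymbolBound (M + 1) r D g →
      SymbolBound M (r + p) (K * D) fun ν => a ν • (g (ν + 1) - g ν) + b ν • g ν := by
  obtain ⟨A, hA⟩ := ha M
  obtain ⟨B, hB⟩ := hb M
  have := hA.const_nonneg
  have := hB.const_nonneg
  refine ⟨3 ^ M * (A + B), by positivity, fun r D g hg => ?_⟩
  have a_Δg := (hA.smul hg.2).mono (r' := r + p) (by omega) le_rfl
  have b_g := (hB.smul hg.of_succ).mono (r' := r + p) (by omega) le_rfl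
  convert a_Δg.add b_g using 1
  ring

end RecurrenceSymbols

/-! ### Multiplying the kernel by `x - y` -/

section JetForms

open Finset

variable {α β : ℝ}

/-- The part of the three-term expansion of `x P_n` involving `P_{n-1}`. -/
def recPrev (α β : ℝ) (x : ℝ) : ℕ → ℝ
  | 0 => 0
  | n + 1 => recC α β n * jacobiP α β n x

lemma mul_jacobiP (h : -2 < α + β) (n : ℕ) (x : ℝ) :
    x * jacobiP α β n x = recA α β n * jacobiP α β (n + 1) x +
      recB α β n * jacobiP α β n x + recPrev α β x n := by
  cases n with
  | zero => rw [mul_jacobiP_zero h, recPrev, add_zero]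
  | succ n => rw [mul_jacobiP_succ h, recPrev]

lemma inv_jacobiNormSq_succ (hα : -1 < α) (hβ : -1 < β) (n : ℕ) :
    (jacobiNormSq α β (n + 1))⁻¹ =
      (jacobiNormSq α β n)⁻¹ * (recA α β n * (recC α β n)⁻¹) := by
  have := (jacobiNormSq_pos hα hβ n).ne'
  have := (jacobiNormSq_pos hα hβ (n + 1)).ne'
  have := recC_ne_zero hα hβ n
  field_simp
  linear_combination -recA_mul_jacobiNormSq_succ hα hβ n

/-- The coefficient `(1 - x)^i P_ν^{(α+i,β)}(x) (1 - y)^j P_ν^{(α+j,β)}(y) / ‖P_ν^{(α,β)}‖²`. -/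
def jetCoeff (α β : ℝ) (i j : ℕ) (x y : ℝ) (ν : ℕ) : ℝ :=
  (jacobiNormSq α β ν)⁻¹ * ((1 - x) ^ i * jacobiP (α + i) β ν x) *
    ((1 - y) ^ j * jacobiP (α + j) β ν y)

variable {E : Type*} [AddCommGroup E]

lemma sum_range_eq_sum_range_succ {f : ℕ → E} {K : ℕ} (h0 : f 0 = 0) (hK : f K = 0) :
    ∑ ν ∈ range K, f ν = ∑ ν ∈ range K, f (ν + 1) := by
  have h := sum_range_succ' f K
  rwa [sum_range_succ, h0, hK, add_zero, add_zero] at h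

variable [Module ℝ E]

/-- The sums to which repeated multiplication by `x - y` leads from the kernel, which is the case
`i = j = 0`. -/
def jetForm (α β : ℝ) (i j K : ℕ) (x y : ℝ) (g : ℕ → E) : E :=
  ∑ ν ∈ range K, jetCoeff α β i j x y ν • g ν

/-- The first-order difference operator acting on the multiplier in the part of
`(x - y) * jetForm` that has the same pair of orders. -/
def stepDiag (α β : ℝ) (i j : ℕ) (g : ℕ → E) (ν : ℕ) : E :=
  (raiseDiag (α + j) ν * renormC α β i ν - raiseDiag (α + i) ν * renormC α β j ν) •
      (g (ν + 1) - g ν) +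
    (raiseDiag (α + i) ν * (recA (α + i) β ν - renormC α β j ν) +
      raiseDiag (α + j) ν * (renormC α β i ν - recA (α + j) β ν) +
      (recB (α + i) β ν - recB (α + j) β ν)) • g ν

/-- The first-order difference operator acting on the multiplier in the part of
`(x - y) * jetForm` in which the order `i` is raised. -/
def stepRaise (α β : ℝ) (i j : ℕ) (g : ℕ → E) (ν : ℕ) : E :=
  (raiseShift (α + i) β ν * renormC α β j ν) • (g (ν + 1) - g ν) +
    (raiseShift (α + i) β ν * (renormC α β j ν - recA (α + i) β ν)) • g ν

/-- The contribution of the `P_{ν-1}` terms of the three-term recurrences to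
`(x - y) * jetForm`. -/
def jetPrev (α β : ℝ) (i j : ℕ) (x y : ℝ) (ν : ℕ) : ℝ :=
  (jacobiNormSq α β ν)⁻¹ * (1 - x) ^ i * (1 - y) ^ j *
    (recPrev (α + i) β x ν * jacobiP (α + j) β ν y -
      jacobiP (α + i) β ν x * recPrev (α + j) β y ν)

lemma sub_mul_jetCoeff (hs : -2 < α + β) (i j : ℕ) (x y : ℝ) (ν : ℕ) :
    (x - y) * jetCoeff α β i j x y ν =
      (jacobiNormSq α β ν)⁻¹ * (1 - x) ^ i * (1 - y) ^ j *
        (recA (α + i) β ν * jacobiP (α + i) β (ν + 1) x * jacobiP (α + j) β ν y -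
          recA (α + j) β ν * jacobiP (α + i) β ν x * jacobiP (α + j) β (ν + 1) y +
          (recB (α + i) β ν - recB (α + j) β ν) *
            (jacobiP (α + i) β ν x * jacobiP (α + j) β ν y)) + jetPrev α β i j x y ν := by
  have : (0 : ℝ) ≤ i := i.cast_nonneg
  have : (0 : ℝ) ≤ j := j.cast_nonneg
  have rec_x := mul_jacobiP (α := α + i) (β := β) (by linarith) ν x
  have rec_y := mul_jacobiP (α := α + j) (β := β) (by linarith) ν y
  unfold jetCoeff jetPrev
  linear_combination ((jacobiNormSq α β ν)⁻¹ * (1 - x) ^ i * (1 - y) ^ j) *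
    (jacobiP (α + j) β ν y * rec_x - jacobiP (α + i) β ν x * rec_y)

-- Summation by parts moves the `P_{ν-1}` terms to `P_{ν+1}`, which `jacobiP_succ_eq_raise` trades
-- for `P_ν` and `(1 - x) P_ν^{(α+1,β)}`; what is left on the multiplier is a difference operator.
theorem sub_smul_jetForm (hα : -1 < α) (hβ : -1 < β) (i j K : ℕ) (x y : ℝ) {g : ℕ → E}
    (hg : ∀ ν, K ≤ ν → g ν = 0) :
    (x - y) • jetForm α β i j K x y g = jetForm α β i j K x y (stepDiag α β i j g) +
      jetForm α β (i + 1) j K x y (stepRaise α β i j g) -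
      jetForm α β i (j + 1) K x y (stepRaise α β j i g) := by
  have jetPrev_sum : ∑ ν ∈ range K, jetPrev α β i j x y ν • g ν =
      ∑ ν ∈ range K, jetPrev α β i j x y (ν + 1) • g (ν + 1) :=
    sum_range_eq_sum_range_succ (f := fun ν => jetPrev α β i j x y ν • g ν)
      (by simp [jetPrev, recPrev]) (by simp [hg K le_rfl])
  simp only [jetForm, smul_sum, smul_smul]
  simp only [sub_mul_jetCoeff (by linarith : -2 < α + β), add_smul _ (jetPrev _ _ _ _ _ _ _)]
  rw [sum_add_distrib, jetPrev_sum, ← sum_add_distrib, ← sum_add_distrib, ← sum_sub_distrib]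
  refine sum_congr rfl fun ν _ => ?_
  simp only [jetCoeff, jetPrev, recPrev, stepDiag, stepRaise, renormC]
  rw [inv_jacobiNormSq_succ hα hβ, jacobiP_succ_eq_raise (α + i) β ν x,
    jacobiP_succ_eq_raise (α + j) β ν y, pow_succ, pow_succ, Nat.cast_succ, Nat.cast_succ,
    ← add_assoc, ← add_assoc]
  module

section Support

variable {K : ℕ} {g : ℕ → E}

lemma stepDiag_eq_zero (i j : ℕ) (hg : ∀ ν, K ≤ ν → g ν = 0) (ν : ℕ) (hν : K ≤ ν) :
    stepDiag α β i j g ν = 0 := by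
  simp [stepDiag, hg ν hν, hg (ν + 1) (by omega)]

lemma stepRaise_eq_zero (i j : ℕ) (hg : ∀ ν, K ≤ ν → g ν = 0) (ν : ℕ) (hν : K ≤ ν) :
    stepRaise α β i j g ν = 0 := by
  simp [stepRaise, hg ν hν, hg (ν + 1) (by omega)]

end Support

end JetForms

section StepSymbols

variable {α β : ℝ} {E : Type*} [NormedAddCommGroup E] [NormedSpace ℝ E]

lemma exists_symbolBound_stepDiag (hα : -1 < α) (hβ : -1 < β) (hs : -1 ≤ α + β) (i j M : ℕ) :
    ∃ K : ℝ, 0 ≤ K ∧ ∀ (r : ℤ) (D : ℝ) (g : ℕ → E), SymbolBound (M + 1) r D g →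
      SymbolBound M (r + -2) (K * D) (stepDiag α β i j g) := by
  have : (0 : ℝ) ≤ i := i.cast_nonneg
  have : (0 : ℝ) ≤ j := j.cast_nonneg
  have hij := isSymbol_renormC_sub_recA hα hβ hs i j
  have hjj := isSymbol_renormC_sub_recA hα hβ hs j j
  have hji := isSymbol_renormC_sub_recA hα hβ hs j i
  refine exists_symbolBound_difference_add (p := -2) ?_ ?_ M
  · have raise_sub := (isSymbol_raiseDiag_sub (α + j) (α + i)).mul
      (isSymbol_renormC hα hβ hs i) (q := -2 + 1) rfl
    have renorm_sub := ((isSymbol_raiseDiag (α + i)).mul (hij.sub hjj) rfl).mono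
      (p := -2 + 1) (by norm_num)
    convert raise_sub.add renorm_sub using 2 with ν
    ring
  · have raise_ji := (isSymbol_raiseDiag (α + i)).mul hji (q := -2) rfl
    have raise_ij := (isSymbol_raiseDiag (α + j)).mul hij (q := -2) rfl
    have recB_sub := (isSymbol_recB (α := α + i) (β := β) (by linarith)).sub
      (isSymbol_recB (α := α + j) (β := β) (by linarith))
    convert (raise_ij.sub raise_ji).add recB_sub using 2 with ν
    ring

lemma exists_symbolBound_stepRaise (hα : -1 < α) (hβ : -1 < β) (hs : -1 ≤ α + β) (i j M : ℕ) :
    ∃ K : ℝ, 0 ≤ K ∧ ∀ (r : ℤ) (D : ℝ) (g : ℕ → E), SymbolBound (M + 1) r D g →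
      SymbolBound M (r + -1) (K * D) (stepRaise α β i j g) :=
  exists_symbolBound_difference_add (p := -1)
    ((isSymbol_raiseShift (α + i) β).mul (isSymbol_renormC hα hβ hs j) rfl)
    (((isSymbol_raiseShift (α + i) β).mul (isSymbol_renormC_sub_recA hα hβ hs j i) rfl).mono
      (by norm_num)) M

end StepSymbols

section JetCoeffBound

variable {α β : ℝ}

lemma uniW_le_mul_uniW (hα : -1 / 2 ≤ α) (hβ : -1 / 2 ≤ β) {L : ℝ} (hL : 1 ≤ L) {n m : ℕ}
    (hn : 1 ≤ n) (hm : 1 ≤ m) (hmn : (m : ℝ) ≤ L * n) {x : ℝ} (hx : x ∈ Set.Icc (-1 : ℝ) 1) :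
    uniW α β n x ≤ (L ^ 2) ^ (α + 1 / 2) * (L ^ 2) ^ (β + 1 / 2) * uniW α β m x := by
  have : (0 : ℝ) < n := by exact_mod_cast hn
  have : (0 : ℝ) < m := by exact_mod_cast hm
  have : 0 < ((n : ℝ) ^ 2)⁻¹ := by positivity
  have : 0 < ((m : ℝ) ^ 2)⁻¹ := by positivity
  have inv_sq_le : ((n : ℝ) ^ 2)⁻¹ ≤ L ^ 2 * ((m : ℝ) ^ 2)⁻¹ := by
    rw [← div_eq_mul_inv, inv_eq_one_div, div_le_div_iff₀ (by positivity) (by positivity),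
      one_mul, ← mul_pow]
    gcongr
  have scale_le {t : ℝ} (ht : 0 ≤ t) : t + ((n : ℝ) ^ 2)⁻¹ ≤ L ^ 2 * (t + ((m : ℝ) ^ 2)⁻¹) := by
    nlinarith [le_mul_of_one_le_left ht (one_le_pow₀ (n := 2) hL)]
  have h1 : 0 ≤ 1 - x := by linarith [hx.2]
  have h2 : 0 ≤ 1 + x := by linarith [hx.1]
  unfold uniW
  rw [mul_mul_mul_comm, ← Real.mul_rpow (by positivity) (by linarith),
    ← Real.mul_rpow (by positivity) (by linarith)]
  exact mul_le_mul (Real.rpow_le_rpow (by linarith) (scale_le h1) (by linarith))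
    (Real.rpow_le_rpow (by linarith) (scale_le h2) (by linarith))
    (by positivity) (by positivity)

lemma pow_mul_uniW_le_uniW_add (α β : ℝ) (i : ℕ) {n : ℕ} (hn : 1 ≤ n) {x : ℝ}
    (hx : x ∈ Set.Icc (-1 : ℝ) 1) : (1 - x) ^ i * uniW α β n x ≤ uniW (α + i) β n x := by
  have : (0 : ℝ) < n := by exact_mod_cast hn
  have : 0 < ((n : ℝ) ^ 2)⁻¹ := by positivity
  have base_pos : 0 < 1 - x + ((n : ℝ) ^ 2)⁻¹ := by linarith [hx.2]
  have uniW_add : uniW (α + i) β n x = (1 - x + ((n : ℝ) ^ 2)⁻¹) ^ i * uniW α β n x := by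
    unfold uniW
    rw [add_right_comm, Real.rpow_add base_pos, Real.rpow_natCast]
    ring
  rw [uniW_add]
  refine mul_le_mul_of_nonneg_right ?_ (uniW_pos α β hn hx).le
  exact pow_le_pow_left₀ (by linarith [hx.2]) (by linarith) i

lemma exists_jacobiP_add_sq_mul_uniW_le (hα : -1 / 2 ≤ α) (hβ : -1 / 2 ≤ β) (i : ℕ) :
    ∃ C : ℝ, 0 < C ∧ ∀ (n ν : ℕ) (x : ℝ), 1 ≤ n → ν < 3 * n → x ∈ Set.Icc (-1 : ℝ) 1 →
      (jacobiNormSq α β ν)⁻¹ * ((1 - x) ^ i * jacobiP (α + i) β ν x) ^ 2 * uniW α β n x ≤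
        C * (1 - x) ^ i := by
  have : (0 : ℝ) ≤ i := i.cast_nonneg
  obtain ⟨C₁, hC₁, sq_le⟩ := exists_jacobiP_sq_mul_uniW_le (α := α + i) (by linarith) hβ
  obtain ⟨C₂, hC₂, normSq_le⟩ :=
    exists_jacobiNormSq_left_add_le (α := α) (β := β) (by linarith) (by linarith) (by linarith) i
  set c : ℝ := (3 ^ 2) ^ (α + 1 / 2) * (3 ^ 2) ^ (β + 1 / 2)
  have hc : 0 < c := by positivity
  refine ⟨c * (C₁ * C₂), by positivity, fun n ν x hn hν hx => ?_⟩
  have := jacobiNormSq_pos (α := α) (β := β) (by linarith) (by linarith) ν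
  have ht : 0 ≤ (1 - x) ^ i := pow_nonneg (by linarith [hx.2]) i
  have uniW_le : uniW α β n x ≤ c * uniW α β (ν + 1) x :=
    uniW_le_mul_uniW hα hβ (by norm_num) hn ν.succ_pos (by exact_mod_cast hν) hx
  have uniW_add_ge := pow_mul_uniW_le_uniW_add α β i ν.succ_pos hx
  set p := jacobiP (α + i) β ν x
  set t := (1 - x) ^ i
  calc (jacobiNormSq α β ν)⁻¹ * (t * p) ^ 2 * uniW α β n x
      ≤ (jacobiNormSq α β ν)⁻¹ * (t * p) ^ 2 * (c * uniW α β (ν + 1) x) := by gcongr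
    _ = (jacobiNormSq α β ν)⁻¹ * c * t * (p ^ 2 * (t * uniW α β (ν + 1) x)) := by ring
    _ ≤ (jacobiNormSq α β ν)⁻¹ * c * t * (p ^ 2 * uniW (α + i) β (ν + 1) x) := by gcongr
    _ ≤ (jacobiNormSq α β ν)⁻¹ * c * t * (C₁ * (C₂ * jacobiNormSq α β ν)) := by
        refine mul_le_mul_of_nonneg_left ((sq_le ν x hx).trans ?_) (by positivity)
        gcongr
        exact normSq_le ν
    _ = c * (C₁ * C₂) * t := by field_simp

end JetCoeffBound

/-! ### Decay of the univariate kernel away from the endpoint `-1` -/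

section KernelDecay

open Finset

variable {α β : ℝ}

/-- `q` is a scale for the points `x` and `y` at resolution `n`: in the variable `θ = arccos x` it
bounds the distance of both points to the endpoint `x = 1`, and it is at least `1 / n`. -/
structure IsEndpointScale (n : ℕ) (x y q : ℝ) : Prop where
  one_le : 1 ≤ n
  left_mem : x ∈ Set.Icc (-1 : ℝ) 1
  right_mem : y ∈ Set.Icc (-1 : ℝ) 1
  one_sub_left_le : 1 - x ≤ q ^ 2
  one_sub_right_le : 1 - y ≤ q ^ 2
  inv_le : (n : ℝ)⁻¹ ≤ q

lemma IsEndpointScale.nonneg {n : ℕ} {x y q : ℝ} (h : IsEndpointScale n x y q) : 0 ≤ q :=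
  (by positivity : (0 : ℝ) ≤ (n : ℝ)⁻¹).trans h.inv_le

lemma exists_abs_jetCoeff_le (hα : -1 / 2 ≤ α) (hβ : -1 / 2 ≤ β) (i j : ℕ) :
    ∃ C : ℝ, 0 < C ∧ ∀ (n ν : ℕ) (x y q : ℝ), ν < 3 * n → IsEndpointScale n x y q →
      |jetCoeff α β i j x y ν| ≤ C * q ^ (i + j) / (√(uniW α β n x) * √(uniW α β n y)) := by
  obtain ⟨C₁, hC₁, sq_le_i⟩ := exists_jacobiP_add_sq_mul_uniW_le hα hβ i
  obtain ⟨C₂, hC₂, sq_le_j⟩ := exists_jacobiP_add_sq_mul_uniW_le hα hβ j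
  refine ⟨√(C₁ * C₂), by positivity, fun n ν x y q hν hq => ?_⟩
  have wx := uniW_pos α β hq.one_le hq.left_mem
  have wy := uniW_pos α β hq.one_le hq.right_mem
  have := hq.nonneg
  have := jacobiNormSq_pos (α := α) (β := β) (by linarith) (by linarith) ν
  have pow_x : (1 - x) ^ i ≤ (q ^ 2) ^ i :=
    pow_le_pow_left₀ (by linarith [hq.left_mem.2]) hq.one_sub_left_le i
  have pow_y : (1 - y) ^ j ≤ (q ^ 2) ^ j :=
    pow_le_pow_left₀ (by linarith [hq.right_mem.2]) hq.one_sub_right_le j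
  have sq_x := sq_le_i n ν x hq.one_le hν hq.left_mem
  have sq_y := sq_le_j n ν y hq.one_le hν hq.right_mem
  unfold jetCoeff
  set X := (1 - x) ^ i * jacobiP (α + i) β ν x
  set Y := (1 - y) ^ j * jacobiP (α + j) β ν y
  rw [le_div_iff₀ (by positivity), ← abs_of_nonneg (show 0 ≤ √(uniW α β n x) * √(uniW α β n y) by
    positivity), ← abs_mul]
  refine abs_le_of_sq_le_sq ?_ (by positivity)
  calc ((jacobiNormSq α β ν)⁻¹ * X * Y * (√(uniW α β n x) * √(uniW α β n y))) ^ 2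
      = ((jacobiNormSq α β ν)⁻¹ * X ^ 2 * uniW α β n x) *
        ((jacobiNormSq α β ν)⁻¹ * Y ^ 2 * uniW α β n y) := by
        rw [mul_pow, mul_pow (√(uniW α β n x)), Real.sq_sqrt wx.le, Real.sq_sqrt wy.le]
        ring
    _ ≤ (C₁ * (q ^ 2) ^ i) * (C₂ * (q ^ 2) ^ j) :=
        mul_le_mul (sq_x.trans (by gcongr)) (sq_y.trans (by gcongr)) (by positivity)
          (by positivity)
    _ = (√(C₁ * C₂) * q ^ (i + j)) ^ 2 := by
        rw [mul_pow, Real.sq_sqrt (by positivity)]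
        ring

variable {E : Type*} [NormedAddCommGroup E] [NormedSpace ℝ E]

lemma exists_norm_jetForm_le (hα : -1 / 2 ≤ α) (hβ : -1 / 2 ≤ β) (i j : ℕ) {r : ℤ} (hr : 0 ≤ r) :
    ∃ C : ℝ, 0 ≤ C ∧ ∀ (n : ℕ) (g : ℕ → E) (D x y q : ℝ), SymbolBound 0 r D g →
      IsEndpointScale n x y q → ‖jetForm α β i j (2 * n + 1) x y g‖ ≤
        C * D * (n : ℝ) ^ (r + 1) * q ^ (i + j) / (√(uniW α β n x) * √(uniW α β n y)) := by
  obtain ⟨C, hC, coeff_le⟩ := exists_abs_jetCoeff_le hα hβ i j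
  refine ⟨C * 3 ^ (r + 1), by positivity, fun n g D x y q hg hq => ?_⟩
  have hn : (1 : ℝ) ≤ n := by exact_mod_cast hq.one_le
  have := hg.const_nonneg
  have := hq.nonneg
  set S := √(uniW α β n x) * √(uniW α β n y)
  have term_le (ν : ℕ) (hν : ν ∈ range (2 * n + 1)) :
      ‖jetCoeff α β i j x y ν • g ν‖ ≤ C * q ^ (i + j) / S * (D * (3 * (n : ℝ)) ^ r) := by
    have hν' : ν < 3 * n := by have := mem_range.mp hν; have := hq.one_le; omega
    have succ_le : (ν : ℝ) + 1 ≤ 3 * n := by exact_mod_cast hν'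
    rw [norm_smul]
    refine mul_le_mul (coeff_le n ν x y q hν' hq) ((hg.bound ν).trans ?_) (norm_nonneg _)
      (by positivity)
    have := zpow_le_zpow_left₀ hr (by positivity) succ_le
    gcongr
  calc ‖jetForm α β i j (2 * n + 1) x y g‖
      ≤ ∑ ν ∈ range (2 * n + 1), C * q ^ (i + j) / S * (D * (3 * (n : ℝ)) ^ r) :=
        norm_sum_le_of_le _ term_le
    _ = (2 * (n : ℝ) + 1) * (C * q ^ (i + j) / S * (D * (3 * (n : ℝ)) ^ r)) := by
        rw [sum_const, card_range, nsmul_eq_mul]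
        push_cast
        ring
    _ ≤ (3 * (n : ℝ)) * (C * q ^ (i + j) / S * (D * (3 * (n : ℝ)) ^ r)) :=
        mul_le_mul_of_nonneg_right (by linarith) (by positivity)
    _ = _ := by
        rw [mul_zpow, zpow_add_one₀ (by linarith : (n : ℝ) ≠ 0),
          zpow_add_one₀ (by norm_num : (3 : ℝ) ≠ 0)]
        ring

lemma abs_sub_pow_succ_mul_norm_jetForm_le (hα : -1 < α) (hβ : -1 < β) (m i j K : ℕ) (x y : ℝ)
    {g : ℕ → E} (hg : ∀ ν, K ≤ ν → g ν = 0) :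
    |x - y| ^ (m + 1) * ‖jetForm α β i j K x y g‖ ≤
      |x - y| ^ m * ‖jetForm α β i j K x y (stepDiag α β i j g)‖ +
      |x - y| ^ m * ‖jetForm α β (i + 1) j K x y (stepRaise α β i j g)‖ +
      |x - y| ^ m * ‖jetForm α β i (j + 1) K x y (stepRaise α β j i g)‖ := by
  rw [pow_succ, mul_assoc, ← Real.norm_eq_abs (x - y), ← norm_smul,
    sub_smul_jetForm hα hβ i j K x y hg, ← mul_add, ← mul_add]
  gcongr
  exact (norm_sub_le _ _).trans (by gcongr; exact norm_add_le _ _)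

-- Each factor `x - y` gains `q / n`: raising an order costs one power of `n` in the symbol and
-- gains a factor `q`, while the diagonal step gains `n⁻²`, and `n⁻¹ ≤ q`.
lemma exists_abs_sub_pow_mul_norm_jetForm_le (hα : -1 / 2 ≤ α) (hβ : -1 / 2 ≤ β) (m i j : ℕ)
    {r : ℤ} (hr : 2 * (m : ℤ) ≤ r) : ∃ C : ℝ, 0 ≤ C ∧
      ∀ (n : ℕ) (g : ℕ → E) (D x y q : ℝ), SymbolBound m r D g →
        (∀ ν, 2 * n + 1 ≤ ν → g ν = 0) → IsEndpointScale n x y q →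
        |x - y| ^ m * ‖jetForm α β i j (2 * n + 1) x y g‖ ≤
          C * D * (n : ℝ) ^ (r + 1 - m) * q ^ (i + j + m) /
            (√(uniW α β n x) * √(uniW α β n y)) := by
  have hα' : -1 < α := by linarith
  have hβ' : -1 < β := by linarith
  have hs : -1 ≤ α + β := by linarith
  induction m generalizing i j r with
  | zero =>
    obtain ⟨C, hC, h⟩ := exists_norm_jetForm_le (E := E) hα hβ i j (r := r) (by simpa using hr)
    exact ⟨C, hC, fun n g D x y q hg _ hq => by simpa using h n g D x y q hg hq⟩
  | succ m ih =>
    push_cast at hr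
    obtain ⟨K₀, hK₀, symb₀⟩ := exists_symbolBound_stepDiag (E := E) hα' hβ' hs i j m
    obtain ⟨K₁, hK₁, symb₁⟩ := exists_symbolBound_stepRaise (E := E) hα' hβ' hs i j m
    obtain ⟨K₂, hK₂, symb₂⟩ := exists_symbolBound_stepRaise (E := E) hα' hβ' hs j i m
    obtain ⟨C₀, hC₀, bound₀⟩ := ih i j (r := r + -2) (by omega)
    obtain ⟨C₁, hC₁, bound₁⟩ := ih (i + 1) j (r := r + -1) (by omega)
    obtain ⟨C₂, hC₂, bound₂⟩ := ih i (j + 1) (r := r + -1) (by omega)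
    refine ⟨C₀ * K₀ + C₁ * K₁ + C₂ * K₂, by positivity, fun n g D x y q hg hsupp hq => ?_⟩
    have hn : (0 : ℝ) < n := by exact_mod_cast hq.one_le
    have := hg.const_nonneg
    have := hq.nonneg
    have := hq.inv_le
    have b₀ := bound₀ n _ _ x y q (symb₀ r D g hg) (stepDiag_eq_zero i j hsupp) hq
    have b₁ := bound₁ n _ _ x y q (symb₁ r D g hg) (stepRaise_eq_zero i j hsupp) hq
    have b₂ := bound₂ n _ _ x y q (symb₂ r D g hg) (stepRaise_eq_zero j i hsupp) hq
    refine (abs_sub_pow_succ_mul_norm_jetForm_le hα' hβ' m i j _ x y hsupp).trans ?_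
    refine (add_le_add_three b₀ b₁ b₂).trans ?_
    rw [show r + -2 + 1 - (m : ℤ) = r - m - 1 by ring, show r + -1 + 1 - (m : ℤ) = r - m by ring,
      show r + 1 - ((m + 1 : ℕ) : ℤ) = r - m by push_cast; ring, zpow_sub_one₀ hn.ne',
      ← add_div, ← add_div]
    refine div_le_div_of_nonneg_right ?_ (by positivity)
    calc _ ≤ C₀ * (K₀ * D) * ((n : ℝ) ^ (r - m) * q) * q ^ (i + j + m) +
          C₁ * (K₁ * D) * (n : ℝ) ^ (r - m) * q ^ (i + 1 + j + m) +
          C₂ * (K₂ * D) * (n : ℝ) ^ (r - m) * q ^ (i + (j + 1) + m) := by gcongr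
      _ = _ := by ring

lemma renormC_zero (hα : -1 < α) (hβ : -1 < β) (ν : ℕ) : renormC α β 0 ν = recA α β ν := by
  rw [renormC, Nat.cast_zero, add_zero]
  exact mul_div_cancel₀ _ (recC_ne_zero hα hβ ν)

lemma stepDiag_zero_zero (g : ℕ → E) : stepDiag α β 0 0 g = fun _ => 0 := by
  ext ν
  simp only [stepDiag, sub_self, zero_smul, add_zero, Nat.cast_zero, ← mul_add,
    sub_add_sub_cancel, mul_zero]

lemma stepRaise_zero_zero (hα : -1 < α) (hβ : -1 < β) (g : ℕ → E) :
    stepRaise α β 0 0 g = fun ν => (raiseShift α β ν * recA α β ν) • (g (ν + 1) - g ν) := by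
  ext ν
  simp [stepRaise, renormC_zero hα hβ]

-- Only first differences of `g` survive the first multiplication by `x - y`.
theorem exists_abs_sub_pow_succ_mul_norm_kernel_le (hα : -1 / 2 ≤ α) (hβ : -1 / 2 ≤ β) (m : ℕ)
    {r : ℤ} (hr : 2 * (m : ℤ) ≤ r) : ∃ C : ℝ, 0 ≤ C ∧
      ∀ (n : ℕ) (g : ℕ → E) (D x y q : ℝ), SymbolBound m r D (fun ν => g (ν + 1) - g ν) →
        (∀ ν, 2 * n + 1 ≤ ν → g ν = 0) → IsEndpointScale n x y q →
        |x - y| ^ (m + 1) * ‖jetForm α β 0 0 (2 * n + 1) x y g‖ ≤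
          C * D * (n : ℝ) ^ (r + 1 - m) * q ^ (m + 1) /
            (√(uniW α β n x) * √(uniW α β n y)) := by
  have hα' : -1 < α := by linarith
  have hβ' : -1 < β := by linarith
  obtain ⟨C₁, hC₁, bound₁⟩ := exists_abs_sub_pow_mul_norm_jetForm_le (E := E) hα hβ m 1 0 hr
  obtain ⟨C₂, hC₂, bound₂⟩ := exists_abs_sub_pow_mul_norm_jetForm_le (E := E) hα hβ m 0 1 hr
  obtain ⟨A, hA⟩ := (isSymbol_raiseShift α β).mul
    (isSymbol_recA (α := α) (β := β) (by linarith)) (zero_add 0) m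
  have := hA.const_nonneg
  refine ⟨(C₁ + C₂) * (3 ^ m * A), by positivity, fun n g D x y q hg hsupp hq => ?_⟩
  have symb : SymbolBound m r (3 ^ m * (A * D)) (stepRaise α β 0 0 g) := by
    rw [stepRaise_zero_zero hα' hβ']
    exact (hA.smul hg).mono (zero_add r).le le_rfl
  have b₁ := bound₁ n _ _ x y q symb (stepRaise_eq_zero 0 0 hsupp) hq
  have b₂ := bound₂ n _ _ x y q symb (stepRaise_eq_zero 0 0 hsupp) hq
  have diag_eq_zero : jetForm α β 0 0 (2 * n + 1) x y (stepDiag α β 0 0 g) = 0 := by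
    simp [jetForm, stepDiag_zero_zero]
  calc |x - y| ^ (m + 1) * ‖jetForm α β 0 0 (2 * n + 1) x y g‖
      ≤ |x - y| ^ m * ‖jetForm α β 1 0 (2 * n + 1) x y (stepRaise α β 0 0 g)‖ +
        |x - y| ^ m * ‖jetForm α β 0 1 (2 * n + 1) x y (stepRaise α β 0 0 g)‖ := by
        simpa only [diag_eq_zero, norm_zero, mul_zero, zero_add] using
          abs_sub_pow_succ_mul_norm_jetForm_le hα' hβ' m 0 0 _ x y hsupp
    _ ≤ _ := add_le_add b₁ b₂
    _ = _ := by
        rw [add_zero, zero_add, add_comm 1 m]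
        ring

end KernelDecay

/-! ### Samples of a univariate cutoff -/

section Cutoff

variable {E : Type*} [NormedAddCommGroup E] [NormedSpace ℝ E] {Q : ℕ} {B : ℝ} {D : ℕ → ℝ → E}

/-- `D m` is the `m`-th derivative of `D 0` on `[0, ∞)` for `m ≤ Q`, one-sided at `0`. -/
def IsDerivFamily (Q : ℕ) (D : ℕ → ℝ → E) : Prop :=
  ∀ m < Q, ∀ t, 0 ≤ t → HasDerivWithinAt (D m) (D (m + 1) t) (Set.Ici 0) t

namespace IsDerivFamily

lemma of_le (h : IsDerivFamily Q D) {M : ℕ} (hM : M ≤ Q) : IsDerivFamily M D :=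
  fun m hm => h m (hm.trans_le hM)

lemma norm_sub_le (h : IsDerivFamily Q D) {m : ℕ} (hm : m < Q) {a b : ℝ} (ha : 0 ≤ a)
    (hab : a ≤ b) (hB : ∀ t ∈ Set.Icc a b, ‖D (m + 1) t‖ ≤ B) :
    ‖D m b - D m a‖ ≤ B * (b - a) := by
  have mean_value := (convex_Icc a b).norm_image_sub_le_of_norm_hasDerivWithin_le
    (fun t ht => (h m hm t (ha.trans ht.1)).mono fun s hs => ha.trans hs.1) hB
    (Set.left_mem_Icc.mpr hab) (Set.right_mem_Icc.mpr hab)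
  rwa [Real.norm_of_nonneg (sub_nonneg.mpr hab)] at mean_value

lemma norm_le_of_flat (h : IsDerivFamily Q D) (hflat : ∀ m, 1 ≤ m → m ≤ Q → D m 0 = 0)
    (hB : ∀ t, 0 ≤ t → ‖D Q t‖ ≤ B) {l m : ℕ} (hm : 1 ≤ m) (hl : m + l = Q) {t : ℝ}
    (ht : 0 ≤ t) : ‖D m t‖ ≤ B * t ^ l := by
  induction l generalizing m t with
  | zero =>
    subst hl
    simpa using hB t ht
  | succ l ih =>
    have : 0 ≤ B := (norm_nonneg _).trans (hB 0 le_rfl)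
    have deriv_le (s : ℝ) (hs : s ∈ Set.Icc 0 t) : ‖D (m + 1) s‖ ≤ B * t ^ l :=
      (ih (by omega) (by omega) hs.1).trans (by have := hs.1; have := hs.2; gcongr)
    have sub_le := h.norm_sub_le (by omega) le_rfl ht deriv_le
    rwa [hflat m hm (by omega), sub_zero, sub_zero, mul_assoc, ← pow_succ] at sub_le

lemma difference (h : IsDerivFamily Q D) : IsDerivFamily Q fun m t => D m (t + 1) - D m t := by
  intro m hm t ht
  have shifted : HasDerivWithinAt (fun s => D m (s + 1)) (D (m + 1) (t + 1)) (Set.Ici 0) t := by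
    have := (h m hm (t + 1) (by linarith)).scomp t
      (((hasDerivAt_id t).add_const 1).hasDerivWithinAt (s := Set.Ici 0))
      (fun s hs => add_nonneg hs zero_le_one)
    exact this.congr_deriv (one_smul _ _)
  exact shifted.sub (h m hm t ht)

lemma scale (h : IsDerivFamily Q D) {c : ℝ} (hc : 0 ≤ c) :
    IsDerivFamily Q fun m t => c ^ m • D m (c * t) := by
  intro m hm t ht
  have chain_rule := ((h m hm (c * t) (mul_nonneg hc ht)).scomp t
    (((hasDerivAt_id t).const_mul c).hasDerivWithinAt (s := Set.Ici 0))
    (fun s hs => mul_nonneg hc hs)).const_smul (c ^ m)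
  exact chain_rule.congr_deriv (by simp only [mul_one, smul_smul, pow_succ])

lemma norm_difference_le (h : IsDerivFamily Q D) {e m : ℕ} (hB : 0 ≤ B) (hm : m < Q)
    (hD : ∀ t, 0 ≤ t → ‖D (m + 1) t‖ ≤ B * (t + 1) ^ e) {t : ℝ} (ht : 0 ≤ t) :
    ‖D m (t + 1) - D m t‖ ≤ 2 ^ e * B * (t + 1) ^ e := by
  have deriv_le (s : ℝ) (hs : s ∈ Set.Icc t (t + 1)) :
      ‖D (m + 1) s‖ ≤ B * (2 * (t + 1)) ^ e := by
    have : 0 ≤ s + 1 := by linarith [hs.1]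
    have : s + 1 ≤ 2 * (t + 1) := by linarith [hs.2]
    exact (hD s (ht.trans hs.1)).trans (by gcongr)
  refine (h.norm_sub_le hm ht (by linarith) deriv_le).trans (le_of_eq ?_)
  rw [mul_pow]
  ring

lemma symbolBound {M e : ℕ} (hM : M ≤ e) (h : IsDerivFamily M D)
    (hB : ∀ m ≤ M, ∀ t, 0 ≤ t → ‖D m t‖ ≤ B * (t + 1) ^ (e - m)) :
    SymbolBound M e ((1 + 2 ^ e) ^ M * B) fun ν => D 0 ν := by
  induction M generalizing e B D with
  | zero =>
    intro ν
    simpa using hB 0 le_rfl ν ν.cast_nonneg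
  | succ M ih =>
    have hB₀ : 0 ≤ B := by simpa using (norm_nonneg _).trans (hB 0 (by omega) 0 le_rfl)
    have difference_le (m : ℕ) (hm : m ≤ M) (t : ℝ) (ht : 0 ≤ t) :
        ‖D m (t + 1) - D m t‖ ≤ 2 ^ e * B * (t + 1) ^ (e - 1 - m) := by
      refine (h.norm_difference_le (e := e - 1 - m) hB₀ (by omega) (fun s hs => ?_) ht).trans ?_
      · simpa only [Nat.sub_sub, add_comm 1 m] using hB (m + 1) (by omega) s hs
      · have : (2 : ℝ) ^ (e - 1 - m) ≤ 2 ^ e := pow_le_pow_right₀ (by norm_num) (by omega)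
        gcongr
    have ih' := ih (e := e - 1) (by omega) (h.difference.of_le M.le_succ) difference_le
    rw [Nat.cast_sub (by omega), Nat.cast_one] at ih'
    simp only [← Nat.cast_succ] at ih'
    refine (SymbolBound.succ (C := B) (fun ν => ?_) ih').mono le_rfl ?_
    · simpa using hB 0 (by omega) ν ν.cast_nonneg
    · have : (2 : ℝ) ^ (e - 1) ≤ 2 ^ e := pow_le_pow_right₀ (by norm_num) (by omega)
      have : (1 + (2 : ℝ) ^ (e - 1)) ^ M ≤ (1 + 2 ^ e) ^ M := by gcongr
      have : (1 : ℝ) ≤ (1 + 2 ^ e) ^ M := one_le_pow₀ (by linarith [pow_pos (two_pos (α := ℝ)) e])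
      calc B + (1 + 2 ^ (e - 1)) ^ M * (2 ^ e * B)
          ≤ (1 + 2 ^ e) ^ M * B + (1 + 2 ^ e) ^ M * (2 ^ e * B) := by
            gcongr
            exact le_mul_of_one_le_left hB₀ this
        _ = (1 + 2 ^ e) ^ (M + 1) * B := by ring

end IsDerivFamily

/-- `D` is the family of derivatives of a function on `[0, ∞)` of class `C^Q` that is supported in
`[0, 2]`, is flat at `0` up to order `Q`, and has `Q`-th derivative bounded by `B`. -/
structure IsUniCutoff (Q : ℕ) (B : ℝ) (D : ℕ → ℝ → E) : Prop where
  family : IsDerivFamily Q D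
  flat : ∀ m, 1 ≤ m → m ≤ Q → D m 0 = 0
  bound : ∀ t, 0 ≤ t → ‖D Q t‖ ≤ B
  supp : ∀ t, 2 < t → D 0 t = 0

namespace IsUniCutoff

lemma bound_nonneg (h : IsUniCutoff Q B D) : 0 ≤ B :=
  (norm_nonneg _).trans (h.bound 0 le_rfl)

lemma sample_eq_zero (h : IsUniCutoff Q B D) {n ν : ℕ} (hn : 1 ≤ n) (hν : 2 * n + 1 ≤ ν) :
    D 0 ((ν : ℝ) / n) = 0 := by
  refine h.supp _ ((lt_div_iff₀ (by exact_mod_cast hn)).mpr ?_)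
  exact_mod_cast hν

-- Integrate `D 1` down from `3`, where `D 0` vanishes.
lemma norm_le (h : IsUniCutoff Q B D) (hQ : 1 ≤ Q) {t : ℝ} (ht : 0 ≤ t) : ‖D 0 t‖ ≤ B * 3 ^ Q := by
  have := h.bound_nonneg
  rcases lt_or_ge 2 t with h2 | h2
  · rw [h.supp t h2, norm_zero]
    positivity
  · have deriv_le (s : ℝ) (hs : s ∈ Set.Icc t 3) : ‖D (0 + 1) s‖ ≤ B * 3 ^ (Q - 1) := by
      have hs₀ := ht.trans hs.1
      have := hs.2
      exact (h.family.norm_le_of_flat (l := Q - 1) h.flat h.bound le_rfl (by omega) hs₀).trans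
        (by gcongr)
    have sub_le := h.family.norm_sub_le hQ ht (by linarith) deriv_le
    rw [h.supp 3 (by norm_num), zero_sub, norm_neg] at sub_le
    calc ‖D 0 t‖ ≤ B * 3 ^ (Q - 1) * (3 - t) := sub_le
      _ ≤ B * 3 ^ (Q - 1) * 3 := by gcongr; linarith
      _ = B * 3 ^ Q := by rw [mul_assoc, pow_sub_one_mul (by omega)]

lemma norm_scaled_deriv_le (h : IsUniCutoff Q B D) {m : ℕ} (hm : m < Q) {c t : ℝ} (hc : 0 ≤ c)
    (ht : 0 ≤ t) : ‖c ^ (m + 1) • D (m + 1) (c * t)‖ ≤ B * c ^ Q * t ^ (Q - 1 - m) := by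
  rw [norm_smul, Real.norm_of_nonneg (by positivity)]
  calc c ^ (m + 1) * ‖D (m + 1) (c * t)‖ ≤ c ^ (m + 1) * (B * (c * t) ^ (Q - 1 - m)) := by
        gcongr
        exact h.family.norm_le_of_flat h.flat h.bound (by omega) (by omega) (mul_nonneg hc ht)
    _ = B * (c ^ (m + 1) * c ^ (Q - 1 - m)) * t ^ (Q - 1 - m) := by rw [mul_pow]; ring
    _ = B * c ^ Q * t ^ (Q - 1 - m) := by rw [← pow_add]; congr 3; omega

theorem symbolBound_difference (h : IsUniCutoff Q B D) {M : ℕ} (hM : M < Q) (n : ℕ) :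
    SymbolBound M (Q - 1 : ℕ) ((1 + 2 ^ (Q - 1)) ^ M * (B * (n : ℝ)⁻¹ ^ Q))
      fun ν => D 0 (((ν + 1 : ℕ) : ℝ) / n) - D 0 ((ν : ℝ) / n) := by
  have hc : (0 : ℝ) ≤ (n : ℝ)⁻¹ := by positivity
  have := h.bound_nonneg
  have scaled := h.family.scale hc
  have difference_le (m : ℕ) (hm : m ≤ M) (t : ℝ) (ht : 0 ≤ t) :
      ‖(n : ℝ)⁻¹ ^ m • D m ((n : ℝ)⁻¹ * (t + 1)) - (n : ℝ)⁻¹ ^ m • D m ((n : ℝ)⁻¹ * t)‖ ≤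
        B * (n : ℝ)⁻¹ ^ Q * (t + 1) ^ (Q - 1 - m) := by
    have deriv_le (s : ℝ) (hs : s ∈ Set.Icc t (t + 1)) :
        ‖(n : ℝ)⁻¹ ^ (m + 1) • D (m + 1) ((n : ℝ)⁻¹ * s)‖ ≤
          B * (n : ℝ)⁻¹ ^ Q * (t + 1) ^ (Q - 1 - m) := by
      have := ht.trans hs.1
      have := hs.2
      exact (h.norm_scaled_deriv_le (by omega) hc (ht.trans hs.1)).trans (by gcongr)
    simpa using scaled.norm_sub_le (m := m) (by omega) ht (by linarith) deriv_le
  simpa only [pow_zero, one_smul, div_eq_inv_mul, Nat.cast_succ] using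
    (scaled.difference.of_le hM.le).symbolBound (by omega) difference_le

end IsUniCutoff

end Cutoff

/-! ### Localization of the univariate kernel -/

section UnivariateLocalization

open Finset Real

lemma jetCoeff_neg (α β : ℝ) (x y : ℝ) (ν : ℕ) :
    jetCoeff α β 0 0 (-x) (-y) ν = jetCoeff β α 0 0 x y ν := by
  have sign_sq : ((-1 : ℝ) ^ ν) * (-1) ^ ν = 1 := by rw [← mul_pow, neg_one_mul, neg_neg, one_pow]
  simp only [jetCoeff, pow_zero, one_mul, Nat.cast_zero, add_zero, jacobiP_neg α β,
    jacobiNormSq_swap α β]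
  linear_combination ((jacobiNormSq β α ν)⁻¹ * jacobiP β α ν x * jacobiP β α ν y) * sign_sq

lemma two_div_pi_mul_abs_le_abs_sin {t : ℝ} (ht : |t| ≤ π / 2) : 2 / π * |t| ≤ |sin t| := by
  refine (mul_le_sin (abs_nonneg t) ht).trans ?_
  rcases abs_choice t with h | h <;> rw [h]
  · exact le_abs_self _
  · rw [sin_neg]
    exact neg_le_abs _

lemma add_mul_abs_sub_arccos_le_abs_sub {x y : ℝ} (hx : x ∈ Set.Icc (-1 : ℝ) 1)
    (hy : y ∈ Set.Icc (-1 : ℝ) 1) (h : arccos x + arccos y ≤ π) :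
    2 / π ^ 2 * ((arccos x + arccos y) * |arccos x - arccos y|) ≤ |x - y| := by
  have := arccos_nonneg x
  have := arccos_nonneg y
  set s := (arccos x + arccos y) / 2 with hs
  set t := (arccos x - arccos y) / 2 with ht
  have hs₀ : 0 ≤ s := by positivity
  have sub_eq : |x - y| = 2 * |sin s| * |sin t| := by
    rw [← cos_arccos hx.1 hx.2, ← cos_arccos hy.1 hy.2, cos_sub_cos, abs_mul, abs_mul, abs_neg,
      abs_two]
  have sin_s := two_div_pi_mul_abs_le_abs_sin (t := s) (by rw [abs_of_nonneg hs₀]; linarith)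
  have sin_t := two_div_pi_mul_abs_le_abs_sin (t := t) (by rw [abs_le]; constructor <;> linarith)
  calc 2 / π ^ 2 * ((arccos x + arccos y) * |arccos x - arccos y|)
      = 2 * (2 / π * |s|) * (2 / π * |t|) := by
        rw [abs_of_nonneg hs₀, ht, abs_div, abs_two, hs]
        field_simp
    _ ≤ |x - y| := by rw [sub_eq]; gcongr

lemma one_sub_le_arccos_sq {x : ℝ} (hx : x ∈ Set.Icc (-1 : ℝ) 1) : 1 - x ≤ arccos x ^ 2 := by
  have one_sub_sq_le := one_sub_sq_div_two_le_cos (x := arccos x)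
  rw [cos_arccos hx.1 hx.2] at one_sub_sq_le
  nlinarith [sq_nonneg (arccos x)]

variable {α β : ℝ} {E : Type*} [NormedAddCommGroup E] [NormedSpace ℝ E]

lemma jetForm_neg (α β : ℝ) (K : ℕ) (x y : ℝ) (g : ℕ → E) :
    jetForm α β 0 0 K (-x) (-y) g = jetForm β α 0 0 K x y g := by
  simp only [jetForm, jetCoeff_neg]

lemma isEndpointScale_two {n : ℕ} {x y : ℝ} (hn : 1 ≤ n) (hx : x ∈ Set.Icc (-1 : ℝ) 1)
    (hy : y ∈ Set.Icc (-1 : ℝ) 1) : IsEndpointScale n x y 2 :=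
  ⟨hn, hx, hy, by linarith [hx.1], by linarith [hy.1],
    (inv_le_one_of_one_le₀ (by exact_mod_cast hn)).trans one_le_two⟩

lemma exists_norm_cutoff_kernel_le (hα : -1 / 2 ≤ α) (hβ : -1 / 2 ≤ β) {Q : ℕ} (hQ : 1 ≤ Q) :
    ∃ C : ℝ, 0 ≤ C ∧ ∀ (B : ℝ) (D : ℕ → ℝ → E) (n : ℕ) (x y : ℝ), IsUniCutoff Q B D → 1 ≤ n →
      x ∈ Set.Icc (-1 : ℝ) 1 → y ∈ Set.Icc (-1 : ℝ) 1 →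
      ‖jetForm α β 0 0 (2 * n + 1) x y (fun ν => D 0 ((ν : ℝ) / n))‖ ≤
        C * B * n / (√(uniW α β n x) * √(uniW α β n y)) := by
  obtain ⟨C, hC, form_le⟩ := exists_norm_jetForm_le (E := E) hα hβ 0 0 le_rfl
  refine ⟨C * 3 ^ Q, by positivity, fun B D n x y hD hn hx hy => ?_⟩
  have symb : SymbolBound 0 0 (B * 3 ^ Q) fun ν : ℕ => D 0 ((ν : ℝ) / n) := fun ν => by
    rw [zpow_zero, mul_one]
    exact hD.norm_le hQ (by positivity)
  refine (form_le n _ _ x y 2 symb (isEndpointScale_two hn hx hy)).trans (le_of_eq ?_)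
  rw [zero_add, zpow_one, pow_zero]
  ring

lemma isEndpointScale_arccos_add_arccos {n : ℕ} {x y : ℝ} (hn : 1 ≤ n)
    (hx : x ∈ Set.Icc (-1 : ℝ) 1) (hy : y ∈ Set.Icc (-1 : ℝ) 1)
    (hfar : 1 ≤ n * |arccos x - arccos y|) : IsEndpointScale n x y (arccos x + arccos y) := by
  have hn₀ : (0 : ℝ) < n := by exact_mod_cast hn
  have := arccos_nonneg x
  have := arccos_nonneg y
  have abs_sub_le : |arccos x - arccos y| ≤ arccos x + arccos y :=
    abs_le.mpr ⟨by linarith, by linarith⟩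
  exact ⟨hn, hx, hy, (one_sub_le_arccos_sq hx).trans (by gcongr; linarith),
    (one_sub_le_arccos_sq hy).trans (by gcongr; linarith),
    ((inv_le_iff_one_le_mul₀' hn₀).mpr hfar).trans abs_sub_le⟩

-- The decay estimate at scale `θ + φ` carries the factor `(θ + φ) ^ k`, which cancels because
-- `|x - y|` is comparable to `(θ + φ) |θ - φ|`.
lemma exists_pow_mul_norm_cutoff_kernel_le (hα : -1 / 2 ≤ α) (hβ : -1 / 2 ≤ β) {k : ℕ}
    (hk : 1 ≤ k) : ∃ C : ℝ, 0 ≤ C ∧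
      ∀ (B : ℝ) (D : ℕ → ℝ → E) (n : ℕ) (x y : ℝ), IsUniCutoff (3 * k - 1) B D → 1 ≤ n →
      x ∈ Set.Icc (-1 : ℝ) 1 → y ∈ Set.Icc (-1 : ℝ) 1 → arccos x + arccos y ≤ π →
      1 ≤ n * |arccos x - arccos y| →
      (n * |arccos x - arccos y|) ^ k *
        ‖jetForm α β 0 0 (2 * n + 1) x y (fun ν => D 0 ((ν : ℝ) / n))‖ ≤
      C * B * n / (√(uniW α β n x) * √(uniW α β n y)) := by
  obtain ⟨C, hC, decay⟩ := exists_abs_sub_pow_succ_mul_norm_kernel_le (E := E) hα hβ (k - 1)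
    (r := (3 * k - 1 - 1 : ℕ)) (by omega)
  refine ⟨(π ^ 2 / 2) ^ k * (C * (1 + 2 ^ (3 * k - 1 - 1)) ^ (k - 1)), by positivity,
    fun B D n x y hD hn hx hy hsum hfar => ?_⟩
  have hn₀ : (0 : ℝ) < n := by exact_mod_cast hn
  have hscale := isEndpointScale_arccos_add_arccos hn hx hy hfar
  have main := decay n _ _ x y _ (hD.symbolBound_difference (by omega) n)
    (fun ν => hD.sample_eq_zero hn) hscale
  have sub_ge := add_mul_abs_sub_arccos_le_abs_sub hx hy hsum
  set ρ := |arccos x - arccos y|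
  set q := arccos x + arccos y
  have : 0 < q := (by positivity : (0 : ℝ) < (n : ℝ)⁻¹).trans_le hscale.inv_le
  set J := ‖jetForm α β 0 0 (2 * n + 1) x y (fun ν => D 0 ((ν : ℝ) / n))‖
  set S := √(uniW α β n x) * √(uniW α β n y)
  rw [Nat.sub_add_cancel hk, show ((3 * k - 1 - 1 : ℕ) : ℤ) + 1 - (k - 1 : ℕ) =
    (3 * k - 1 : ℕ) + (1 - (k : ℤ)) by omega, zpow_add₀ hn₀.ne', zpow_sub₀ hn₀.ne',
    zpow_natCast, zpow_natCast, zpow_one] at main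
  calc (n * ρ) ^ k * J
      = (π ^ 2 / 2 * n / q) ^ k * ((2 / π ^ 2 * (q * ρ)) ^ k * J) := by
        rw [← mul_assoc, ← mul_pow]
        congr 2
        field_simp
    _ ≤ (π ^ 2 / 2 * n / q) ^ k * (|x - y| ^ k * J) := by gcongr
    _ ≤ _ := mul_le_mul_of_nonneg_left main (by positivity)
    _ = (π ^ 2 / 2) ^ k * (C * (1 + 2 ^ (3 * k - 1 - 1)) ^ (k - 1)) * B * n / S := by
        simp only [div_pow, mul_pow, inv_pow]
        field_simp

lemma exists_one_add_pow_mul_norm_cutoff_kernel_le_of_add_le (hα : -1 / 2 ≤ α) (hβ : -1 / 2 ≤ β)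
    {k : ℕ} (hk : 1 ≤ k) : ∃ C : ℝ, 0 ≤ C ∧
      ∀ (B : ℝ) (D : ℕ → ℝ → E) (n : ℕ) (x y : ℝ), IsUniCutoff (3 * k - 1) B D → 1 ≤ n →
      x ∈ Set.Icc (-1 : ℝ) 1 → y ∈ Set.Icc (-1 : ℝ) 1 → arccos x + arccos y ≤ π →
      (1 + n * |arccos x - arccos y|) ^ k *
        ‖jetForm α β 0 0 (2 * n + 1) x y (fun ν => D 0 ((ν : ℝ) / n))‖ ≤
      C * B * n / (√(uniW α β n x) * √(uniW α β n y)) := by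
  obtain ⟨C₀, hC₀, near⟩ := exists_norm_cutoff_kernel_le (E := E) hα hβ
    (Q := 3 * k - 1) (by omega)
  obtain ⟨C₁, -, far⟩ := exists_pow_mul_norm_cutoff_kernel_le (E := E) hα hβ hk
  refine ⟨2 ^ k * max C₀ C₁, by positivity, fun B D n x y hD hn hx hy hsum => ?_⟩
  have := hD.bound_nonneg
  set J := ‖jetForm α β 0 0 (2 * n + 1) x y (fun ν => D 0 ((ν : ℝ) / n))‖
  set S := √(uniW α β n x) * √(uniW α β n y)
  set ρ := |arccos x - arccos y|
  rw [mul_assoc (2 ^ k), mul_assoc (2 ^ k), mul_div_assoc]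
  rcases le_total ((n : ℝ) * ρ) 1 with hnear | hfar
  · have : 1 + (n : ℝ) * ρ ≤ 2 := by linarith
    calc (1 + (n : ℝ) * ρ) ^ k * J ≤ 2 ^ k * (C₀ * B * n / S) := by
          gcongr
          exact near B D n x y hD hn hx hy
      _ ≤ _ := by gcongr; exact le_max_left _ _
  · have : 1 + (n : ℝ) * ρ ≤ 2 * (n * ρ) := by linarith
    calc (1 + (n : ℝ) * ρ) ^ k * J ≤ (2 * (n * ρ)) ^ k * J := by gcongr
      _ = 2 ^ k * ((n * ρ) ^ k * J) := by rw [mul_pow, mul_assoc]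
      _ ≤ 2 ^ k * (C₁ * B * n / S) := by
          gcongr
          exact far B D n x y hD hn hx hy hsum hfar
      _ ≤ _ := by gcongr; exact le_max_right _ _

-- The reflection `x ↦ -x` swaps `α` and `β` and reduces to `arccos x + arccos y ≤ π`.
theorem exists_one_add_pow_mul_norm_cutoff_kernel_le (hα : -1 / 2 ≤ α) (hβ : -1 / 2 ≤ β) {k : ℕ}
    (hk : 1 ≤ k) : ∃ C : ℝ, 0 ≤ C ∧
      ∀ (B : ℝ) (D : ℕ → ℝ → E) (n : ℕ) (x y : ℝ), IsUniCutoff (3 * k - 1) B D → 1 ≤ n →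
      x ∈ Set.Icc (-1 : ℝ) 1 → y ∈ Set.Icc (-1 : ℝ) 1 →
      (1 + n * |arccos x - arccos y|) ^ k *
        ‖jetForm α β 0 0 (2 * n + 1) x y (fun ν => D 0 ((ν : ℝ) / n))‖ ≤
      C * B * n / (√(uniW α β n x) * √(uniW α β n y)) := by
  obtain ⟨C₁, hC₁, direct⟩ :=
    exists_one_add_pow_mul_norm_cutoff_kernel_le_of_add_le (E := E) hα hβ hk
  obtain ⟨C₂, -, reflected⟩ :=
    exists_one_add_pow_mul_norm_cutoff_kernel_le_of_add_le (E := E) hβ hα hk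
  refine ⟨max C₁ C₂, by positivity, fun B D n x y hD hn hx hy => ?_⟩
  have := hD.bound_nonneg
  rcases le_total (arccos x + arccos y) π with hsum | hsum
  · refine (direct B D n x y hD hn hx hy hsum).trans ?_
    gcongr
    exact le_max_left _ _
  · have key := reflected B D n (-x) (-y) hD hn ⟨by linarith [hx.2], by linarith [hx.1]⟩
      ⟨by linarith [hy.2], by linarith [hy.1]⟩ (by rw [arccos_neg, arccos_neg]; linarith)
    rw [jetForm_neg, uniW_neg, uniW_neg, arccos_neg, arccos_neg, sub_sub_sub_cancel_left,
      abs_sub_comm] at key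
    refine key.trans ?_
    gcongr
    exact le_max_right _ _

end UnivariateLocalization

/-! ### Multivariate cutoffs along coordinate lines -/

section MultivariateCutoff

open Function

variable {d : ℕ} {A : (Fin d → ℝ) → ℂ} {t : Fin d → ℝ} {ℓ : Fin d}

lemma update_mem_orthant (ht : t ∈ orthant d) (ℓ : Fin d) {s : ℝ} (hs : 0 ≤ s) :
    update t ℓ s ∈ orthant d := by
  intro j
  rcases eq_or_ne j ℓ with rfl | hj
  · simpa using hs
  · simpa [hj] using ht j

lemma contDiffOn_comp_update {N : ℕ∞ω} (hA : ContDiffOn ℝ N A (orthant d)) (ht : t ∈ orthant d)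
    (ℓ : Fin d) : ContDiffOn ℝ N (fun s => A (update t ℓ s)) (Set.Ici 0) :=
  hA.comp (contDiff_update N t ℓ).contDiffOn fun _ hs => update_mem_orthant ht ℓ hs

lemma partialD_update (ℓ : Fin d) (m : ℕ) (A : (Fin d → ℝ) → ℂ) (t : Fin d → ℝ) (s : ℝ) :
    partialD ℓ m A (update t ℓ s) =
      iteratedDerivWithin m (fun s => A (update t ℓ s)) (Set.Ici 0) s := by
  simp [partialD]

theorem IsCutoff.isUniCutoff {k : ℕ} (hA : IsCutoff k A) {B : ℝ}
    (hB : ∀ t ∈ orthant d, ‖partialD ℓ (3 * k - 1) A t‖ ≤ B) (ht : t ∈ orthant d)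
    (ht2 : ∀ j, t j ≤ 2) :
    IsUniCutoff (3 * k - 1) B fun m s => partialD ℓ m A (update t ℓ s) where
  family m hm s hs := by
    have differentiable := (contDiffOn_comp_update hA.contDiffOn ht ℓ)
      |>.differentiableOn_iteratedDerivWithin (m := m) (by exact_mod_cast hm)
        (uniqueDiffOn_Ici 0) s hs
    simp only [partialD_update, iteratedDerivWithin_succ]
    exact differentiable.hasDerivWithinAt
  flat m h1 hm := by
    refine hA.boundary ℓ _ (update_mem_orthant ht ℓ le_rfl) (fun j => ?_) (by simp) m h1 hm
    rcases eq_or_ne j ℓ with rfl | hj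
    · simp
    · simpa [hj] using ht2 j
  bound s hs := hB _ (update_mem_orthant ht ℓ hs)
  supp s hs := by
    rw [partialD_update, iteratedDerivWithin_zero]
    by_contra h
    have le_two := hA.supp _ (update_mem_orthant ht ℓ (by linarith)) h ℓ
    rw [update_self] at le_two
    linarith

lemma uniqueDiffOn_orthant (d : ℕ) : UniqueDiffOn ℝ (orthant d) := by
  have orthant_eq_pi : orthant d = Set.univ.pi fun _ => Set.Ici 0 := by
    ext t
    simp only [orthant, Set.mem_ofPred_eq, Set.mem_univ_pi, Set.mem_Ici]
  rw [orthant_eq_pi]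
  exact UniqueDiffOn.univ_pi fun _ => uniqueDiffOn_Ici 0

/-- The iterated derivative of `A` in the direction of a coordinate axis, taken within the orthant.
For smooth `A` it agrees with `partialD`, and its joint continuity is immediate. -/
def axisDeriv (ℓ : Fin d) (A : (Fin d → ℝ) → ℂ) : ℕ → (Fin d → ℝ) → ℂ
  | 0 => A
  | m + 1 => fun t => fderivWithin ℝ (axisDeriv ℓ A m) (orthant d) t (Pi.single ℓ 1)

lemma contDiffOn_axisDeriv (hA : ContDiffOn ℝ ∞ A (orthant d)) (ℓ : Fin d) (m : ℕ) :
    ContDiffOn ℝ ∞ (axisDeriv ℓ A m) (orthant d) := by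
  induction m with
  | zero => exact hA
  | succ m ih =>
    exact (ih.fderivWithin (uniqueDiffOn_orthant d) (by simp)).clm_apply contDiffOn_const

lemma partialD_eq_axisDeriv (hA : ContDiffOn ℝ ∞ A (orthant d)) (ℓ : Fin d) (m : ℕ)
    (ht : t ∈ orthant d) : partialD ℓ m A t = axisDeriv ℓ A m t := by
  induction m generalizing t with
  | zero => simp [partialD, axisDeriv]
  | succ m ih =>
    have eqOn : Set.EqOn (iteratedDerivWithin m (fun s => A (update t ℓ s)) (Set.Ici 0))
        (fun s => axisDeriv ℓ A m (update t ℓ s)) (Set.Ici 0) := fun s hs => by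
      rw [← partialD_update, ih (update_mem_orthant ht ℓ hs)]
    have hasFDeriv :=
      ((contDiffOn_axisDeriv hA ℓ m).differentiableOn (by simp) t ht).hasFDerivWithinAt
    rw [← update_eq_self ℓ t] at hasFDeriv
    have hasDeriv := hasFDeriv.comp_hasDerivWithinAt (t ℓ)
      (hasDerivAt_update t ℓ (t ℓ)).hasDerivWithinAt (s := Set.Ici 0)
      fun s hs => update_mem_orthant ht ℓ hs
    rw [update_eq_self] at hasDeriv
    rw [partialD, iteratedDerivWithin_succ, derivWithin_congr eqOn (eqOn (ht ℓ))]
    exact hasDeriv.derivWithin (uniqueDiffOn_Ici 0 _ (ht ℓ))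

lemma axisDeriv_eq_zero (hA : SuppInCube A) (ℓ : Fin d) (m : ℕ) {j : Fin d} (ht : t ∈ orthant d)
    (hj : 2 < t j) : axisDeriv ℓ A m t = 0 := by
  induction m generalizing t with
  | zero =>
    by_contra h
    exact absurd (hA t ht h j) (not_le.mpr hj)
  | succ m ih =>
    have eventually_zero : axisDeriv ℓ A m =ᶠ[nhdsWithin t (orthant d)] fun _ => 0 := by
      have two_lt : ∀ᶠ u in nhds t, 2 < u j :=
        (continuous_apply j).continuousAt.eventually (lt_mem_nhds hj)
      filter_upwards [two_lt.filter_mono nhdsWithin_le_nhds, self_mem_nhdsWithin] with u hu hu'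
      exact ih hu' hu
    simp only [axisDeriv]
    rw [eventually_zero.fderivWithin_eq (ih ht hj)]
    simp

lemma IsAdmissible.exists_norm_partialD_le (hA : IsAdmissible A) (ℓ : Fin d) (m : ℕ) :
    ∃ M : ℝ, ∀ t ∈ orthant d, ‖partialD ℓ m A t‖ ≤ M := by
  have cube_subset : Set.Icc (0 : Fin d → ℝ) (fun _ => 2) ⊆ orthant d := fun t ht j => ht.1 j
  obtain ⟨M, hM⟩ := isCompact_Icc.exists_bound_of_continuousOn
    ((contDiffOn_axisDeriv hA.contDiffOn ℓ m).continuousOn.mono cube_subset)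
  refine ⟨max M 0, fun t ht => ?_⟩
  rw [partialD_eq_axisDeriv hA.contDiffOn ℓ m ht]
  by_cases h : ∀ j, t j ≤ 2
  · exact (hM t ⟨ht, h⟩).trans (le_max_left _ _)
  · push Not at h
    obtain ⟨j, hj⟩ := h
    rw [axisDeriv_eq_zero hA.supp ℓ m ht hj, norm_zero]
    exact le_max_right _ _

lemma IsAdmissible.isCutoff (hA : IsAdmissible A) (k : ℕ) : IsCutoff k A where
  contDiffOn := hA.contDiffOn.of_le (by exact_mod_cast le_top)
  supp := hA.supp
  boundary ℓ t ht _ h0 m h1 _ := hA.boundary ℓ t ht h0 m h1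

end MultivariateCutoff

/-! ### Tensor product kernels -/

section TensorKernel

open Finset Function

section SumLines

variable {ι κ : Type*} [Fintype ι] [DecidableEq ι] (S : Finset κ) (ℓ : ι)

-- `(ν, s) ↦ (update ν ℓ s, ν ℓ)` is an involution of the index set.
lemma sum_piFinset_sum_update {M : Type*} [AddCommMonoid M] (F : (ι → κ) → M) :
    ∑ ν ∈ Fintype.piFinset fun _ => S, ∑ s ∈ S, F (update ν ℓ s) =
      #S • ∑ ν ∈ Fintype.piFinset fun _ => S, F ν := by
  have update_mem (ν : ι → κ) (hν : ν ∈ Fintype.piFinset fun _ => S) (s : κ) (hs : s ∈ S) :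
      update ν ℓ s ∈ Fintype.piFinset fun _ => S :=
    Fintype.mem_piFinset.mpr <|
      (forall_update_iff ν fun _ a => a ∈ S).mpr ⟨hs, fun j _ => Fintype.mem_piFinset.mp hν j⟩
  have swap_mem (p : (ι → κ) × κ) (hp : p ∈ (Fintype.piFinset fun _ => S) ×ˢ S) :
      (update p.1 ℓ p.2, p.1 ℓ) ∈ (Fintype.piFinset fun _ => S) ×ˢ S := by
    rw [mem_product] at hp ⊢
    exact ⟨update_mem p.1 hp.1 p.2 hp.2, Fintype.mem_piFinset.mp hp.1 ℓ⟩
  have swap_swap (p : (ι → κ) × κ) :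
      (update (update p.1 ℓ p.2) ℓ (p.1 ℓ), update p.1 ℓ p.2 ℓ) = p := by simp
  calc _ = ∑ p ∈ (Fintype.piFinset fun _ => S) ×ˢ S, F (update p.1 ℓ p.2) :=
        (sum_product' _ _ fun ν s => F (update ν ℓ s)).symm
    _ = ∑ p ∈ (Fintype.piFinset fun _ : ι => S) ×ˢ S, F p.1 :=
        sum_nbij' (fun p => (update p.1 ℓ p.2, p.1 ℓ)) (fun p => (update p.1 ℓ p.2, p.1 ℓ))
          swap_mem swap_mem (fun p _ => swap_swap p) (fun p _ => swap_swap p) fun _ _ => rfl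
    _ = _ := by simp only [sum_product, sum_const, sum_nsmul]

lemma card_mul_norm_sum_piFinset_le {E : Type*} [NormedAddCommGroup E] [NormedSpace ℝ E]
    {F : (ι → κ) → E} {b : ℝ}
    (hF : ∀ ν ∈ Fintype.piFinset fun _ => S, ‖∑ s ∈ S, F (update ν ℓ s)‖ ≤ b) :
    #S * ‖∑ ν ∈ Fintype.piFinset fun _ => S, F ν‖ ≤ #S ^ Fintype.card ι * b := by
  calc #S * ‖∑ ν ∈ Fintype.piFinset fun _ => S, F ν‖
      = ‖∑ ν ∈ Fintype.piFinset fun _ => S, ∑ s ∈ S, F (update ν ℓ s)‖ := by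
        rw [sum_piFinset_sum_update, ← Nat.cast_smul_eq_nsmul ℝ, norm_smul,
          Real.norm_of_nonneg (Nat.cast_nonneg _)]
    _ ≤ #(Fintype.piFinset fun _ : ι => S) • b := norm_sum_le_of_le _ hF |>.trans_eq (sum_const _)
    _ = #S ^ Fintype.card ι * b := by simp

lemma sum_prod_update_smul {E : Type*} [AddCommGroup E] [Module ℝ E] (G : ι → κ → ℝ)
    (F : (ι → κ) → E) (ν : ι → κ) :
    ∑ s ∈ S, (∏ j, G j (update ν ℓ s j)) • F (update ν ℓ s) =
      (∏ j ∈ univ.erase ℓ, G j (ν j)) • ∑ s ∈ S, G ℓ s • F (update ν ℓ s) := by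
  rw [smul_sum]
  refine sum_congr rfl fun s _ => ?_
  have off_line : ∏ j ∈ univ.erase ℓ, G j (update ν ℓ s j) = ∏ j ∈ univ.erase ℓ, G j (ν j) :=
    prod_congr rfl fun j hj => by rw [update_of_ne (ne_of_mem_erase hj)]
  rw [← mul_prod_erase univ _ (mem_univ ℓ), off_line, update_self, smul_smul, mul_comm]

end SumLines

lemma jacobiPn_mul_jacobiPn {α β : ℝ} (hα : -1 < α) (hβ : -1 < β) (ν : ℕ) (x y : ℝ) :
    jacobiPn α β ν x * jacobiPn α β ν y = jetCoeff α β 0 0 x y ν := by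
  have sqrt_sq := Real.mul_self_sqrt (jacobiNormSq_pos hα hβ ν).le
  simp only [jacobiPn, jetCoeff, pow_zero, one_mul, Nat.cast_zero, add_zero]
  rw [← sqrt_sq, mul_inv, sqrt_sq]
  ring

variable {d : ℕ} {α β : Fin d → ℝ} {A : (Fin d → ℝ) → ℂ}

lemma kernel_eq_sum (hα : ∀ j, -1 < α j) (hβ : ∀ j, -1 < β j) (hA : SuppInCube A) {n : ℕ}
    (hn : 1 ≤ n) (x y : Fin d → ℝ) :
    kernel α β A n x y = ∑ ν ∈ Fintype.piFinset fun _ => range (2 * n + 1),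
      (∏ j, jetCoeff (α j) (β j) 0 0 (x j) (y j) (ν j)) • A fun j => (ν j : ℝ) / n := by
  rw [kernel, tsum_eq_sum (s := Fintype.piFinset fun _ => range (2 * n + 1))]
  · refine sum_congr rfl fun ν _ => ?_
    rw [mul_assoc, mul_comm, ← Complex.ofReal_mul, tensorJacobi, tensorJacobi, ← prod_mul_distrib,
      Complex.real_smul]
    simp only [jacobiPn_mul_jacobiPn (hα _) (hβ _)]
  · intro ν hν
    rw [mul_assoc]
    refine mul_eq_zero_of_left ?_ _
    by_contra h
    refine hν (Fintype.mem_piFinset.mpr fun j => mem_range_succ_iff.mpr ?_)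
    have le_two := hA _ (fun j => by positivity) h j
    rw [div_le_iff₀ (by exact_mod_cast hn)] at le_two
    exact_mod_cast le_two

lemma sqrt_bigW_mul_sqrt_bigW {n : ℕ} (hn : 1 ≤ n) {x y : Fin d → ℝ}
    (hx : x ∈ Set.Icc (-1 : Fin d → ℝ) 1) (hy : y ∈ Set.Icc (-1 : Fin d → ℝ) 1) :
    √(bigW α β n x) * √(bigW α β n y) =
      ∏ j, (√(uniW (α j) (β j) n (x j)) * √(uniW (α j) (β j) n (y j))) := by
  rw [prod_mul_distrib, ← Real.sqrt_prod _ fun j _ => (uniW_pos _ _ hn ⟨hx.1 j, hx.2 j⟩).le,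
    ← Real.sqrt_prod _ fun j _ => (uniW_pos _ _ hn ⟨hy.1 j, hy.2 j⟩).le]
  rfl

lemma sum_kernel_line_eq (ℓ : Fin d) (n K : ℕ) (x y : Fin d → ℝ) (ν : Fin d → ℕ) :
    ∑ s ∈ range K, (∏ j, jetCoeff (α j) (β j) 0 0 (x j) (y j) (update ν ℓ s j)) •
        A (fun j => ((update ν ℓ s j : ℕ) : ℝ) / n) =
      (∏ j ∈ univ.erase ℓ, jetCoeff (α j) (β j) 0 0 (x j) (y j) (ν j)) •
        jetForm (α ℓ) (β ℓ) 0 0 K (x ℓ) (y ℓ)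
          fun s => partialD ℓ 0 A (update (fun j => (ν j : ℝ) / n) ℓ ((s : ℝ) / n)) := by
  have div_update (s : ℕ) : (fun j => ((update ν ℓ s j : ℕ) : ℝ) / n) =
      update (fun j => (ν j : ℝ) / n) ℓ (s / n) :=
    funext fun j => apply_update (fun _ (a : ℕ) => (a : ℝ) / n) ν ℓ s j
  refine (sum_prod_update_smul (range K) ℓ
    (fun j => jetCoeff (α j) (β j) 0 0 (x j) (y j)) (fun μ => A fun j => (μ j : ℝ) / n) ν).trans ?_
  simp only [jetForm, partialD_update, iteratedDerivWithin_zero, div_update]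

lemma exists_norm_kernel_line_le (hα : ∀ j, -1 / 2 ≤ α j) (hβ : ∀ j, -1 / 2 ≤ β j) {k : ℕ}
    (hk : 1 ≤ k) (ℓ : Fin d) : ∃ C : ℝ, 0 ≤ C ∧ ∀ (B : ℝ) (A : (Fin d → ℝ) → ℂ), IsCutoff k A →
      (∀ t ∈ orthant d, ‖partialD ℓ (3 * k - 1) A t‖ ≤ B) →
      ∀ (n : ℕ) (x y : Fin d → ℝ), 1 ≤ n → x ∈ Set.Icc (-1 : Fin d → ℝ) 1 →
      y ∈ Set.Icc (-1 : Fin d → ℝ) 1 →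
      ∀ ν ∈ Fintype.piFinset fun _ => range (2 * n + 1),
        (1 + n * |Real.arccos (x ℓ) - Real.arccos (y ℓ)|) ^ k * ‖∑ s ∈ range (2 * n + 1),
          (∏ j, jetCoeff (α j) (β j) 0 0 (x j) (y j) (update ν ℓ s j)) •
            A (fun j => ((update ν ℓ s j : ℕ) : ℝ) / n)‖ ≤
          C * B * n / (√(bigW α β n x) * √(bigW α β n y)) := by
  choose c hc coeff_le using fun j => exists_abs_jetCoeff_le (hα j) (hβ j) 0 0
  obtain ⟨U, hU, uni_le⟩ :=
    exists_one_add_pow_mul_norm_cutoff_kernel_le (E := ℂ) (hα ℓ) (hβ ℓ) hk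
  have : 0 ≤ ∏ j ∈ univ.erase ℓ, c j := prod_nonneg fun j _ => (hc j).le
  refine ⟨U * ∏ j ∈ univ.erase ℓ, c j, by positivity, fun B A hA hB n x y hn hx hy ν hν => ?_⟩
  have hxj (j) : x j ∈ Set.Icc (-1 : ℝ) 1 := ⟨hx.1 j, hx.2 j⟩
  have hyj (j) : y j ∈ Set.Icc (-1 : ℝ) 1 := ⟨hy.1 j, hy.2 j⟩
  have hνj (j) : ν j ≤ 2 * n := mem_range_succ_iff.mp (Fintype.mem_piFinset.mp hν j)
  have hn₀ : (0 : ℝ) < n := by exact_mod_cast hn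
  have cutoff := hA.isUniCutoff (t := fun j => (ν j : ℝ) / n) hB (fun j => by positivity)
    fun j => (div_le_iff₀ hn₀).mpr (by exact_mod_cast hνj j)
  have line_le := uni_le B _ n (x ℓ) (y ℓ) cutoff hn (hxj ℓ) (hyj ℓ)
  have off_line_le (j : Fin d) : |jetCoeff (α j) (β j) 0 0 (x j) (y j) (ν j)| ≤
      c j / (√(uniW (α j) (β j) n (x j)) * √(uniW (α j) (β j) n (y j))) := by
    simpa using coeff_le j n (ν j) (x j) (y j) 2 (by have := hνj j; omega)
      (isEndpointScale_two hn (hxj j) (hyj j))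
  rw [sum_kernel_line_eq, norm_smul, Real.norm_eq_abs, abs_prod, mul_left_comm,
    sqrt_bigW_mul_sqrt_bigW hn hx hy, ← mul_prod_erase univ _ (mem_univ ℓ)]
  refine (mul_le_mul (prod_le_prod (fun _ _ => abs_nonneg _) fun j _ => off_line_le j) line_le
    (by positivity) (prod_nonneg fun j _ => (abs_nonneg _).trans (off_line_le j))).trans_eq ?_
  rw [prod_div_distrib, div_mul_div_comm]
  ring

lemma exists_norm_kernel_le_of_coord (hα : ∀ j, -1 / 2 ≤ α j) (hβ : ∀ j, -1 / 2 ≤ β j) {k : ℕ}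
    (hk : 1 ≤ k) (ℓ : Fin d) : ∃ C : ℝ, 0 ≤ C ∧ ∀ (B : ℝ) (A : (Fin d → ℝ) → ℂ), IsCutoff k A →
      (∀ t ∈ orthant d, ‖partialD ℓ (3 * k - 1) A t‖ ≤ B) →
      ∀ (n : ℕ) (x y : Fin d → ℝ), 1 ≤ n → x ∈ Set.Icc (-1 : Fin d → ℝ) 1 →
        y ∈ Set.Icc (-1 : Fin d → ℝ) 1 →
        (1 + n * |Real.arccos (x ℓ) - Real.arccos (y ℓ)|) ^ k * ‖kernel α β A n x y‖ ≤
          C * B * n ^ d / (√(bigW α β n x) * √(bigW α β n y)) := by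
  obtain ⟨C, hC, line_le⟩ := exists_norm_kernel_line_le hα hβ hk ℓ
  refine ⟨3 ^ d * C, by positivity, fun B A hA hB n x y hn hx hy => ?_⟩
  have : 0 ≤ B := (norm_nonneg _).trans (hB 0 fun _ => le_rfl)
  rw [kernel_eq_sum (fun j => by linarith [hα j]) (fun j => by linarith [hβ j]) hA.supp hn]
  set S := √(bigW α β n x) * √(bigW α β n y)
  set R := (1 + n * |Real.arccos (x ℓ) - Real.arccos (y ℓ)|) ^ k
  have hR : 0 < R := by positivity
  have average := card_mul_norm_sum_piFinset_le (range (2 * n + 1)) ℓ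
    (F := fun ν => (∏ j, jetCoeff (α j) (β j) 0 0 (x j) (y j) (ν j)) • A fun j => (ν j : ℝ) / n)
    fun ν hν => (le_div_iff₀' hR).mpr (line_le B A hA hB n x y hn hx hy ν hν)
  rw [card_range, Fintype.card_fin, mul_div_assoc', le_div_iff₀' hR, mul_left_comm] at average
  have hK : (0 : ℝ) < (2 * n + 1 : ℕ) := by positivity
  have : (n : ℝ) ≤ (2 * n + 1 : ℕ) := by exact_mod_cast (by omega)
  have : ((2 * n + 1 : ℕ) : ℝ) ≤ 3 * n := by exact_mod_cast (by omega)
  refine le_of_mul_le_mul_left (average.trans ?_) hK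
  calc ((2 * n + 1 : ℕ) : ℝ) ^ d * (C * B * n / S)
      ≤ (3 * n) ^ d * (C * B * (2 * n + 1 : ℕ) / S) := by gcongr
    _ = _ := by
        rw [mul_pow]
        ring

lemma rho_nonneg (x y : Fin d → ℝ) : 0 ≤ rho x y :=
  Real.iSup_nonneg fun _ => abs_nonneg _

-- Localize in the coordinate in which `x` and `y` are farthest apart.
theorem exists_norm_kernel_le (hd : 1 ≤ d) (hα : ∀ j, -1 / 2 ≤ α j) (hβ : ∀ j, -1 / 2 ≤ β j)
    {k : ℕ} (hk : 1 ≤ k) (M : Fin d → ℝ) :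
    ∃ c : ℝ, 0 < c ∧ ∀ A : (Fin d → ℝ) → ℂ, IsCutoff k A →
      (∀ ℓ, ∀ t ∈ orthant d, ‖partialD ℓ (3 * k - 1) A t‖ ≤ M ℓ) →
      ∀ n : ℕ, 1 ≤ n → ∀ x ∈ Set.Icc (-1 : Fin d → ℝ) 1, ∀ y ∈ Set.Icc (-1 : Fin d → ℝ) 1,
        ‖kernel α β A n x y‖ ≤ c * (n : ℝ) ^ d / (√(bigW α β n x) * √(bigW α β n y)) *
          (1 + n * rho x y) ^ (-(k : ℝ)) := by
  choose C hC coord_le using fun ℓ => exists_norm_kernel_le_of_coord hα hβ hk ℓ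
  have term_nonneg (ℓ) : 0 ≤ C ℓ * |M ℓ| := mul_nonneg (hC ℓ) (abs_nonneg _)
  refine ⟨∑ ℓ, C ℓ * |M ℓ| + 1,
    add_pos_of_nonneg_of_pos (sum_nonneg fun ℓ _ => term_nonneg ℓ) one_pos,
    fun A hA hM n hn x hx y hy => ?_⟩
  have : Nonempty (Fin d) := ⟨⟨0, hd⟩⟩
  obtain ⟨ℓ, rho_eq⟩ : ∃ ℓ, |Real.arccos (x ℓ) - Real.arccos (y ℓ)| = rho x y :=
    exists_eq_ciSup_of_finite
  have := rho_nonneg x y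
  have hpos : 0 < 1 + n * rho x y := by positivity
  have le_coord := coord_le ℓ |M ℓ| A hA (fun t ht => (hM ℓ t ht).trans (le_abs_self _))
    n x y hn hx hy
  rw [rho_eq] at le_coord
  rw [Real.rpow_neg hpos.le, Real.rpow_natCast, ← div_eq_mul_inv, le_div_iff₀ (pow_pos hpos k),
    mul_comm]
  refine le_coord.trans ?_
  have : C ℓ * |M ℓ| ≤ ∑ ℓ, C ℓ * |M ℓ| + 1 :=
    (single_le_sum (f := fun ℓ => C ℓ * |M ℓ|) (fun j _ => term_nonneg j) (mem_univ ℓ)).trans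
      (by linarith)
  gcongr

theorem IsAdmissible.exists_norm_kernel_le (hd : 1 ≤ d) (hα : ∀ j, -1 / 2 ≤ α j)
    (hβ : ∀ j, -1 / 2 ≤ β j) (hA : IsAdmissible A) {κ : ℝ} (hκ : 0 < κ) : ∃ c : ℝ, 0 < c ∧
      ∀ n : ℕ, 1 ≤ n → ∀ x ∈ Set.Icc (-1 : Fin d → ℝ) 1, ∀ y ∈ Set.Icc (-1 : Fin d → ℝ) 1,
        ‖kernel α β A n x y‖ ≤ c * (n : ℝ) ^ d / (√(bigW α β n x) * √(bigW α β n y)) *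
          (1 + n * rho x y) ^ (-κ) := by
  choose M hM using fun ℓ => hA.exists_norm_partialD_le ℓ (3 * ⌈κ⌉₊ - 1)
  obtain ⟨c, hc, kernel_le⟩ :=
    TensorJacobi.exists_norm_kernel_le hd hα hβ (Nat.ceil_pos.mpr hκ) M
  refine ⟨c, hc, fun n hn x hx y hy => ?_⟩
  refine (kernel_le A (hA.isCutoff _) hM n hn x hx y hy).trans ?_
  have := rho_nonneg x y
  have : 1 ≤ 1 + n * rho x y := le_add_of_nonneg_right (by positivity)
  gcongr
  exact Nat.le_ceil κ

end TensorKernel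

end TensorJacobi

end

theorem mainTheorem1 (d : ℕ) (hd : 1 ≤ d) (α β : Fin d → ℝ)
    (hα : ∀ j, -(1 / 2 : ℝ) ≤ α j) (hβ : ∀ j, -(1 / 2 : ℝ) ≤ β j) :
    (∀ k : ℕ, 1 ≤ k → ∀ M : Fin d → ℝ, ∃ c : ℝ, 0 < c ∧
      ∀ A : (Fin d → ℝ) → ℂ, TensorJacobi.IsCutoff k A →
        (∀ ℓ, ∀ t ∈ TensorJacobi.orthant d, ‖TensorJacobi.partialD ℓ (3 * k - 1) A t‖ ≤ M ℓ) →
        ∀ n : ℕ, 1 ≤ n → ∀ x ∈ Set.Icc (-1 : Fin d → ℝ) 1, ∀ y ∈ Set.Icc (-1 : Fin d → ℝ) 1,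
          ‖TensorJacobi.kernel α β A n x y‖ ≤
            c * (n : ℝ) ^ d /
              (√(TensorJacobi.bigW α β n x) * √(TensorJacobi.bigW α β n y)) *
              (1 + n * TensorJacobi.rho x y) ^ (-(k : ℝ))) ∧
    (∀ A : (Fin d → ℝ) → ℂ, TensorJacobi.IsAdmissible A →
      ∀ κ : ℝ, 0 < κ → ∃ c : ℝ, 0 < c ∧
        ∀ n : ℕ, 1 ≤ n → ∀ x ∈ Set.Icc (-1 : Fin d → ℝ) 1, ∀ y ∈ Set.Icc (-1 : Fin d → ℝ) 1,
          ‖TensorJacobi.kernel α β A n x y‖ ≤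
            c * (n : ℝ) ^ d /
              (√(TensorJacobi.bigW α β n x) * √(TensorJacobi.bigW α β n y)) *
              (1 + n * TensorJacobi.rho x y) ^ (-κ)) := by
  have hα' : ∀ j, -1 / 2 ≤ α j := fun j => by linarith [hα j]
  have hβ' : ∀ j, -1 / 2 ≤ β j := fun j => by linarith [hβ j]
  exact ⟨fun k hk M => TensorJacobi.exists_norm_kernel_le hd hα' hβ' hk M,
    fun A hA κ hκ => hA.exists_norm_kernel_le hd hα' hβ' hκ⟩
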